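/- **Setting.** Let $T>0$, $\mathbb T=\mathbb R/T\mathbb Z$, $n\ge 1$, $G=\mathbb T\times\mathbb R^n$, $G_+=\mathbb T\times\{x\in\mathbb R^n: x_n>0\}$, $G^{n-1}=\mathbb T\times\mathbb R^{n-1}$. For a strictly positive order function $\mu:(0,\infty)\to\mathbb R$ (a maximum of finitely many functions $\gamma\mapsto r+\gamma s$ with $r,s\ge 0$) let $\mathcal N(\mu)$ be its Newton polygon: the convex hull of $(0,0)$ and of the points $(b,m),(b,0),(0,m)$, where $\gamma\mapsto b+\gamma m$ runs through the linear pieces of $\mu$. Put $\langle y\rangle=(1+|y|^2)^{1/2}$ and $$w_\mu(\tau,\xi)=\sum_{(r,s)\text{ vertex of }\mathcal N(\mu)}\langle\tau\rangle^{s}\langle\xi\rangle^{r}.$$ The Newton polygon space $H^\mu(\mathbb T\times\mathbb R^m)$ is $\mathsf{op}[1/w_\mu]L^2(\mathbb T\times\mathbb R^m)$, with norm $\|f\|_\mu=\|\mathsf{op}[w_\mu]f\|_{L^2}$, where $\mathsf{op}[w]$ is the Fourier multiplier on $\mathbb T\times\mathbb R^m$ with symbol $w$, evaluated at $(\tau,\xi)\in\frac{2\pi}{T}\mathbb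 Z\times\mathbb R^m$. $H^\mu_\perp$ is its closed subspace of functions $f$ with vanishing time average, $\int_{\mathbb T}f(t,\cdot)\,dt=0$. The space $\overline H{}^\mu_\perp(G_+)$ consists of the restrictions $r^+F$ to $G_+$ of all $F\in H^\mu_\perp(G)$, with the quotient norm. Let $r_1>r_2\ge 0$ be integers, let $s_2\ge 0$ be real, and let $\mu(\gamma)=\max\{r_1,\,r_2+\gamma s_2\}$ be the order function of the Newton polygon with vertices $(0,0),(r_1,0),(r_2,s_2),(0,s_2)$ (a "CHG-shaped" order function). With $y=s_2/(r_1-r_2)$ and $o_y(\gamma)=\max\{1,y\gamma\}$, put for $j=0,\dots,r_1-1$ $$T_j(\mu)=\begin{cases}(r_1-r_2)\,o_y+r_2-j-\tfrac12, & j<r_2,\\ (r_1-j-\tfrac12)\,o_y, & j\ge r_2.\end{cases}$$ **Theorem.** 1. For each $j\in\{0,\dots,r_1-1\}$, the Newton polygon of $T_j(\mu)$ is $\mathcal N(\mu)$ translated to the left by $j+\frac12$ and cut to the first quadrant: $$\mathcal N(T_j(\mu))=\{(r,s)\in[0,\infty)^2:(r+j+\tfrac12,\,s)\in\mathcal N(\mu)\}.$$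 2. There is a bounded linear operator $$\mathsf{Tr}^{(r_1)}=(\mathsf{Tr}_0,\dots,\mathsf{Tr}_{r_1-1}):\ \overline H{}^\mu_\perp(G_+)\to\prod_{j=0}^{r_1-1}H^{T_j(\mu)}_\perp(G^{n-1})$$ that extends the classical traces: every $\varphi\in C_c^\infty(G)$ with vanishing time average lies in $H^\mu_\perp(G)$, and $\mathsf{Tr}_j(r^+\varphi)(t,x')=\partial_n^j\varphi(t,x',0)$ for all $j$. Consequently $\mathsf{Tr}^{(r_1)}\circ r^+$ is bounded on $H^\mu_\perp(G)$. 3. $\mathsf{Tr}^{(r_1)}$ is onto, and there is a bounded linear operator $E^\mu:\prod_{j=0}^{r_1-1}H^{T_j(\mu)}_\perp(G^{n-1})\to H^\mu_\perp(G)$ with $\mathsf{Tr}^{(r_1)}(r^+E^\mu\sigma)=\sigma$ for all $\sigma$. Thus $E^\mu$ and $r^+E^\mu$ are bounded right inverses of the trace on $H^\mu_\perp(G)$ and on $\overline H{}^\mu_\perp(G_+)$. -/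

import Mathlib

open MeasureTheory Set
open scoped ENNReal FourierTransform

noncomputable section

namespace NewtonTrace

/-! ### Newton polygons and order functions

A point `(r, s)` of the plane records the exponent `r` of `|ξ|` and the exponent `s` of `|τ|`.
Order functions are only considered on `(0, ∞)`. -/

/-- The Newton polygon `𝒩(E)` of a set `E`: the convex hull of `E`, of the projections of its
elements to the two coordinate axes, and of the origin. -/
def newtonPolygon (E : Set (ℝ × ℝ)) : Set (ℝ × ℝ) :=
  convexHull ℝ (E ∪ (fun p => (p.1, 0)) '' E ∪ (fun p => (0, p.2)) '' E ∪ {0})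

/-- The set of vertices of a convex polygon. -/
def vertices (N : Set (ℝ × ℝ)) : Set (ℝ × ℝ) := N.extremePoints ℝ

/-- The order function `γ ↦ max {r + γ s | (r, s) ∈ V}` of the polygon with vertex set `V`. -/
def polygonOrder (V : Set (ℝ × ℝ)) (γ : ℝ) : ℝ := sSup ((fun p => p.1 + γ * p.2) '' V)

/-- The coefficient pairs `(b, m)` of the linear pieces `γ ↦ b + γ m` of a piecewise linear
function `μ` on `(0, ∞)`. -/
def linearPieces (μ : ℝ → ℝ) : Set (ℝ × ℝ) :=
  {p | ∃ a b : ℝ, 0 ≤ a ∧ a < b ∧ ∀ γ ∈ Ioo a b, μ γ = p.1 + γ * p.2}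

/-- The Newton polygon `𝒩(μ)` of a strictly positive order function `μ`. -/
def orderPolygon (μ : ℝ → ℝ) : Set (ℝ × ℝ) := newtonPolygon (linearPieces μ)

/-- The smooth weight function `w_μ(τ, ξ) = ∑ ⟨τ⟩ ^ s * ⟨ξ⟩ ^ r`, the (finite) sum being over the
vertices `(r, s)` of the Newton polygon of `μ`.  It depends on `ξ` through `|ξ|` only, and the
argument `ρ` stands for `|ξ|`. -/
def weight (μ : ℝ → ℝ) (τ ρ : ℝ) : ℝ :=
  ∑ᶠ p ∈ vertices (orderPolygon μ), (1 + τ ^ 2) ^ (p.2 / 2) * (1 + ρ ^ 2) ^ (p.1 / 2)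

theorem measurable_weight (μ : ℝ → ℝ) (τ : ℝ) : Measurable (weight μ τ) := by
  by_cases h : (vertices (orderPolygon μ)).Finite
  · have e : weight μ τ = fun ρ => ∑ p ∈ h.toFinset,
        (1 + τ ^ 2) ^ (p.2 / 2) * (1 + ρ ^ 2) ^ (p.1 / 2) := by
      funext ρ
      exact finsum_mem_eq_finite_toFinset_sum _ h
    rw [e]
    fun_prop
  · have e : weight μ τ = fun _ => 0 := by
      funext ρ
      refine finsum_mem_eq_zero_of_infinite ?_
      refine Set.Infinite.mono (fun p hp => ⟨hp, ?_⟩) h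
      exact (by positivity : (0 : ℝ) < (1 + τ ^ 2) ^ (p.2 / 2) * (1 + ρ ^ 2) ^ (p.1 / 2)).ne'
    rw [e]
    exact measurable_const

/-- The elementary order functions `o_y(γ) = max {1, y γ}`. -/
def elementaryOrder (y γ : ℝ) : ℝ := max 1 (y * γ)

/-- The CHG-shaped order function: the one of the Newton polygon with vertices
`(0, 0)`, `(r₁, 0)`, `(r₂, s₂)`, `(0, s₂)`. -/
def chgOrder (r₁ r₂ : ℕ) (s₂ : ℝ) : ℝ → ℝ :=
  polygonOrder {((0 : ℝ), (0 : ℝ)), ((r₁ : ℝ), (0 : ℝ)), ((r₂ : ℝ), s₂), ((0 : ℝ), s₂)}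

/-- The order functions `T_j(μ)` of the trace spaces, for `μ = chgOrder r₁ r₂ s₂`; the number
`s₂ / (r₁ - r₂)` is minus the slope of the segment from `(r₁, 0)` to `(r₂, s₂)`. -/
def traceOrder (r₁ r₂ : ℕ) (s₂ : ℝ) (j : ℕ) (γ : ℝ) : ℝ :=
  if j < r₂ then
    ((r₁ : ℝ) - r₂) * elementaryOrder (s₂ / ((r₁ : ℝ) - r₂)) γ + ((r₂ : ℝ) - j - 1 / 2)
  else
    ((r₁ : ℝ) - j - 1 / 2) * elementaryOrder (s₂ / ((r₁ : ℝ) - r₂)) γ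

/-! ### The group `G = 𝕋 × ℝⁿ` and the Fourier transform on `L²(G)` -/

/-- The group `𝕋 × ℝⁿ`, where `𝕋 = ℝ / T ℤ`. -/
abbrev TorusSpace (T : ℝ) (n : ℕ) : Type := AddCircle T × EuclideanSpace ℝ (Fin n)

variable {T : ℝ} [hT : Fact (0 < T)] {n : ℕ}

variable (T n) in
/-- The product of the (normalized) Haar measure of `𝕋` and of the Lebesgue measure of `ℝⁿ`. -/
def torusMeasure : Measure (TorusSpace T n) :=
  (AddCircle.haarAddCircle (T := T)).prod volume

instance : SFinite (torusMeasure T n) := by unfold torusMeasure; infer_instance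

variable (T n) in
/-- The Hilbert space `L²(𝕋 × ℝⁿ)`. -/
abbrev L2G : Type := Lp ℂ 2 (torusMeasure T n)

theorem memLp_timeCoeff {f : TorusSpace T n → ℂ} (hf : MemLp f 2 (torusMeasure T n)) (k : ℤ) :
    MemLp (fun x => fourierCoeff (fun t => f (t, x)) k) 2 volume := by
  have hm : AEStronglyMeasurable (fun p : TorusSpace T n => fourier (-k) p.1 • f p)
      (torusMeasure T n) :=
    (((fourier (-k)).continuous.comp continuous_fst).aestronglyMeasurable).smul hf.1
  have hm' := (hm : AEStronglyMeasurable _ ((AddCircle.haarAddCircle (T := T)).prod volume)).prod_swap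
  refine ⟨hm'.integral_prod_right', ?_⟩
  have hs : ∀ᵐ x : EuclideanSpace ℝ (Fin n) ∂volume,
      AEStronglyMeasurable (fun t => fourier (-k) t • f (t, x))
        (AddCircle.haarAddCircle (T := T)) := hm'.prodMk_left
  have h2 := hf.2
  rw [eLpNorm_lt_top_iff_lintegral_rpow_enorm_lt_top (by norm_num) (by norm_num)] at h2 ⊢
  refine lt_of_le_of_lt ?_ h2
  unfold torusMeasure
  rw [lintegral_prod_symm _
    ((hf.1 : AEStronglyMeasurable f ((AddCircle.haarAddCircle (T := T)).prod volume)).enorm.pow_const _)]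
  refine lintegral_mono_ae ?_
  filter_upwards [hs] with x hx
  have h3 : ‖fourierCoeff (fun t => f (t, x)) k‖ₑ ≤
      eLpNorm (fun t => fourier (-k) t • f (t, x)) 2 (AddCircle.haarAddCircle (T := T)) := by
    refine le_trans (enorm_integral_le_lintegral_enorm _) ?_
    rw [← eLpNorm_one_eq_lintegral_enorm]
    exact eLpNorm_le_eLpNorm_of_exponent_le (by norm_num) hx
  refine le_trans (ENNReal.rpow_le_rpow h3 (by norm_num)) ?_
  rw [eLpNorm_eq_lintegral_rpow_enorm_toReal (by norm_num) (by norm_num), ← ENNReal.rpow_mul]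
  have h4 : ∀ t : AddCircle T, ‖fourier (-k) t‖ₑ = 1 := fun t => by
    rw [← ofReal_norm, fourier_apply, Circle.norm_coe, ENNReal.ofReal_one]
  simp only [enorm_smul, h4, one_mul]
  norm_num

/-- The `k`-th Fourier coefficient in time, `x ↦ ∫ f(t, x) exp (- 2 π i k t / T) dt`, of an
element of `L²(𝕋 × ℝⁿ)`. -/
def timeCoeff (f : L2G T n) (k : ℤ) : Lp ℂ 2 (volume : Measure (EuclideanSpace ℝ (Fin n))) :=
  (memLp_timeCoeff (Lp.memLp f) k).toLp _

theorem ae_slice {u v : TorusSpace T n → ℂ} (h : u =ᵐ[torusMeasure T n] v) :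
    ∀ᵐ x : EuclideanSpace ℝ (Fin n) ∂volume,
      (fun t => u (t, x)) =ᵐ[AddCircle.haarAddCircle (T := T)] fun t => v (t, x) := by
  have h1 : ∀ᵐ q ∂((volume : Measure (EuclideanSpace ℝ (Fin n))).prod
      (AddCircle.haarAddCircle (T := T))), u q.swap = v q.swap := by
    have h2 : Filter.Eventually (fun p => u p = v p)
      (ae ((AddCircle.haarAddCircle (T := T)).prod
        (volume : Measure (EuclideanSpace ℝ (Fin n))))) := h
    exact Measure.measurePreserving_swap.quasiMeasurePreserving.ae h2
  exact Measure.ae_ae_of_ae_prod h1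

theorem ae_integrable_slice (f : L2G T n) :
    ∀ᵐ x : EuclideanSpace ℝ (Fin n) ∂volume,
      Integrable (fun t => f (t, x)) (AddCircle.haarAddCircle (T := T)) := by
  have hf : MemLp f 2 ((AddCircle.haarAddCircle (T := T)).prod
    (volume : Measure (EuclideanSpace ℝ (Fin n)))) := Lp.memLp f
  have hi := (hf.integrable_norm_pow (by norm_num)).swap.prod_right_ae
  have hs := hf.1.prod_swap.prodMk_left
  filter_upwards [hi, hs] with x hx hx'
  have h2 : MemLp (fun t => f (t, x)) 2 (AddCircle.haarAddCircle (T := T)) :=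
    (memLp_two_iff_integrable_sq_norm hx').2 hx
  exact h2.integrable (by norm_num)

theorem timeCoeff_add (f g : L2G T n) (k : ℤ) :
    timeCoeff (f + g) k = timeCoeff f k + timeCoeff g k := by
  unfold timeCoeff
  rw [← MemLp.toLp_add]
  refine MemLp.toLp_congr _ _ ?_
  filter_upwards [ae_slice (Lp.coeFn_add f g), ae_integrable_slice f, ae_integrable_slice g]
    with x hx hf hg
  have e : fourierCoeff (fun t => (f + g : L2G T n) (t, x)) k =
      fourierCoeff ((fun t => f (t, x)) + fun t => g (t, x)) k := by
    refine integral_congr_ae ?_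
    filter_upwards [hx] with t ht
    simp only [ht, Pi.add_apply]
  rw [e, fourierCoeff.add hf hg]
  rfl

theorem timeCoeff_smul (c : ℂ) (f : L2G T n) (k : ℤ) :
    timeCoeff (c • f) k = c • timeCoeff f k := by
  unfold timeCoeff
  rw [← MemLp.toLp_const_smul]
  refine MemLp.toLp_congr _ _ ?_
  filter_upwards [ae_slice (Lp.coeFn_smul c f)] with x hx
  have e : fourierCoeff (fun t => (c • f : L2G T n) (t, x)) k =
      fourierCoeff (c • fun t => f (t, x)) k := by
    refine integral_congr_ae ?_
    filter_upwards [hx] with t ht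
    simp only [ht, Pi.smul_apply]
  rw [e, fourierCoeff.const_smul]
  rfl

/-- The Fourier transform `L²(𝕋 × ℝⁿ) → L²(ℤ × ℝⁿ)`: Fourier coefficients in time, followed by
the Fourier transform of `L²(ℝⁿ)`.  In the normalization of Mathlib, `fourierG f k ξ` belongs to the
character `(t, x) ↦ exp (i (2 π k / T) t + i (2 π ξ) · x)`. -/
def fourierG (f : L2G T n) (k : ℤ) : Lp ℂ 2 (volume : Measure (EuclideanSpace ℝ (Fin n))) :=
  𝓕 (timeCoeff f k)

/-! ### Newton polygon potential spaces -/

/-- The norm `‖f‖_μ = ‖op[w_μ] f‖_{L²(G)}`, expressed by Plancherel's theorem; it is `∞` if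
`f ∉ H^μ(G)`. -/
def polyNorm (μ : ℝ → ℝ) (f : L2G T n) : ℝ≥0∞ :=
  (∑' k : ℤ, ∫⁻ ξ : EuclideanSpace ℝ (Fin n),
    (ENNReal.ofReal (weight μ (2 * Real.pi * k / T) (2 * Real.pi * ‖ξ‖)) *
      ‖fourierG f k ξ‖ₑ) ^ (2 : ℝ)) ^ (1 / 2 : ℝ)

theorem fourierG_add (f g : L2G T n) (k : ℤ) : fourierG (f + g) k = fourierG f k + fourierG g k := by
  unfold fourierG
  rw [timeCoeff_add, FourierTransform.fourier_add]

theorem fourierG_smul (c : ℂ) (f : L2G T n) (k : ℤ) : fourierG (c • f) k = c • fourierG f k := by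
  unfold fourierG
  rw [timeCoeff_smul, FourierTransform.fourier_smul]

theorem polyNorm_lt_top_iff (μ : ℝ → ℝ) (f : L2G T n) : polyNorm μ f < ⊤ ↔
    ∑' k : ℤ, ∫⁻ ξ : EuclideanSpace ℝ (Fin n),
      (ENNReal.ofReal (weight μ (2 * Real.pi * k / T) (2 * Real.pi * ‖ξ‖)) *
        ‖fourierG f k ξ‖ₑ) ^ (2 : ℝ) < ⊤ :=
  ENNReal.rpow_lt_top_iff_of_pos (by norm_num)

theorem polyNorm_zero_lt_top (μ : ℝ → ℝ) : polyNorm μ (0 : L2G T n) < ⊤ := by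
  rw [polyNorm_lt_top_iff]
  have h0 : ∀ k : ℤ, fourierG (0 : L2G T n) k = 0 := fun k => by
    simpa using fourierG_smul (0 : ℂ) (0 : L2G T n) k
  have h1 : ∀ k : ℤ, ∫⁻ ξ : EuclideanSpace ℝ (Fin n),
      (ENNReal.ofReal (weight μ (2 * Real.pi * k / T) (2 * Real.pi * ‖ξ‖)) *
        ‖fourierG (0 : L2G T n) k ξ‖ₑ) ^ (2 : ℝ) = 0 := fun k => by
    rw [← lintegral_zero (μ := (volume : Measure (EuclideanSpace ℝ (Fin n))))]
    refine lintegral_congr_ae ?_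
    rw [h0]
    filter_upwards [Lp.coeFn_zero ℂ 2 (volume : Measure (EuclideanSpace ℝ (Fin n)))] with ξ hξ
    rw [hξ]
    simp
  rw [tsum_congr h1, tsum_zero]
  exact ENNReal.zero_lt_top

theorem polyNorm_smul_lt_top (μ : ℝ → ℝ) (c : ℂ) {f : L2G T n} (hf : polyNorm μ f < ⊤) :
    polyNorm μ (c • f) < ⊤ := by
  rw [polyNorm_lt_top_iff] at hf ⊢
  have hc : ‖c‖ₑ ^ (2 : ℝ) ≠ ⊤ := ENNReal.rpow_ne_top_of_nonneg (by norm_num) enorm_ne_top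
  refine lt_of_le_of_lt ?_ (ENNReal.mul_lt_top hc.lt_top hf)
  rw [← ENNReal.tsum_mul_left]
  refine ENNReal.tsum_le_tsum fun k => ?_
  rw [← lintegral_const_mul' _ _ hc]
  refine lintegral_mono_ae ?_
  rw [fourierG_smul]
  filter_upwards [Lp.coeFn_smul c (fourierG f k)] with ξ hξ
  rw [hξ, Pi.smul_apply, enorm_smul, ← ENNReal.mul_rpow_of_nonneg _ _ (by norm_num),
    mul_left_comm]

theorem polyNorm_add_lt_top (μ : ℝ → ℝ) {f g : L2G T n} (hf : polyNorm μ f < ⊤)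
    (hg : polyNorm μ g < ⊤) : polyNorm μ (f + g) < ⊤ := by
  rw [polyNorm_lt_top_iff] at hf hg ⊢
  have hc : (2 : ℝ≥0∞) ^ ((2 : ℝ) - 1) ≠ ⊤ :=
    ENNReal.rpow_ne_top_of_nonneg (by norm_num) (by norm_num)
  refine lt_of_le_of_lt ?_ (ENNReal.mul_lt_top hc.lt_top (ENNReal.add_lt_top.2 ⟨hf, hg⟩))
  rw [← ENNReal.tsum_add, ← ENNReal.tsum_mul_left]
  refine ENNReal.tsum_le_tsum fun k => ?_
  have hw : Measurable fun ξ : EuclideanSpace ℝ (Fin n) =>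
      ENNReal.ofReal (weight μ (2 * Real.pi * k / T) (2 * Real.pi * ‖ξ‖)) :=
    (measurable_weight μ _).comp (measurable_norm.const_mul _) |>.ennreal_ofReal
  have hm := (hw.aemeasurable.mul (Lp.aestronglyMeasurable (fourierG f k)).enorm).pow_const (2 : ℝ)
  simp only [Pi.mul_apply] at hm
  rw [← lintegral_add_left' hm, ← lintegral_const_mul' _ _ hc]
  refine lintegral_mono_ae ?_
  rw [fourierG_add]
  filter_upwards [Lp.coeFn_add (fourierG f k) (fourierG g k)] with ξ hξ
  rw [hξ, Pi.add_apply]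
  refine le_trans (ENNReal.rpow_le_rpow (mul_le_mul_right (enorm_add_le _ _) _) (by norm_num)) ?_
  rw [mul_add]
  exact ENNReal.rpow_add_le_mul_rpow_add_rpow _ _ (by norm_num)

variable (T n) in
/-- The Newton polygon potential space `H^μ(𝕋 × ℝⁿ) = op[1 / w_μ] L²(𝕋 × ℝⁿ)` of a strictly
positive order function `μ`. -/
def HSpace (μ : ℝ → ℝ) : Submodule ℂ (L2G T n) where
  carrier := {f | polyNorm μ f < ⊤}
  zero_mem' := polyNorm_zero_lt_top μ
  add_mem' := fun hf hg => polyNorm_add_lt_top μ hf hg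
  smul_mem' := fun c _ hf => polyNorm_smul_lt_top μ c hf

variable (T n) in
/-- The purely oscillatory elements of `L²(𝕋 × ℝⁿ)`: those with vanishing time average
`x ↦ ∫ f(t, x) dt`. -/
def oscillatory : Submodule ℂ (L2G T n) where
  carrier := {f | timeCoeff f 0 = 0}
  zero_mem' := by
    have h := timeCoeff_smul (T := T) (n := n) 0 0 0
    simpa using h
  add_mem' := fun {f g} hf hg => by
    simp only [mem_ofPred_eq] at hf hg ⊢
    rw [timeCoeff_add, hf, hg, add_zero]
  smul_mem' := fun c f hf => by
    simp only [mem_ofPred_eq] at hf ⊢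
    rw [timeCoeff_smul, hf, smul_zero]

variable (T n) in
/-- The purely oscillatory Newton polygon space `H^μ_⊥(𝕋 × ℝⁿ)`. -/
def HPerp (μ : ℝ → ℝ) : Submodule ℂ (L2G T n) := HSpace T n μ ⊓ oscillatory T n

/-! ### The half space `G₊ = 𝕋 × ℝⁿ₊`, with `n = d + 1` -/

variable {d : ℕ}

variable (T d) in
/-- The half space `{(t, x) | 0 < x_n}`. -/
def halfSpace : Set (TorusSpace T (d + 1)) := {p | 0 < p.2 (Fin.last d)}

variable (T d) in
/-- The Hilbert space `L²(G₊)`. -/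
abbrev L2Half : Type := Lp ℂ 2 ((torusMeasure T (d + 1)).restrict (halfSpace T d))

variable (T d) in
/-- The restriction `r⁺ : L²(G) → L²(G₊)`. -/
def restrictL2 : L2G T (d + 1) →ₗ[ℂ] L2Half T d :=
  (LpToLpRestrictCLM (TorusSpace T (d + 1)) ℂ ℂ (torusMeasure T (d + 1)) 2
    (halfSpace T d)).toLinearMap

variable (T d) in
/-- The restricted space `H̄^μ_⊥(G₊) = r⁺ H^μ_⊥(G)`. -/
def HBarPerp (μ : ℝ → ℝ) : Submodule ℂ (L2Half T d) :=
  (HPerp T (d + 1) μ).map (restrictL2 T d)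

/-- The quotient norm of the restricted space `H̄^μ_⊥(G₊)`. -/
def barNorm (μ : ℝ → ℝ) (f : L2Half T d) : ℝ≥0∞ :=
  ⨅ F ∈ {F : L2G T (d + 1) | F ∈ HPerp T (d + 1) μ ∧ restrictL2 T d F = f}, polyNorm μ F

variable (T d) in
/-- The restriction `r⁺ : H^μ_⊥(G) → H̄^μ_⊥(G₊)`. -/
def restrictPerp (μ : ℝ → ℝ) : HPerp T (d + 1) μ →ₗ[ℂ] HBarPerp T d μ :=
  (restrictL2 T d).submoduleMap (HPerp T (d + 1) μ)

/-! ### Traces -/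

variable (T d) in
/-- The trace space `∏_{j < r₁} H^{T_j(μ)}_⊥(𝕋 × ℝⁿ⁻¹)`, where `n = d + 1` and
`μ = chgOrder r₁ r₂ s₂`. -/
abbrev TraceSpace (r₁ r₂ : ℕ) (s₂ : ℝ) : Type :=
  (j : Fin r₁) → HPerp T d (traceOrder r₁ r₂ s₂ j)

/-- The norm of the product space `∏_{j < r₁} H^{T_j(μ)}_⊥(𝕋 × ℝⁿ⁻¹)`. -/
def traceNorm {r₁ r₂ : ℕ} {s₂ : ℝ} (σ : TraceSpace T d r₁ r₂ s₂) : ℝ≥0∞ :=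
  ∑ j : Fin r₁, polyNorm (traceOrder r₁ r₂ s₂ j) (σ j : L2G T d)

/-- The point `(x', x_n)` of `ℝᵈ⁺¹`. -/
def joinLast (x' : EuclideanSpace ℝ (Fin d)) (s : ℝ) : EuclideanSpace ℝ (Fin (d + 1)) :=
  WithLp.toLp 2 (Fin.snoc (α := fun _ => ℝ) (fun i => x' i) s)

/-- The classical trace `(t, x') ↦ ∂_n^j φ(t, x', 0)`. -/
def classicalTrace (j : ℕ) (φ : TorusSpace T (d + 1) → ℂ) : TorusSpace T d → ℂ :=
  fun p => iteratedDeriv j (fun s : ℝ => φ (p.1, joinLast p.2 s)) 0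

/-- Test functions in `C_c^∞(𝕋 × ℝⁿ)` with vanishing time average; smoothness is smoothness of the
lift to `ℝ × ℝⁿ`. -/
structure IsOscillatoryTest (φ : TorusSpace T n → ℂ) : Prop where
  smooth : ContDiff ℝ (⊤ : ℕ∞) fun p : ℝ × EuclideanSpace ℝ (Fin n) => φ ((p.1 : AddCircle T), p.2)
  compact : HasCompactSupport φ
  mean_zero : ∀ x, ∫ t, φ (t, x) ∂(AddCircle.haarAddCircle (T := T)) = 0

end NewtonTrace

end

open NewtonTrace

/-! Fourier series in time and the Fourier transform in space turn every norm into a weighted `L²`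
norm over `ℤ × ℝⁿ`, and the trace of order `j` into the integral of `(2πis)^j û(k, x, s)` over the
normal frequency `s` (`IsTrace`). The theorem becomes a family of one-dimensional estimates in `s`,
which must be uniform in `k` and in the tangential frequency `x`.

Only the size of the weights matters. By convexity a weight is comparable to its largest monomial.
With `X = 1 + (2π|x|)²`, `Q = ⟨τ⟩^(2y)` and `z = (2πs)²`, the squared weight of `μ` is comparable to
`(X + z)^r₂ * max (X + z) Q ^ (r₁ - r₂)` (`chgSymbol`), that of `T_j(μ)` to `traceSymbol`. The
squared normal frequency scale for order `j` is `L = X` if `j < r₂` and `L = max X Q` otherwise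
(`traceScale`): this dichotomy is the one in the definition of `T_j`.

Boundedness of the trace is a weighted Cauchy–Schwarz inequality in `s`. By
`pow_mul_traceSymbol_le`, `z^j * traceSymbol` is at most `chgSymbol` times a Poisson kernel of scale
`√L`, normalized to total mass one.

For the extension, `v̂(k, x)` is multiplied by a kernel in `s` supported in `|2πs| ≤ √L`, a rescaled
profile with `j`-th moment one and all other moments of order below `r₁` zero
(`exists_dual_moments`). On the support `chgSymbol` is at most a constant times `L^(j + 1/2) *
traceSymbol` (`chgSymbol_le_traceSymbol`), and the squared `L²` norm of the kernel supplies the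
factor `L^-(j + 1/2)`. Since the other traces of each extension vanish, the extensions of the
separate data can be added.

The trace descends to the half space because a function vanishing on `x_n > 0` has zero trace: the
partial transforms are tested against bumps in `(0, ∞)` shrinking to the origin
(`ae_trace_eq_zero`). It agrees with the classical trace by Fourier inversion in `x_n` at the point
`0` (`fourier_slice`). -/

namespace NewtonTrace

/-! ### The polygons of two-piece order functions -/

/-- The trapezoid with vertices `(0, 0)`, `(α, 0)`, `(β, s)`, `(0, s)`. -/
def trapezoid (α β s : ℝ) : Set (ℝ × ℝ) :=
  {p | ∃ θ ∈ Icc (0 : ℝ) 1, p.2 = θ * s ∧ 0 ≤ p.1 ∧ p.1 ≤ α - (α - β) * θ}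

theorem convex_trapezoid (α β s : ℝ) : Convex ℝ (trapezoid α β s) := by
  rintro p ⟨θ, ⟨h0, h1⟩, h2, h3, h4⟩ q ⟨η, ⟨g0, g1⟩, g2, g3, g4⟩ a b ha hb hab
  refine ⟨a * θ + b * η, ⟨by positivity, by nlinarith⟩, ?_, ?_, ?_⟩
  · simp only [Prod.snd_add, Prod.smul_snd, smul_eq_mul, h2, g2]
    ring
  · simp only [Prod.fst_add, Prod.smul_fst, smul_eq_mul]
    positivity
  · simp only [Prod.fst_add, Prod.smul_fst, smul_eq_mul]
    have e : α - (α - β) * (a * θ + b * η) =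
        a * (α - (α - β) * θ) + b * (α - (α - β) * η) := by
      linear_combination (-α) * hab
    rw [e]
    gcongr

theorem mem_segment_zero {x y r : ℝ} (h0 : 0 ≤ r) (h1 : r ≤ x) :
    ((r, y) : ℝ × ℝ) ∈ segment ℝ ((0 : ℝ), y) (x, y) := by
  rcases h0.eq_or_lt with rfl | h0
  · exact left_mem_segment _ _ _
  · have hx : 0 < x := h0.trans_le h1
    refine ⟨1 - r / x, r / x, sub_nonneg.2 ((div_le_one hx).2 h1), by positivity, by ring, ?_⟩
    ext
    · simp [hx.ne']
    · simp only [Prod.snd_add, Prod.smul_snd, smul_eq_mul]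
      ring

/-- Every horizontal slice is a segment whose ends lie on the left and on the slanted side, and
these sides are segments between the given points. -/
theorem trapezoid_subset {α β s : ℝ} {K : Set (ℝ × ℝ)} (hK : Convex ℝ K)
    (h0 : ((0 : ℝ), (0 : ℝ)) ∈ K) (h1 : (α, (0 : ℝ)) ∈ K) (h2 : (β, s) ∈ K)
    (h3 : ((0 : ℝ), s) ∈ K) : trapezoid α β s ⊆ K := by
  rintro ⟨r, σ⟩ ⟨θ, ⟨g0, g1⟩, rfl, g3, g4⟩
  have hl : ((0 : ℝ), θ * s) ∈ K := by
    have := hK h0 h3 (sub_nonneg.2 g1) g0 (by ring)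
    simpa using this
  have hr : (α - (α - β) * θ, θ * s) ∈ K := by
    have := hK h1 h2 (sub_nonneg.2 g1) g0 (by ring)
    convert this using 1
    ext
    · simp only [Prod.fst_add, Prod.smul_fst, smul_eq_mul]
      ring
    · simp
  exact hK.segment_subset hl hr (mem_segment_zero g3 g4)

section vertices

variable {α β s : ℝ}

theorem trapezoid_zero_mem (hα : 0 ≤ α) : ((0 : ℝ), (0 : ℝ)) ∈ trapezoid α β s :=
  ⟨0, by simp, by simp, le_rfl, by simpa⟩

theorem trapezoid_right_mem (hα : 0 ≤ α) : (α, (0 : ℝ)) ∈ trapezoid α β s :=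
  ⟨0, by simp, by simp, hα, by simp⟩

theorem trapezoid_top_mem (hβ : 0 ≤ β) : (β, s) ∈ trapezoid α β s :=
  ⟨1, by simp, by simp, hβ, by simp⟩

theorem trapezoid_left_mem (hβ : 0 ≤ β) : ((0 : ℝ), s) ∈ trapezoid α β s :=
  ⟨1, by simp, by simp, le_rfl, by simpa⟩

theorem trapezoid_eq_convexHull (hβ : 0 ≤ β) (hαβ : β ≤ α) :
    trapezoid α β s = convexHull ℝ {((0 : ℝ), (0 : ℝ)), (α, 0), (β, s), (0, s)} := by
  refine Subset.antisymm (trapezoid_subset (convex_convexHull ℝ _) ?_ ?_ ?_ ?_)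
    (convexHull_min ?_ (convex_trapezoid _ _ _))
  iterate 4 exact subset_convexHull ℝ _ (by simp)
  rintro p (rfl | rfl | rfl | rfl)
  · exact trapezoid_zero_mem (hβ.trans hαβ)
  · exact trapezoid_right_mem (hβ.trans hαβ)
  · exact trapezoid_top_mem hβ
  · exact trapezoid_left_mem hβ

/-- An affine function is determined by its values at two points. If the second branch wins at one
point of the interval, it wins at every later point because `s ≥ 0`; otherwise the constant branch
wins throughout. -/
theorem linearPieces_subset {μ : ℝ → ℝ} (hμ : ∀ γ, 0 < γ → μ γ = max α (β + γ * s)) (hs : 0 ≤ s) :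
    linearPieces μ ⊆ {(α, 0), (β, s)} := by
  rintro ⟨p, q⟩ ⟨a, b, ha, hab, h⟩
  have key : ∀ {c₁ c₂ u v : ℝ}, c₁ < c₂ → u + c₁ * v = p + c₁ * q → u + c₂ * v = p + c₂ * q →
      (p, q) = (u, v) := by
    intro c₁ c₂ u v hc h₁ h₂
    have : (c₂ - c₁) * (v - q) = 0 := by linear_combination h₂ - h₁
    rcases mul_eq_zero.1 this with h | h
    · linarith
    · obtain rfl : v = q := by linarith
      obtain rfl : u = p := by linarith
      rfl
  by_cases hc : ∃ c ∈ Ioo a b, α < β + c * s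
  · obtain ⟨c, ⟨hc1, hc2⟩, hc3⟩ := hc
    right
    have hd : c < (c + b) / 2 := by linarith
    have e1 := h c ⟨hc1, hc2⟩
    have e2 := h ((c + b) / 2) ⟨by linarith, by linarith⟩
    rw [hμ _ (by linarith), max_eq_right hc3.le] at e1
    rw [hμ _ (by linarith), max_eq_right (hc3.le.trans (by gcongr))] at e2
    exact key hd e1 e2
  · push Not at hc
    left
    obtain ⟨c, hc1, hc2⟩ := exists_between hab
    obtain ⟨c', hc1', hc2'⟩ := exists_between hc2
    have e1 := h c ⟨hc1, hc2⟩
    have e2 := h c' ⟨hc1.trans hc1', hc2'⟩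
    rw [hμ _ (by linarith), max_eq_left (hc _ ⟨hc1, hc2⟩)] at e1
    rw [hμ _ (by linarith), max_eq_left (hc _ ⟨hc1.trans hc1', hc2'⟩)] at e2
    exact key hc1' (by simpa using e1) (by simpa using e2)

theorem right_mem_linearPieces {μ : ℝ → ℝ} (hμ : ∀ γ, 0 < γ → μ γ = max α (β + γ * s))
    (hs : 0 ≤ s) (hαβ : β < α) : (α, 0) ∈ linearPieces μ := by
  -- The kink is at `(α - β) / s`; the denominator `s + 1` gives a smaller endpoint and also covers
  -- `s = 0`.
  refine ⟨0, (α - β) / (s + 1), le_rfl, div_pos (by linarith) (by linarith), ?_⟩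
  rintro γ ⟨h0, h1⟩
  rw [lt_div_iff₀ (by linarith)] at h1
  rw [hμ γ h0, max_eq_left (by nlinarith)]
  simp

theorem top_mem_linearPieces {μ : ℝ → ℝ} (hμ : ∀ γ, 0 < γ → μ γ = max α (β + γ * s))
    (hs : 0 < s) (hαβ : β < α) : (β, s) ∈ linearPieces μ := by
  have h : 0 < (α - β) / s := div_pos (by linarith) hs
  refine ⟨(α - β) / s, (α - β) / s + 1, h.le, by linarith, ?_⟩
  rintro γ ⟨h0, h1⟩
  have hγ := h.trans h0
  rw [div_lt_iff₀ hs] at h0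
  rw [hμ γ hγ, max_eq_right (by linarith)]

/-- The Newton polygon of `γ ↦ max {α, β + γ s}`. -/
theorem orderPolygon_eq_trapezoid {μ : ℝ → ℝ} (hμ : ∀ γ, 0 < γ → μ γ = max α (β + γ * s))
    (hs : 0 ≤ s) (hβ : 0 ≤ β) (hαβ : β < α) : orderPolygon μ = trapezoid α β s := by
  have hα : 0 ≤ α := hβ.trans hαβ.le
  refine Subset.antisymm (convexHull_min ?_ (convex_trapezoid _ _ _))
    (trapezoid_subset (convex_convexHull ℝ _) ?_ ?_ ?_ ?_)
  · have hl := linearPieces_subset hμ hs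
    have h1 : ∀ p ∈ linearPieces μ, p ∈ trapezoid α β s ∧ (p.1, (0 : ℝ)) ∈ trapezoid α β s ∧
        ((0 : ℝ), p.2) ∈ trapezoid α β s := by
      intro p hp
      rcases hl hp with rfl | hp'
      · exact ⟨trapezoid_right_mem hα, trapezoid_right_mem hα, trapezoid_zero_mem hα⟩
      · obtain rfl : p = (β, s) := hp'
        exact ⟨trapezoid_top_mem hβ, ⟨0, by simp, by simp, hβ, by simpa using hαβ.le⟩,
          trapezoid_left_mem hβ⟩
    rintro p (((hp | ⟨q, hq, rfl⟩) | ⟨q, hq, rfl⟩) | hp)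
    · exact (h1 p hp).1
    · exact (h1 q hq).2.1
    · exact (h1 q hq).2.2
    · obtain rfl : p = ((0 : ℝ), (0 : ℝ)) := hp
      exact trapezoid_zero_mem hα
  · exact subset_convexHull ℝ _ (Or.inr rfl)
  · exact subset_convexHull ℝ _ (Or.inl (Or.inl (Or.inl (right_mem_linearPieces hμ hs hαβ))))
  -- For `s = 0` the second branch is never active, as `β < α`, so `(β, s)` is not a linear piece.
  -- The trapezoid is then the segment from the origin to `(α, 0)`, which contains `(β, 0)`.
  · rcases hs.eq_or_lt with rfl | hs
    · have h0 : ((0 : ℝ), (0 : ℝ)) ∈ orderPolygon μ := subset_convexHull ℝ _ (Or.inr rfl)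
      have h1 : (α, (0 : ℝ)) ∈ orderPolygon μ :=
        subset_convexHull ℝ _ (Or.inl (Or.inl (Or.inl (right_mem_linearPieces hμ le_rfl hαβ))))
      exact (convex_convexHull ℝ _).segment_subset h0 h1 (mem_segment_zero hβ hαβ.le)
    · exact subset_convexHull ℝ _ (Or.inl (Or.inl (Or.inl (top_mem_linearPieces hμ hs hαβ))))
  · rcases hs.eq_or_lt with rfl | hs
    · exact subset_convexHull ℝ _ (Or.inr rfl)
    · exact subset_convexHull ℝ _
        (Or.inl (Or.inr ⟨_, top_mem_linearPieces hμ hs hαβ, rfl⟩))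

end vertices

theorem chgOrder_eq {r₁ r₂ : ℕ} {s₂ : ℝ} (hs : 0 ≤ s₂) (γ : ℝ) (hγ : 0 < γ) :
    chgOrder r₁ r₂ s₂ γ = max (r₁ : ℝ) (r₂ + γ * s₂) := by
  have h0 : (0 : ℝ) ≤ r₁ := by positivity
  have h2 : (0 : ℝ) ≤ r₂ := by positivity
  have h3 : 0 ≤ γ * s₂ := by positivity
  refine IsGreatest.csSup_eq ⟨?_, ?_⟩
  · rcases le_total (r₁ : ℝ) (r₂ + γ * s₂) with h | h
    · exact ⟨((r₂ : ℝ), s₂), by simp, by simp [h]⟩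
    · exact ⟨((r₁ : ℝ), 0), by simp, by simp [h]⟩
  · rintro _ ⟨p, (rfl | rfl | rfl | rfl), rfl⟩
    · simp [h0]
    · simp
    · simp
    · simp [h2]

theorem traceOrder_eq_of_lt {r₁ r₂ : ℕ} (hr : r₂ < r₁) {s₂ : ℝ} {j : ℕ} (hj : j < r₂) (γ : ℝ) :
    traceOrder r₁ r₂ s₂ j γ =
      max ((r₁ : ℝ) - j - 1 / 2) ((r₂ : ℝ) - j - 1 / 2 + γ * s₂) := by
  have h : (0 : ℝ) < (r₁ : ℝ) - r₂ := sub_pos.2 (by exact_mod_cast hr)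
  rw [traceOrder, if_pos hj, elementaryOrder, mul_max_of_nonneg _ _ h.le, max_add]
  congr 1
  · ring
  · field_simp
    ring

theorem traceOrder_eq_of_ge {r₁ r₂ : ℕ} {s₂ : ℝ} {j : ℕ} (hj : r₂ ≤ j) (hj' : j < r₁) (γ : ℝ) :
    traceOrder r₁ r₂ s₂ j γ = max ((r₁ : ℝ) - j - 1 / 2)
      (0 + γ * (s₂ / ((r₁ : ℝ) - r₂) * ((r₁ : ℝ) - j - 1 / 2))) := by
  have h : (0 : ℝ) ≤ (r₁ : ℝ) - j - 1 / 2 := by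
    have : (j : ℝ) + 1 ≤ r₁ := by exact_mod_cast hj'
    linarith
  rw [traceOrder, if_neg hj.not_gt, elementaryOrder, mul_max_of_nonneg _ _ h]
  congr 1
  · ring
  · ring

theorem orderPolygon_chgOrder {r₁ r₂ : ℕ} (hr : r₂ < r₁) {s₂ : ℝ} (hs : 0 ≤ s₂) :
    orderPolygon (chgOrder r₁ r₂ s₂) = trapezoid r₁ r₂ s₂ :=
  orderPolygon_eq_trapezoid (chgOrder_eq hs) hs (by positivity) (by exact_mod_cast hr)

/-- The vertical line at abscissa `j + 1/2` meets the top side if `j < r₂`, which leaves a trapezoid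
of the same height. If `j ≥ r₂` it meets the slanted side, which leaves a triangle of height `s₂ (r₁
- j - 1/2) / (r₁ - r₂)`. -/
theorem orderPolygon_traceOrder {r₁ r₂ : ℕ} (hr : r₂ < r₁) {s₂ : ℝ} (hs : 0 ≤ s₂) {j : ℕ}
    (hj : j < r₁) : orderPolygon (traceOrder r₁ r₂ s₂ j) =
      {p : ℝ × ℝ | 0 ≤ p.1 ∧ 0 ≤ p.2 ∧
        (p.1 + ((j : ℝ) + 1 / 2), p.2) ∈ orderPolygon (chgOrder r₁ r₂ s₂)} := by
  rw [orderPolygon_chgOrder hr hs]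
  have hr' : (r₂ : ℝ) + 1 ≤ r₁ := by exact_mod_cast hr
  have hj' : (j : ℝ) + 1 ≤ r₁ := by exact_mod_cast hj
  rcases lt_or_ge j r₂ with h | h
  · have hj2 : (j : ℝ) + 1 ≤ r₂ := by exact_mod_cast h
    rw [orderPolygon_eq_trapezoid (fun γ _ => traceOrder_eq_of_lt hr h γ) hs (by linarith)
      (by linarith)]
    ext ⟨x, z⟩
    constructor
    · rintro ⟨θ, hθ, h1, h2, h3⟩
      simp only at h1 h2 h3
      exact ⟨h2, h1 ▸ mul_nonneg hθ.1 hs, θ, hθ, h1, by positivity, by simp only; linarith⟩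
    · rintro ⟨h1, -, θ, hθ, h2, -, h3⟩
      simp only at h1 h2 h3
      exact ⟨θ, hθ, h2, h1, by simp only; linarith⟩
  · have hj2 : (r₂ : ℝ) ≤ j := by exact_mod_cast h
    have hm : (0 : ℝ) < (r₁ : ℝ) - r₂ := by linarith
    have hR : (0 : ℝ) < (r₁ : ℝ) - j - 1 / 2 := by linarith
    rw [orderPolygon_eq_trapezoid (fun γ _ => traceOrder_eq_of_ge h hj γ)
      (by positivity) le_rfl hR]
    ext ⟨x, z⟩
    constructor
    · rintro ⟨θ, hθ, h1, h2, h3⟩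
      simp only at h1 h2 h3
      have hθ0 := hθ.1
      -- The parameter `θ` measures the height relative to the top of the figure, so passing from
      -- the triangle to the full trapezoid multiplies it by the ratio of the two heights. The
      -- converse below uses the inverse ratio.
      refine ⟨h2, ?_, θ * (((r₁ : ℝ) - j - 1 / 2) / ((r₁ : ℝ) - r₂)), ⟨by positivity, ?_⟩, ?_,
        by positivity, ?_⟩
      · simp only [h1]
        positivity
      · exact mul_le_one₀ hθ.2 (by positivity) ((div_le_one hm).2 (by linarith))
      · simp only [h1]
        ring
      · have : ((r₁ : ℝ) - r₂) * (θ * (((r₁ : ℝ) - j - 1 / 2) / ((r₁ : ℝ) - r₂))) =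
            θ * ((r₁ : ℝ) - j - 1 / 2) := by
          field_simp
        simp only
        rw [this]
        linarith
    · rintro ⟨h1, -, θ, hθ, h2, -, h3⟩
      simp only at h1 h2 h3
      have hθ0 := hθ.1
      refine ⟨θ * (((r₁ : ℝ) - r₂) / ((r₁ : ℝ) - j - 1 / 2)), ⟨by positivity, ?_⟩, ?_, h1, ?_⟩
      · rw [← mul_div_assoc, div_le_one hR]
        linarith
      · simp only [h2]
        generalize (r₁ : ℝ) - j - 1 / 2 = R at hR ⊢
        field_simp
      · have : ((r₁ : ℝ) - j - 1 / 2 - 0) * (θ * (((r₁ : ℝ) - r₂) / ((r₁ : ℝ) - j - 1 / 2))) =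
            θ * ((r₁ : ℝ) - r₂) := by
          generalize (r₁ : ℝ) - j - 1 / 2 = R at hR ⊢
          field_simp
          ring
        simp only
        rw [this]
        linarith

/-! ### Two-sided bounds for the weights -/

/-- In the exponents, a monomial is the exponential of a linear form. -/
theorem convexOn_monomial (τ ρ : ℝ) : ConvexOn ℝ univ
    fun p : ℝ × ℝ => (1 + τ ^ 2) ^ (p.2 / 2) * (1 + ρ ^ 2) ^ (p.1 / 2) := by
  have h := convexOn_exp.comp_linearMap
    ((Real.log (1 + τ ^ 2) / 2) • LinearMap.snd ℝ ℝ ℝ +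
      (Real.log (1 + ρ ^ 2) / 2) • LinearMap.fst ℝ ℝ ℝ)
  refine h.congr fun p _ => ?_
  simp only [Function.comp, LinearMap.add_apply, LinearMap.smul_apply, LinearMap.snd_apply,
    LinearMap.fst_apply, smul_eq_mul, Real.exp_add]
  rw [Real.rpow_def_of_pos (by positivity), Real.rpow_def_of_pos (by positivity)]
  rw [← Real.exp_add, ← Real.exp_add]
  ring_nf

/-- This is Krein–Milman; no closure is needed because the extreme points lie in the finite set `S`,
so that their convex hull is already closed. -/
theorem convexHull_extremePoints_convexHull {S : Set (ℝ × ℝ)} (hS : S.Finite) :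
    convexHull ℝ ((convexHull ℝ S).extremePoints ℝ) = convexHull ℝ S := by
  have h := closure_convexHull_extremePoints (hS.isCompact_convexHull (𝕜 := ℝ)) (convex_convexHull ℝ S)
  have hf : ((convexHull ℝ S).extremePoints ℝ).Finite :=
    hS.subset extremePoints_convexHull_subset
  rwa [(hf.isClosed_convexHull (𝕜 := ℝ)).closure_eq] at h

/-! ### Bounds for a weight in terms of points spanning its polygon. -/

section weight

variable {μ : ℝ → ℝ} {S : Set (ℝ × ℝ)}

/-- A convex function on a convex hull is dominated by its value at some spanning point. Here this
is a vertex, hence a single term of the sum. -/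
theorem monomial_le_weight (hS : S.Finite) (hμ : orderPolygon μ = convexHull ℝ S) (τ ρ : ℝ)
    {p : ℝ × ℝ} (hp : p ∈ orderPolygon μ) :
    (1 + τ ^ 2) ^ (p.2 / 2) * (1 + ρ ^ 2) ^ (p.1 / 2) ≤ weight μ τ ρ := by
  have hf : (vertices (orderPolygon μ)).Finite := by
    rw [hμ]
    exact hS.subset extremePoints_convexHull_subset
  rw [hμ, ← convexHull_extremePoints_convexHull hS, ← hμ] at hp
  obtain ⟨v, hv, h⟩ := ((convexOn_monomial τ ρ).subset (subset_univ _)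
    (convex_convexHull ℝ _)).exists_ge_of_mem_convexHull (subset_convexHull ℝ _) hp
  refine h.trans ?_
  rw [weight, finsum_mem_eq_finite_toFinset_sum _ hf]
  exact Finset.single_le_sum
    (f := fun p : ℝ × ℝ => (1 + τ ^ 2) ^ (p.2 / 2) * (1 + ρ ^ 2) ^ (p.1 / 2))
    (fun _ _ => by positivity) (hf.mem_toFinset.2 hv)

/-- The spanning set `S` may contain points that are not vertices, or list a point twice, when the
polygon degenerates. Only the inclusion of the vertices in `S` enters, so no case distinction on the
shape is required. -/
theorem weight_le (hS : S.Finite) (hμ : orderPolygon μ = convexHull ℝ S) (τ ρ : ℝ) {B : ℝ}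
    (hB0 : 0 ≤ B)
    (hB : ∀ p ∈ S, (1 + τ ^ 2) ^ (p.2 / 2) * (1 + ρ ^ 2) ^ (p.1 / 2) ≤ B) :
    weight μ τ ρ ≤ S.ncard * B := by
  have hsub : vertices (orderPolygon μ) ⊆ S := by
    rw [hμ]
    exact extremePoints_convexHull_subset
  have hf := hS.subset hsub
  rw [weight, finsum_mem_eq_finite_toFinset_sum _ hf]
  refine (Finset.sum_le_card_nsmul _ _ B fun p hp => hB p (hsub (hf.mem_toFinset.1 hp))).trans ?_
  rw [nsmul_eq_mul]
  gcongr
  rw [← Set.ncard_eq_toFinset_card _ hf]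
  exact Set.ncard_le_ncard hsub hS

theorem weight_nonneg (μ : ℝ → ℝ) (τ ρ : ℝ) : 0 ≤ weight μ τ ρ :=
  finsum_nonneg fun _ => finsum_nonneg fun _ => by positivity

end weight

/-! ### Weights of two-piece order functions. -/

section twoPiece

variable {μ : ℝ → ℝ} {α β s : ℝ}

theorem rpow_half_sq {x : ℝ} (hx : 0 ≤ x) (y : ℝ) : (x ^ (y / 2)) ^ 2 = x ^ y := by
  rw [← Real.rpow_natCast, ← Real.rpow_mul hx]
  norm_num

theorem one_le_weight (hμ : ∀ γ, 0 < γ → μ γ = max α (β + γ * s)) (hs : 0 ≤ s) (hβ : 0 ≤ β)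
    (hαβ : β < α) (τ ρ : ℝ) : 1 ≤ weight μ τ ρ := by
  have hP := orderPolygon_eq_trapezoid hμ hs hβ hαβ
  have h := monomial_le_weight (S := {((0 : ℝ), (0 : ℝ)), (α, 0), (β, s), (0, s)}) (by simp)
    (hP.trans (trapezoid_eq_convexHull hβ hαβ.le)) τ ρ
    (hP ▸ trapezoid_zero_mem (hβ.trans hαβ.le))
  simpa using h

theorem max_le_weight_sq (hμ : ∀ γ, 0 < γ → μ γ = max α (β + γ * s)) (hs : 0 ≤ s) (hβ : 0 ≤ β)
    (hαβ : β < α) (τ ρ : ℝ) :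
    max ((1 + ρ ^ 2) ^ α) ((1 + τ ^ 2) ^ s * (1 + ρ ^ 2) ^ β) ≤ weight μ τ ρ ^ 2 := by
  have hP := orderPolygon_eq_trapezoid hμ hs hβ hαβ
  have h := fun {p} => monomial_le_weight (p := p)
    (S := {((0 : ℝ), (0 : ℝ)), (α, 0), (β, s), (0, s)}) (by simp)
    (hP.trans (trapezoid_eq_convexHull hβ hαβ.le)) τ ρ
  have h1 := h (hP ▸ trapezoid_right_mem (hβ.trans hαβ.le))
  have h2 := h (hP ▸ trapezoid_top_mem hβ)
  refine max_le ?_ ?_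
  · rw [← rpow_half_sq (by positivity : 0 ≤ 1 + ρ ^ 2) α]
    gcongr
    simpa using h1
  · rw [← rpow_half_sq (by positivity : 0 ≤ 1 + ρ ^ 2) β,
      ← rpow_half_sq (by positivity : 0 ≤ 1 + τ ^ 2) s, ← mul_pow]
    gcongr

/-- There are at most four vertices, and the monomials at `(0, 0)` and `(0, s)` are dominated by
those at `(α, 0)` and `(β, s)`; squaring gives `16 = 4²`. -/
theorem weight_sq_le (hμ : ∀ γ, 0 < γ → μ γ = max α (β + γ * s)) (hs : 0 ≤ s) (hβ : 0 ≤ β)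
    (hαβ : β < α) (τ ρ : ℝ) :
    weight μ τ ρ ^ 2 ≤
      16 * max ((1 + ρ ^ 2) ^ α) ((1 + τ ^ 2) ^ s * (1 + ρ ^ 2) ^ β) := by
  have hP := orderPolygon_eq_trapezoid hμ hs hβ hαβ
  have hα := hβ.trans hαβ.le
  set B := max ((1 + ρ ^ 2) ^ (α / 2)) ((1 + τ ^ 2) ^ (s / 2) * (1 + ρ ^ 2) ^ (β / 2)) with hB
  have hρ : 1 ≤ 1 + ρ ^ 2 := by nlinarith [sq_nonneg ρ]
  have hτ : 1 ≤ 1 + τ ^ 2 := by nlinarith [sq_nonneg τ]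
  have hρα : 1 ≤ (1 + ρ ^ 2) ^ (α / 2) := Real.one_le_rpow hρ (by linarith)
  have hρβ : 1 ≤ (1 + ρ ^ 2) ^ (β / 2) := Real.one_le_rpow hρ (by linarith)
  have h := weight_le (S := {((0 : ℝ), (0 : ℝ)), (α, 0), (β, s), (0, s)}) (by simp)
    (hP.trans (trapezoid_eq_convexHull hβ hαβ.le)) τ ρ (B := B) (by positivity) (by
      rintro p (rfl | rfl | rfl | rfl)
      · simpa [hB] using Or.inl hρα
      · simp [hB]
      · simp [hB]
      · simp only [zero_div, Real.rpow_zero, mul_one]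
        exact le_max_of_le_right (le_mul_of_one_le_right (by positivity) hρβ))
  have hc : (({((0 : ℝ), (0 : ℝ)), (α, 0), (β, s), (0, s)} : Set (ℝ × ℝ)).ncard : ℝ) ≤ 4 := by
    have h4 : ({((0 : ℝ), (0 : ℝ)), (α, 0), (β, s), (0, s)} : Set (ℝ × ℝ)).ncard ≤ 4 := by
      refine (ncard_insert_le _ _).trans ?_
      refine (Nat.succ_le_succ (ncard_insert_le _ _)).trans ?_
      refine (Nat.succ_le_succ (Nat.succ_le_succ (ncard_insert_le _ _))).trans ?_
      simp
    exact_mod_cast h4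
  have h' : weight μ τ ρ ≤ 4 * B := h.trans (by gcongr)
  calc weight μ τ ρ ^ 2 ≤ (4 * B) ^ 2 := by
        have := weight_nonneg μ τ ρ
        gcongr
    _ = 16 * B ^ 2 := by ring
    _ ≤ _ := by
      gcongr
      rw [← rpow_half_sq (by positivity : 0 ≤ 1 + ρ ^ 2) α,
        ← rpow_half_sq (by positivity : 0 ≤ 1 + ρ ^ 2) β,
        ← rpow_half_sq (by positivity : 0 ≤ 1 + τ ^ 2) s, ← mul_pow]
      rcases max_choice ((1 + ρ ^ 2) ^ (α / 2)) ((1 + τ ^ 2) ^ (s / 2) * (1 + ρ ^ 2) ^ (β / 2))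
        with h | h
      · rw [hB, h]
        exact le_max_left _ _
      · rw [hB, h]
        exact le_max_right _ _

end twoPiece

/-- The square of the weight of `chgOrder`, up to constants, in terms of `X = ⟨ξ⟩²` and
`Q = ⟨τ⟩ ^ (2 y)`. -/
noncomputable def chgSymbol (r₁ r₂ : ℕ) (Q X : ℝ) : ℝ := X ^ r₂ * max X Q ^ (r₁ - r₂)

/-- The square of the weight of `traceOrder`, up to constants. -/
noncomputable def traceSymbol (r₁ r₂ j : ℕ) (Q X : ℝ) : ℝ :=
  if j < r₂ then X ^ (r₂ - 1 - j) * √X * max X Q ^ (r₁ - r₂)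
  else max X Q ^ (r₁ - 1 - j) * √(max X Q)

theorem max_rpow {x y z : ℝ} (hx : 0 ≤ x) (hy : 0 ≤ y) (hz : 0 ≤ z) :
    max x y ^ z = max (x ^ z) (y ^ z) := by
  rcases le_total x y with h | h
  · rw [max_eq_right h, max_eq_right (Real.rpow_le_rpow hx h hz)]
  · rw [max_eq_left h, max_eq_left (Real.rpow_le_rpow hy h hz)]

theorem rpow_sub_half {x : ℝ} (hx : 0 < x) {r j : ℕ} (h : j < r) :
    x ^ ((r : ℝ) - j - 1 / 2) = x ^ (r - 1 - j) * √x := by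
  have e : (r : ℝ) - j - 1 / 2 = ((r - 1 - j : ℕ) : ℝ) + 1 / 2 := by
    have : r = (r - 1 - j) + j + 1 := by omega
    have h' : (r : ℝ) = ((r - 1 - j : ℕ) : ℝ) + j + 1 := by exact_mod_cast this
    linarith
  rw [e, Real.rpow_add hx, Real.rpow_natCast, Real.sqrt_eq_rpow]

/-! ### Weights in the variables `X` and `Q`. -/

section symbols

variable {r₁ r₂ : ℕ} {s₂ : ℝ}

theorem rpow_slope (hr : r₂ < r₁) {x : ℝ} (hx : 0 ≤ x) :
    x ^ s₂ = (x ^ (s₂ / ((r₁ : ℝ) - r₂))) ^ (r₁ - r₂) := by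
  have h : (0 : ℝ) < (r₁ : ℝ) - r₂ := sub_pos.2 (by exact_mod_cast hr)
  rw [← Real.rpow_natCast, ← Real.rpow_mul hx, Nat.cast_sub hr.le, div_mul_cancel₀ _ h.ne']

/-- Since `y (r₁ - r₂) = s₂`, the two monomials share the factor `X^r₂`, and what remains is the
maximum of two powers with the same exponent `r₁ - r₂`. -/
theorem chgSymbol_eq_max (hr : r₂ < r₁) (τ ρ : ℝ) :
    max ((1 + ρ ^ 2) ^ (r₁ : ℝ)) ((1 + τ ^ 2) ^ s₂ * (1 + ρ ^ 2) ^ (r₂ : ℝ)) =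
      chgSymbol r₁ r₂ ((1 + τ ^ 2) ^ (s₂ / ((r₁ : ℝ) - r₂))) (1 + ρ ^ 2) := by
  rw [chgSymbol, rpow_slope hr (by positivity : 0 ≤ 1 + τ ^ 2), Real.rpow_natCast,
    Real.rpow_natCast]
  set Q := (1 + τ ^ 2) ^ (s₂ / ((r₁ : ℝ) - r₂))
  have hQ : 0 ≤ Q := by positivity
  rw [(pow_left_monotoneOn (n := r₁ - r₂)).map_max (a := 1 + ρ ^ 2) (b := Q)
    (by simp only [mem_ofPred_eq]; positivity) hQ, mul_max_of_nonneg _ _ (by positivity), ← pow_add,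
    Nat.add_sub_cancel' hr.le, mul_comm (Q ^ _)]

theorem chgSymbol_le_weight_sq (hr : r₂ < r₁) (hs : 0 ≤ s₂) (τ ρ : ℝ) :
    chgSymbol r₁ r₂ ((1 + τ ^ 2) ^ (s₂ / ((r₁ : ℝ) - r₂))) (1 + ρ ^ 2) ≤
      weight (chgOrder r₁ r₂ s₂) τ ρ ^ 2 := by
  rw [← chgSymbol_eq_max hr]
  exact max_le_weight_sq (chgOrder_eq hs) hs (by positivity) (by exact_mod_cast hr) τ ρ

theorem weight_sq_le_chgSymbol (hr : r₂ < r₁) (hs : 0 ≤ s₂) (τ ρ : ℝ) :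
    weight (chgOrder r₁ r₂ s₂) τ ρ ^ 2 ≤
      16 * chgSymbol r₁ r₂ ((1 + τ ^ 2) ^ (s₂ / ((r₁ : ℝ) - r₂))) (1 + ρ ^ 2) := by
  rw [← chgSymbol_eq_max hr]
  exact weight_sq_le (chgOrder_eq hs) hs (by positivity) (by exact_mod_cast hr) τ ρ

/-- Here `T_j(μ)` is `μ` lowered by `j + 1/2`, so the maximum is the one for `μ` multiplied by
`X^-(j + 1/2)`. -/
theorem traceSymbol_eq_max_of_lt (hr : r₂ < r₁) {j : ℕ} (hj : j < r₂) (τ ρ : ℝ) :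
    max ((1 + ρ ^ 2) ^ ((r₁ : ℝ) - j - 1 / 2))
        ((1 + τ ^ 2) ^ s₂ * (1 + ρ ^ 2) ^ ((r₂ : ℝ) - j - 1 / 2)) =
      traceSymbol r₁ r₂ j ((1 + τ ^ 2) ^ (s₂ / ((r₁ : ℝ) - r₂))) (1 + ρ ^ 2) := by
  have h := chgSymbol_eq_max (s₂ := s₂) hr τ ρ
  have hX : 0 < 1 + ρ ^ 2 := by positivity
  rw [traceSymbol, if_pos hj, ← rpow_sub_half hX hj]
  have e1 : (1 + ρ ^ 2) ^ ((r₁ : ℝ) - j - 1 / 2) =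
      (1 + ρ ^ 2) ^ (-((j : ℝ) + 1 / 2)) * (1 + ρ ^ 2) ^ (r₁ : ℝ) := by
    rw [← Real.rpow_add hX]
    ring_nf
  have e2 : (1 + ρ ^ 2) ^ ((r₂ : ℝ) - j - 1 / 2) =
      (1 + ρ ^ 2) ^ (-((j : ℝ) + 1 / 2)) * (1 + ρ ^ 2) ^ (r₂ : ℝ) := by
    rw [← Real.rpow_add hX]
    ring_nf
  rw [e1, e2, mul_left_comm, ← mul_max_of_nonneg _ _ (by positivity), h, chgSymbol,
    Real.rpow_natCast, mul_assoc]

theorem traceSymbol_eq_max_of_ge {j : ℕ} (hj : r₂ ≤ j) (hj' : j < r₁) (τ ρ : ℝ) :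
    max ((1 + ρ ^ 2) ^ ((r₁ : ℝ) - j - 1 / 2))
        ((1 + τ ^ 2) ^ (s₂ / ((r₁ : ℝ) - r₂) * ((r₁ : ℝ) - j - 1 / 2)) *
          (1 + ρ ^ 2) ^ (0 : ℝ)) =
      traceSymbol r₁ r₂ j ((1 + τ ^ 2) ^ (s₂ / ((r₁ : ℝ) - r₂))) (1 + ρ ^ 2) := by
  have h : (0 : ℝ) ≤ (r₁ : ℝ) - j - 1 / 2 := by
    have : (j : ℝ) + 1 ≤ r₁ := by exact_mod_cast hj'
    linarith
  rw [traceSymbol, if_neg hj.not_gt, ← rpow_sub_half (by positivity) hj', Real.rpow_zero, mul_one,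
    Real.rpow_mul (by positivity), max_rpow (by positivity) (by positivity) h]

theorem traceOrder_bounds (hr : r₂ < r₁) (hs : 0 ≤ s₂) {j : ℕ} (hj : j < r₁) (τ ρ : ℝ) :
    1 ≤ weight (traceOrder r₁ r₂ s₂ j) τ ρ ∧
    traceSymbol r₁ r₂ j ((1 + τ ^ 2) ^ (s₂ / ((r₁ : ℝ) - r₂))) (1 + ρ ^ 2) ≤
      weight (traceOrder r₁ r₂ s₂ j) τ ρ ^ 2 ∧
    weight (traceOrder r₁ r₂ s₂ j) τ ρ ^ 2 ≤
      16 * traceSymbol r₁ r₂ j ((1 + τ ^ 2) ^ (s₂ / ((r₁ : ℝ) - r₂))) (1 + ρ ^ 2) := by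
  have hr' : (r₂ : ℝ) + 1 ≤ r₁ := by exact_mod_cast hr
  have hj' : (j : ℝ) + 1 ≤ r₁ := by exact_mod_cast hj
  rcases lt_or_ge j r₂ with h | h
  · have hj2 : (j : ℝ) + 1 ≤ r₂ := by exact_mod_cast h
    have hμ := fun γ (_ : 0 < γ) => traceOrder_eq_of_lt (s₂ := s₂) hr h γ
    rw [← traceSymbol_eq_max_of_lt hr h]
    exact ⟨one_le_weight hμ hs (by linarith) (by linarith) τ ρ,
      max_le_weight_sq hμ hs (by linarith) (by linarith) τ ρ,
      weight_sq_le hμ hs (by linarith) (by linarith) τ ρ⟩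
  · have hμ := fun γ (_ : 0 < γ) => traceOrder_eq_of_ge (s₂ := s₂) h hj γ
    have hm : (0 : ℝ) < (r₁ : ℝ) - r₂ := by linarith
    have hR : (0 : ℝ) < (r₁ : ℝ) - j - 1 / 2 := by linarith
    have hS : 0 ≤ s₂ / ((r₁ : ℝ) - r₂) * ((r₁ : ℝ) - j - 1 / 2) := by positivity
    rw [← traceSymbol_eq_max_of_ge h hj]
    exact ⟨one_le_weight hμ hS le_rfl hR τ ρ, max_le_weight_sq hμ hS le_rfl hR τ ρ,
      weight_sq_le hμ hS le_rfl hR τ ρ⟩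

end symbols

/-! ### Plancherel's theorem on `𝕋 × ℝⁿ` -/

section Plancherel

variable {T : ℝ} [hT : Fact (0 < T)] {n : ℕ}

theorem measurePreserving_snd_torus :
    MeasurePreserving (Prod.snd : TorusSpace T n → _) (torusMeasure T n) volume := by
  unfold torusMeasure
  exact measurePreserving_snd

theorem memLp_timeMode (k : ℤ) (g : Lp ℂ 2 (volume : Measure (EuclideanSpace ℝ (Fin n)))) :
    MemLp (fun p : TorusSpace T n => fourier k p.1 * g p.2) 2 (torusMeasure T n) := by
  have h := (Lp.memLp g).comp_measurePreserving (measurePreserving_snd_torus (T := T))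
  refine h.mono ((((fourier k).continuous.comp continuous_fst).aestronglyMeasurable).mul h.1) ?_
  filter_upwards with p
  rw [norm_mul, fourier_apply, Circle.norm_coe, one_mul]
  rfl

/-- The function `(t, x) ↦ exp (2 π i k t / T) g(x)`. -/
noncomputable def timeMode (k : ℤ) (g : Lp ℂ 2 (volume : Measure (EuclideanSpace ℝ (Fin n)))) :
    L2G T n := (memLp_timeMode k g).toLp _

theorem coeFn_timeMode (k : ℤ) (g : Lp ℂ 2 (volume : Measure (EuclideanSpace ℝ (Fin n)))) :
    timeMode (T := T) k g =ᵐ[torusMeasure T n] fun p => fourier k p.1 * g p.2 :=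
  MemLp.coeFn_toLp _

theorem coeFn_timeCoeff (f : L2G T n) (k : ℤ) :
    timeCoeff f k =ᵐ[volume] fun x => fourierCoeff (fun t => f (t, x)) k :=
  MemLp.coeFn_toLp _

/-- By Fubini, taking the `k`-th coefficient is adjoint to inserting the `k`-th mode. Orthogonality
and totality of the modes both follow from this identity. -/
theorem inner_timeMode (k : ℤ) (g : Lp ℂ 2 (volume : Measure (EuclideanSpace ℝ (Fin n))))
    (f : L2G T n) : inner ℂ (timeMode k g) f = inner ℂ g (timeCoeff f k) := by
  have hi : Integrable (fun p : TorusSpace T n => inner ℂ (fourier k p.1 * g p.2) (f p))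
      (torusMeasure T n) := by
    refine (L2.integrable_inner (𝕜 := ℂ) (timeMode k g) f).congr ?_
    filter_upwards [coeFn_timeMode (T := T) k g] with p hp
    rw [hp]
  rw [L2.inner_def, L2.inner_def]
  have e1 : ∫ p, inner ℂ (timeMode (T := T) k g p) (f p) ∂(torusMeasure T n) =
      ∫ p : TorusSpace T n, inner ℂ (fourier k p.1 * g p.2) (f p) ∂(torusMeasure T n) := by
    refine integral_congr_ae ?_
    filter_upwards [coeFn_timeMode (T := T) k g] with p hp
    rw [hp]
  rw [e1]
  unfold torusMeasure at hi ⊢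
  rw [integral_prod_symm _ hi]
  refine integral_congr_ae ?_
  filter_upwards [coeFn_timeCoeff f k] with x hx
  rw [hx, fourierCoeff]
  simp only [RCLike.inner_apply, map_mul, smul_eq_mul, fourier_neg]
  rw [← integral_mul_const]
  refine integral_congr_ae (Filter.Eventually.of_forall fun t => ?_)
  have e : ∀ a b c : ℂ, c * (a * b) = a * c * b := fun a b c => by ring
  exact e _ _ _

theorem timeCoeff_timeMode (k l : ℤ) (g : Lp ℂ 2 (volume : Measure (EuclideanSpace ℝ (Fin n)))) :
    timeCoeff (timeMode (T := T) k g) l = if l = k then g else 0 := by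
  have h : timeCoeff (timeMode (T := T) k g) l =ᵐ[volume]
      fun x => (if l = k then (1 : ℂ) else 0) * g x := by
    filter_upwards [coeFn_timeCoeff (timeMode (T := T) k g) l,
      ae_slice (coeFn_timeMode (T := T) k g)] with x hx hs
    rw [hx, fourierCoeff_congr_ae hs]
    simp only [mul_comm _ (g x)]
    rw [fourierCoeff.const_mul (fourier k : AddCircle T → ℂ) (g x) l, fourierCoeff_fourier,
      Pi.single_apply]
  refine Lp.ext (h.trans ?_)
  split_ifs
  · simp
  · filter_upwards [Lp.coeFn_zero ℂ 2 (volume : Measure (EuclideanSpace ℝ (Fin n)))] with x hx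
    rw [hx, zero_mul, Pi.zero_apply]

theorem timeMode_add (k : ℤ) (g h : Lp ℂ 2 (volume : Measure (EuclideanSpace ℝ (Fin n)))) :
    timeMode (T := T) k (g + h) = timeMode k g + timeMode k h := by
  unfold timeMode
  rw [← MemLp.toLp_add]
  refine MemLp.toLp_congr _ _ ?_
  filter_upwards [(measurePreserving_snd_torus (T := T)).quasiMeasurePreserving.ae
    (Lp.coeFn_add g h)] with p hp
  rw [Pi.add_apply, ← mul_add, hp, Pi.add_apply]

theorem timeMode_smul (k : ℤ) (c : ℂ) (g : Lp ℂ 2 (volume : Measure (EuclideanSpace ℝ (Fin n)))) :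
    timeMode (T := T) k (c • g) = c • timeMode k g := by
  unfold timeMode
  rw [← MemLp.toLp_const_smul]
  refine MemLp.toLp_congr _ _ ?_
  filter_upwards [(measurePreserving_snd_torus (T := T)).quasiMeasurePreserving.ae
    (Lp.coeFn_smul c g)] with p hp
  simp only [hp, Pi.smul_apply, smul_eq_mul]
  ring

variable (T n) in
/-- The isometric embedding `g ↦ timeMode k g`. -/
noncomputable def timeModeₗᵢ (k : ℤ) :
    Lp ℂ 2 (volume : Measure (EuclideanSpace ℝ (Fin n))) →ₗᵢ[ℂ] L2G T n where
  toFun := timeMode k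
  map_add' := timeMode_add k
  map_smul' := timeMode_smul k
  norm_map' g := by
    have h : inner ℂ (timeMode (T := T) k g) (timeMode k g) = inner ℂ g g := by
      rw [inner_timeMode, timeCoeff_timeMode, if_pos rfl]
    rw [inner_self_eq_norm_sq_to_K, inner_self_eq_norm_sq_to_K] at h
    have h' : ‖timeMode (T := T) k g‖ ^ 2 = ‖g‖ ^ 2 := by exact_mod_cast h
    exact (sq_eq_sq₀ (norm_nonneg _) (norm_nonneg _)).1 h'

/-- The countably many coefficients vanish off one common null set of `x`. There completeness of the
exponentials on the circle kills the slice, and Tonelli's theorem concludes. -/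
theorem eq_zero_of_timeCoeff (f : L2G T n) (h : ∀ k, timeCoeff f k = 0) : f = 0 := by
  have h1 : ∀ᵐ x : EuclideanSpace ℝ (Fin n), ∀ k : ℤ, fourierCoeff (fun t => f (t, x)) k = 0 := by
    rw [ae_all_iff]
    intro k
    filter_upwards [coeFn_timeCoeff f k,
      Lp.coeFn_zero ℂ 2 (volume : Measure (EuclideanSpace ℝ (Fin n)))] with x hx h0
    rw [← hx, h k, h0]
    rfl
  have hf : MemLp f 2 ((AddCircle.haarAddCircle (T := T)).prod
    (volume : Measure (EuclideanSpace ℝ (Fin n)))) := Lp.memLp f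
  have h2 : ∀ᵐ x : EuclideanSpace ℝ (Fin n),
      ∀ᵐ t ∂(AddCircle.haarAddCircle (T := T)), f (t, x) = 0 := by
    filter_upwards [h1, (hf.integrable_norm_pow (by norm_num)).swap.prod_right_ae,
      hf.1.prod_swap.prodMk_left] with x hx hi hs
    have hm : MemLp (fun t => f (t, x)) 2 (AddCircle.haarAddCircle (T := T)) :=
      (memLp_two_iff_integrable_sq_norm hs).2 hi
    have h0 : hm.toLp _ = 0 := by
      refine fourierBasis.repr.map_eq_zero_iff.1 ?_
      ext k
      rw [fourierBasis_repr, fourierCoeff_congr_ae hm.coeFn_toLp, hx k]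
      rfl
    have h0' := hm.coeFn_toLp
    rw [h0] at h0'
    filter_upwards [h0', Lp.coeFn_zero ℂ 2 (AddCircle.haarAddCircle (T := T))] with t ht hz
    rw [← ht, hz]
    rfl
  refine Lp.ext ?_
  have h3 : ∀ᵐ p ∂(torusMeasure T n), f p = 0 := by
    have h4 : ∫⁻ p, ‖f p‖ₑ ∂(torusMeasure T n) = 0 := by
      refine (lintegral_prod_symm (fun p : TorusSpace T n => ‖f p‖ₑ) hf.1.enorm).trans ?_
      rw [lintegral_eq_zero_iff' hf.1.enorm.lintegral_prod_left']
      filter_upwards [h2] with x hx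
      refine (lintegral_congr_ae ?_).trans lintegral_zero
      filter_upwards [hx] with t ht
      rw [ht, enorm_zero]
    rw [lintegral_eq_zero_iff' (Lp.aestronglyMeasurable f).enorm] at h4
    filter_upwards [h4] with p hp
    simpa using hp
  filter_upwards [h3, Lp.coeFn_zero ℂ 2 (torusMeasure T n)] with p hp h0
  rw [hp, h0]
  rfl

variable (T n) in
theorem orthogonalFamily_timeMode :
    OrthogonalFamily ℂ (fun _ : ℤ => Lp ℂ 2 (volume : Measure (EuclideanSpace ℝ (Fin n))))
      (timeModeₗᵢ T n) := by
  intro k l hkl g h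
  refine (inner_timeMode k g (timeMode l h)).trans ?_
  rw [timeCoeff_timeMode, if_neg hkl, inner_zero_right]

variable (T n) in
theorem isHilbertSum_timeMode :
    IsHilbertSum ℂ (fun _ : ℤ => Lp ℂ 2 (volume : Measure (EuclideanSpace ℝ (Fin n))))
      (timeModeₗᵢ T n) := by
  refine IsHilbertSum.mk (orthogonalFamily_timeMode T n) ?_
  rw [top_le_iff, Submodule.topologicalClosure_eq_top_iff, eq_bot_iff]
  intro f hf
  refine (Submodule.mem_bot ℂ).2 (eq_zero_of_timeCoeff f fun k => ?_)
  have h := (Submodule.mem_orthogonal _ f).1 hf (timeMode k (timeCoeff f k))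
    (Submodule.mem_iSup_of_mem k ⟨_, rfl⟩)
  rw [inner_timeMode] at h
  exact inner_self_eq_zero.1 h

theorem linearIsometryEquiv_timeMode_apply (f : L2G T n) (k : ℤ) :
    (isHilbertSum_timeMode T n).linearIsometryEquiv f k = timeCoeff f k := by
  set w := (isHilbertSum_timeMode T n).linearIsometryEquiv f with hw
  have hf : f = (isHilbertSum_timeMode T n).linearIsometryEquiv.symm w := by simp [hw]
  have hs := (isHilbertSum_timeMode T n).hasSum_linearIsometryEquiv_symm w
  rw [← hf] at hs
  refine ext_inner_left ℂ fun g => ?_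
  rw [← inner_timeMode]
  have h1 := hs.mapL (innerSL ℂ (timeMode (T := T) k g))
  simp only [innerSL_apply_apply] at h1
  have h2 : ∀ l : ℤ, inner ℂ (timeMode (T := T) k g) (timeModeₗᵢ T n l (w l)) =
      if l = k then inner ℂ g (w k) else 0 := by
    intro l
    refine (inner_timeMode k g (timeMode l (w l))).trans ?_
    rw [timeCoeff_timeMode]
    by_cases h : l = k
    · subst h
      simp
    · rw [if_neg h, if_neg (Ne.symm h), inner_zero_right]
  simp only [h2] at h1
  exact (hasSum_ite_eq k _).unique h1

theorem lintegral_enorm_sq_eq {α : Type*} [MeasurableSpace α] {ν : Measure α} (g : Lp ℂ 2 ν) :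
    ∫⁻ x, ‖g x‖ₑ ^ (2 : ℝ) ∂ν = ‖g‖ₑ ^ (2 : ℝ) := by
  rw [Lp.enorm_def, eLpNorm_eq_lintegral_rpow_enorm_toReal (by norm_num) (by norm_num),
    ← ENNReal.rpow_mul]
  norm_num

theorem eq_of_fourierG_eq {u v : L2G T n} (h : ∀ k, fourierG u k = fourierG v k) : u = v := by
  refine (isHilbertSum_timeMode T n).linearIsometryEquiv.injective ?_
  ext1
  funext k
  rw [linearIsometryEquiv_timeMode_apply, linearIsometryEquiv_timeMode_apply]
  exact (Lp.fourierTransformₗᵢ (EuclideanSpace ℝ (Fin n)) ℂ).injective (h k)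

theorem tsum_lintegral_fourierG_lt_top (u : L2G T n) :
    ∑' k : ℤ, ∫⁻ ξ, ‖fourierG u k ξ‖ₑ ^ (2 : ℝ) < ⊤ := by
  have h := (lp.hasSum_norm (p := 2) (by norm_num)
    ((isHilbertSum_timeMode T n).linearIsometryEquiv u)).summable
  simp only [linearIsometryEquiv_timeMode_apply, ENNReal.toReal_ofNat] at h
  have e : ∀ k, ∫⁻ ξ, ‖fourierG u k ξ‖ₑ ^ (2 : ℝ) = ENNReal.ofReal (‖timeCoeff u k‖ ^ (2 : ℝ)) := by
    intro k
    rw [lintegral_enorm_sq_eq, ← ENNReal.ofReal_rpow_of_nonneg (norm_nonneg _) (by norm_num),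
      ofReal_norm]
    congr 1
    rw [← ofReal_norm, ← ofReal_norm]
    congr 1
    exact Lp.norm_fourier_eq _
  rw [tsum_congr e]
  exact h.tsum_ofReal_lt_top

/-- The Riesz–Fischer half of Plancherel's theorem. It lets both the trace and the extension be
defined by prescribing their transforms. -/
theorem exists_fourierG_eq (g : ℤ → Lp ℂ 2 (volume : Measure (EuclideanSpace ℝ (Fin n))))
    (hg : ∑' k : ℤ, ∫⁻ ξ, ‖g k ξ‖ₑ ^ (2 : ℝ) < ⊤) : ∃ u : L2G T n, ∀ k, fourierG u k = g k := by
  have hm : Memℓp (fun k => 𝓕⁻ (g k)) 2 := by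
    refine memℓp_gen ?_
    have e : ∀ k, ‖𝓕⁻ (g k)‖ ^ (2 : ℝ≥0∞).toReal =
        (∫⁻ ξ, ‖g k ξ‖ₑ ^ (2 : ℝ)).toReal := by
      intro k
      rw [lintegral_enorm_sq_eq, ← ENNReal.toReal_rpow, toReal_enorm, ENNReal.toReal_ofNat]
      congr 1
      exact (Lp.fourierTransformₗᵢ (EuclideanSpace ℝ (Fin n)) ℂ).symm.norm_map _
    simp only [e]
    exact ENNReal.summable_toReal hg.ne
  refine ⟨(isHilbertSum_timeMode T n).linearIsometryEquiv.symm ⟨_, hm⟩, fun k => ?_⟩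
  rw [fourierG, ← linearIsometryEquiv_timeMode_apply, LinearIsometryEquiv.apply_symm_apply]
  exact (Lp.fourierTransformₗᵢ (EuclideanSpace ℝ (Fin n)) ℂ).apply_symm_apply _

theorem mem_oscillatory_iff {u : L2G T n} : u ∈ oscillatory T n ↔ fourierG u 0 = 0 := by
  refine Iff.trans (Iff.rfl : _ ↔ timeCoeff u 0 = 0) ?_
  exact (Lp.fourierTransformₗᵢ (EuclideanSpace ℝ (Fin n)) ℂ).map_eq_zero_iff.symm

end Plancherel

/-! ### Splitting off the last coordinate -/

section joinLast

variable {d : ℕ}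

theorem norm_joinLast_sq (x : EuclideanSpace ℝ (Fin d)) (s : ℝ) :
    ‖joinLast x s‖ ^ 2 = ‖x‖ ^ 2 + s ^ 2 := by
  rw [EuclideanSpace.norm_sq_eq, EuclideanSpace.norm_sq_eq, Fin.sum_univ_castSucc]
  simp [joinLast]

theorem inner_joinLast (x y : EuclideanSpace ℝ (Fin d)) (s t : ℝ) :
    inner ℝ (joinLast x s) (joinLast y t) = inner ℝ x y + s * t := by
  rw [PiLp.inner_apply, PiLp.inner_apply, Fin.sum_univ_castSucc]
  simp [joinLast, mul_comm]

@[simp]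
theorem joinLast_last (x : EuclideanSpace ℝ (Fin d)) (s : ℝ) :
    joinLast x s (Fin.last d) = s := by
  simp [joinLast]

variable (d) in
/-- The linear map `(x, s) ↦ joinLast x s`. -/
noncomputable def joinLastL : EuclideanSpace ℝ (Fin d) × ℝ →L[ℝ] EuclideanSpace ℝ (Fin (d + 1)) :=
  LinearMap.toContinuousLinearMap
    { toFun := fun p => joinLast p.1 p.2
      map_add' := fun p q => by
        ext i
        refine Fin.lastCases ?_ (fun j => ?_) i <;> simp [joinLast]
      map_smul' := fun c p => by
        ext i
        refine Fin.lastCases ?_ (fun j => ?_) i <;> simp [joinLast] }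

@[simp]
theorem joinLastL_apply (p : EuclideanSpace ℝ (Fin d) × ℝ) :
    joinLastL d p = joinLast p.1 p.2 := rfl

variable (d) in
/-- The measurable equivalence `(x, s) ↦ joinLast x s`. -/
noncomputable def joinLastEquiv :
    EuclideanSpace ℝ (Fin d) × ℝ ≃ᵐ EuclideanSpace ℝ (Fin (d + 1)) :=
  (((MeasurableEquiv.toLp 2 (Fin d → ℝ)).symm.prodCongr (MeasurableEquiv.refl ℝ)).trans
    MeasurableEquiv.prodComm).trans
    ((MeasurableEquiv.piFinSuccAbove (fun _ => ℝ) (Fin.last d)).symm.trans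
      (MeasurableEquiv.toLp 2 (Fin (d + 1) → ℝ)))

theorem joinLastEquiv_apply (p : EuclideanSpace ℝ (Fin d) × ℝ) :
    joinLastEquiv d p = joinLast p.1 p.2 := by
  ext i
  simp only [joinLastEquiv, joinLast, MeasurableEquiv.piFinSuccAbove, Fin.insertNthEquiv,
    MeasurableEquiv.trans_apply, MeasurableEquiv.coe_toLp]
  exact congrFun (Fin.insertNth_last' p.2 fun i => p.1 i) i

variable (d) in
theorem measurePreserving_joinLast :
    MeasurePreserving (fun p : EuclideanSpace ℝ (Fin d) × ℝ => joinLast p.1 p.2)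
      (volume.prod volume) volume := by
  have h : MeasurePreserving (joinLastEquiv d) (volume.prod volume) volume := by
    refine (((PiLp.volume_preserving_ofLp (Fin d)).prod
      (MeasurePreserving.id (volume : Measure ℝ))).trans (Measure.measurePreserving_swap)).trans
      ((volume_preserving_piFinSuccAbove (fun _ : Fin (d + 1) => ℝ) (Fin.last d)).symm.trans
        (PiLp.volume_preserving_toLp (Fin (d + 1))))
  have e : (fun p : EuclideanSpace ℝ (Fin d) × ℝ => joinLast p.1 p.2) = joinLastEquiv d :=
    funext fun p => (joinLastEquiv_apply p).symm
  rwa [e]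

variable (d) in
theorem measurableEmbedding_joinLast :
    MeasurableEmbedding (fun p : EuclideanSpace ℝ (Fin d) × ℝ => joinLast p.1 p.2) := by
  have e : (fun p : EuclideanSpace ℝ (Fin d) × ℝ => joinLast p.1 p.2) = joinLastEquiv d :=
    funext fun p => (joinLastEquiv_apply p).symm
  rw [e]
  exact (joinLastEquiv d).measurableEmbedding

theorem ae_joinLast {p : EuclideanSpace ℝ (Fin (d + 1)) → Prop} (h : ∀ᵐ ξ, p ξ) :
    ∀ᵐ x : EuclideanSpace ℝ (Fin d), ∀ᵐ s : ℝ, p (joinLast x s) :=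
  Measure.ae_ae_of_ae_prod ((measurePreserving_joinLast d).quasiMeasurePreserving.ae h)

theorem lintegral_joinLast {f : EuclideanSpace ℝ (Fin (d + 1)) → ℝ≥0∞} (hf : AEMeasurable f) :
    ∫⁻ ξ, f ξ = ∫⁻ x : EuclideanSpace ℝ (Fin d), ∫⁻ s : ℝ, f (joinLast x s) := by
  rw [← (measurePreserving_joinLast d).lintegral_comp_emb (measurableEmbedding_joinLast d),
    lintegral_prod]
  exact hf.comp_quasiMeasurePreserving (measurePreserving_joinLast d).quasiMeasurePreserving

theorem integral_joinLast {f : EuclideanSpace ℝ (Fin (d + 1)) → ℂ} (hf : Integrable f) :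
    ∫ ξ, f ξ = ∫ x : EuclideanSpace ℝ (Fin d), ∫ s : ℝ, f (joinLast x s) := by
  rw [← (measurePreserving_joinLast d).integral_comp (measurableEmbedding_joinLast d),
    integral_prod]
  exact (measurePreserving_joinLast d).integrable_comp_of_integrable hf

end joinLast

/-! ### The trace estimate -/

/-- The substitution `x = 2πs / √L` reduces this to the integral of `1 / (1 + x²)`, which is `π`;
the value does not depend on `L`. -/
theorem integrable_poissonKernel {L : ℝ} (hL : 0 < L) :
    Integrable (fun s : ℝ => √L / (L + (2 * Real.pi * s) ^ 2)) ∧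
      ∫ s : ℝ, √L / (L + (2 * Real.pi * s) ^ 2) = 1 / 2 := by
  have hsq : 0 < √L := Real.sqrt_pos.2 hL
  have ha : 0 < 2 * Real.pi / √L := by positivity
  have e : (fun s : ℝ => √L / (L + (2 * Real.pi * s) ^ 2)) =
      fun s => (√L)⁻¹ * (1 + (2 * Real.pi / √L * s) ^ 2)⁻¹ := by
    funext s
    rw [div_mul_eq_mul_div, div_pow, Real.sq_sqrt hL.le]
    field_simp
    rw [Real.sq_sqrt hL.le]
  have hi : Integrable fun s : ℝ => (1 + (2 * Real.pi / √L * s) ^ 2)⁻¹ :=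
    integrable_inv_one_add_sq.comp_mul_left' ha.ne'
  rw [e]
  refine ⟨hi.const_mul _, ?_⟩
  rw [integral_const_mul, Measure.integral_comp_mul_left (fun x : ℝ => (1 + x ^ 2)⁻¹),
    integral_univ_inv_one_add_sq, abs_of_pos (by positivity), smul_eq_mul]
  have := Real.pi_pos
  field_simp

theorem lintegral_poissonKernel {L : ℝ} (hL : 0 < L) :
    ∫⁻ s : ℝ, ENNReal.ofReal (2 * (√L / (L + (2 * Real.pi * s) ^ 2))) = 1 := by
  obtain ⟨h1, h2⟩ := integrable_poissonKernel hL
  rw [← ofReal_integral_eq_lintegral_ofReal (h1.const_mul 2)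
    (Filter.Eventually.of_forall fun s => by positivity), integral_const_mul, h2]
  norm_num

/-- The squared length scale in the normal variable of the trace of order `j`. -/
noncomputable def traceScale (r₂ j : ℕ) (Q X : ℝ) : ℝ := if j < r₂ then X else max X Q

/-- For `j < r₂`, one factor `X + z` of `(X + z)^r₂` becomes the denominator of the Poisson kernel,
and the others absorb `z^j`. For `j ≥ r₂`, all factors `X + z` go into `z^r₂`, and the denominator
comes from one factor `max (X + z) Q`, which is at least half of `max X Q + z`. That is the origin
of the constant 2. -/
theorem pow_mul_traceSymbol_le {r₁ r₂ j : ℕ} (hr : r₂ < r₁) (hj : j < r₁) {Q X z : ℝ}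
    (hX : 0 < X) (hz : 0 ≤ z) :
    z ^ j * traceSymbol r₁ r₂ j Q X ≤ 2 * (√(traceScale r₂ j Q X) / (traceScale r₂ j Q X + z)) *
      chgSymbol r₁ r₂ Q (X + z) := by
  have hM : max X Q ≤ max (X + z) Q := max_le_max_right _ (by linarith)
  have hB : 0 < max X Q := lt_max_of_lt_left hX
  have hM0 : 0 < max (X + z) Q := hB.trans_le hM
  unfold traceSymbol traceScale chgSymbol
  split_ifs with h
  · have e : r₂ = (r₂ - 1 - j) + j + 1 := by omega
    have h1 : z ^ j * X ^ (r₂ - 1 - j) ≤ (X + z) ^ (r₂ - 1) := by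
      calc z ^ j * X ^ (r₂ - 1 - j) ≤ (X + z) ^ j * (X + z) ^ (r₂ - 1 - j) := by
            gcongr <;> linarith
        _ = (X + z) ^ (r₂ - 1) := by rw [← pow_add]; congr 1; omega
    have h2 : (X + z) ^ r₂ = (X + z) ^ (r₂ - 1) * (X + z) := by
      rw [← pow_succ]; congr 1; omega
    have h3 : max X Q ^ (r₁ - r₂) ≤ max (X + z) Q ^ (r₁ - r₂) := by gcongr
    calc z ^ j * (X ^ (r₂ - 1 - j) * √X * max X Q ^ (r₁ - r₂))
        = (z ^ j * X ^ (r₂ - 1 - j)) * √X * max X Q ^ (r₁ - r₂) := by ring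
      _ ≤ (X + z) ^ (r₂ - 1) * √X * max (X + z) Q ^ (r₁ - r₂) := by gcongr
      _ ≤ 2 * ((X + z) ^ (r₂ - 1) * √X * max (X + z) Q ^ (r₁ - r₂)) :=
          le_mul_of_one_le_left (by positivity) (by norm_num)
      _ = _ := by
          rw [h2]
          have : X + z ≠ 0 := by positivity
          field_simp
  · have h : r₂ ≤ j := not_lt.1 h
    have h1 : z ^ j ≤ (X + z) ^ r₂ * max (X + z) Q ^ (j - r₂) := by
      calc z ^ j = z ^ r₂ * z ^ (j - r₂) := by rw [← pow_add]; congr 1; omega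
        _ ≤ (X + z) ^ r₂ * max (X + z) Q ^ (j - r₂) := by
            gcongr
            · linarith
            · exact le_max_of_le_left (by linarith)
    have h2 : max (X + z) Q ^ (r₁ - r₂) =
        max (X + z) Q ^ (j - r₂) * max (X + z) Q ^ (r₁ - 1 - j) * max (X + z) Q := by
      rw [← pow_add, ← pow_succ]; congr 1; omega
    have h3 : max X Q + z ≤ 2 * max (X + z) Q := by
      have : X + z ≤ max (X + z) Q := le_max_left _ _
      linarith
    calc z ^ j * (max X Q ^ (r₁ - 1 - j) * √(max X Q))
        ≤ ((X + z) ^ r₂ * max (X + z) Q ^ (j - r₂)) *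
            (max (X + z) Q ^ (r₁ - 1 - j) * √(max X Q)) := by gcongr
      _ = ((X + z) ^ r₂ * max (X + z) Q ^ (j - r₂) * max (X + z) Q ^ (r₁ - 1 - j)) *
            (√(max X Q) / (max X Q + z)) * (max X Q + z) := by
          have : max X Q + z ≠ 0 := by positivity
          field_simp
      _ ≤ ((X + z) ^ r₂ * max (X + z) Q ^ (j - r₂) * max (X + z) Q ^ (r₁ - 1 - j)) *
            (√(max X Q) / (max X Q + z)) * (2 * max (X + z) Q) := by gcongr
      _ = _ := by
          rw [h2]
          ring

theorem one_add_norm_joinLast_sq {d : ℕ} (x : EuclideanSpace ℝ (Fin d)) (s : ℝ) :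
    1 + (2 * Real.pi * ‖joinLast x s‖) ^ 2 =
      (1 + (2 * Real.pi * ‖x‖) ^ 2) + (2 * Real.pi * s) ^ 2 := by
  rw [mul_pow, norm_joinLast_sq]
  ring

theorem weight_traceOrder_mul_le {d r₁ r₂ j : ℕ} (hr : r₂ < r₁) (hj : j < r₁) {s₂ : ℝ}
    (hs : 0 ≤ s₂) (τ : ℝ) (x : EuclideanSpace ℝ (Fin d)) (s : ℝ) :
    weight (traceOrder r₁ r₂ s₂ j) τ (2 * Real.pi * ‖x‖) * |2 * Real.pi * s| ^ j ≤
      4 * √(2 * (√(traceScale r₂ j ((1 + τ ^ 2) ^ (s₂ / ((r₁ : ℝ) - r₂)))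
          (1 + (2 * Real.pi * ‖x‖) ^ 2)) /
        (traceScale r₂ j ((1 + τ ^ 2) ^ (s₂ / ((r₁ : ℝ) - r₂))) (1 + (2 * Real.pi * ‖x‖) ^ 2) +
          (2 * Real.pi * s) ^ 2))) *
      weight (chgOrder r₁ r₂ s₂) τ (2 * Real.pi * ‖joinLast x s‖) := by
  have h1 := (traceOrder_bounds hr hs hj τ (2 * Real.pi * ‖x‖)).2.2
  have h2 := chgSymbol_le_weight_sq hr hs τ (2 * Real.pi * ‖joinLast x s‖)
  rw [one_add_norm_joinLast_sq] at h2
  set Q := (1 + τ ^ 2) ^ (s₂ / ((r₁ : ℝ) - r₂))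
  set X := 1 + (2 * Real.pi * ‖x‖) ^ 2
  have hX : 0 < X := by positivity
  have h3 := pow_mul_traceSymbol_le hr hj (Q := Q) hX (sq_nonneg (2 * Real.pi * s))
  have hL : 0 < traceScale r₂ j Q X := by
    unfold traceScale
    split_ifs
    · exact hX
    · exact lt_max_of_lt_left hX
  have hw := weight_nonneg (chgOrder r₁ r₂ s₂) τ (2 * Real.pi * ‖joinLast x s‖)
  have hK : 0 ≤ 2 * (√(traceScale r₂ j Q X) / (traceScale r₂ j Q X + (2 * Real.pi * s) ^ 2)) := by
    positivity
  refine le_of_sq_le_sq ?_ (by positivity)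
  rw [mul_pow, mul_pow, mul_pow, Real.sq_sqrt hK, ← abs_pow, sq_abs, ← pow_mul, mul_comm j, pow_mul]
  calc weight (traceOrder r₁ r₂ s₂ j) τ (2 * Real.pi * ‖x‖) ^ 2 * ((2 * Real.pi * s) ^ 2) ^ j
      ≤ 16 * traceSymbol r₁ r₂ j Q X * ((2 * Real.pi * s) ^ 2) ^ j := by gcongr
    _ = 16 * (((2 * Real.pi * s) ^ 2) ^ j * traceSymbol r₁ r₂ j Q X) := by ring
    _ ≤ 16 * (2 * (√(traceScale r₂ j Q X) / (traceScale r₂ j Q X + (2 * Real.pi * s) ^ 2)) *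
        chgSymbol r₁ r₂ Q (X + (2 * Real.pi * s) ^ 2)) := by gcongr
    _ ≤ 16 * (2 * (√(traceScale r₂ j Q X) / (traceScale r₂ j Q X + (2 * Real.pi * s) ^ 2)) *
        weight (chgOrder r₁ r₂ s₂) τ (2 * Real.pi * ‖joinLast x s‖) ^ 2) := by gcongr
    _ = _ := by ring

theorem continuous_joinLast_right {d : ℕ} (x : EuclideanSpace ℝ (Fin d)) :
    Continuous fun s : ℝ => joinLast x s :=
  (joinLastL d).continuous.comp (Continuous.prodMk_right x)

theorem sq_lintegral_mul_le {α : Type*} [MeasurableSpace α] {ν : Measure α} {f g : α → ℝ≥0∞}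
    (hf : AEMeasurable f ν) (hg : AEMeasurable g ν) :
    (∫⁻ a, f a * g a ∂ν) ^ (2 : ℝ) ≤ (∫⁻ a, f a ^ (2 : ℝ) ∂ν) * ∫⁻ a, g a ^ (2 : ℝ) ∂ν := by
  have h := ENNReal.lintegral_mul_le_Lp_mul_Lq ν Real.HolderConjugate.two_two hf hg
  refine (ENNReal.rpow_le_rpow h (by norm_num : (0 : ℝ) ≤ 2)).trans_eq ?_
  rw [ENNReal.mul_rpow_of_nonneg _ _ (by norm_num), ← ENNReal.rpow_mul, ← ENNReal.rpow_mul]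
  norm_num

/-- Cauchy–Schwarz in `s`, with the square root of the Poisson kernel as one factor. As the kernel
has mass one for every scale, the constant is independent of `τ` and `x`; 16 comes from the upper
bound for the trace weight. -/
theorem sq_lintegral_trace_le {d r₁ r₂ j : ℕ} (hr : r₂ < r₁) (hj : j < r₁) {s₂ : ℝ}
    (hs : 0 ≤ s₂) (τ : ℝ) (x : EuclideanSpace ℝ (Fin d)) {g : ℝ → ℂ}
    (hg : AEStronglyMeasurable g volume) :
    (ENNReal.ofReal (weight (traceOrder r₁ r₂ s₂ j) τ (2 * Real.pi * ‖x‖)) *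
      ∫⁻ s : ℝ, ‖(2 * Real.pi * Complex.I * s) ^ j * g s‖ₑ) ^ (2 : ℝ) ≤
    16 * ∫⁻ s : ℝ, (ENNReal.ofReal (weight (chgOrder r₁ r₂ s₂) τ
      (2 * Real.pi * ‖joinLast x s‖)) * ‖g s‖ₑ) ^ (2 : ℝ) := by
  set L := traceScale r₂ j ((1 + τ ^ 2) ^ (s₂ / ((r₁ : ℝ) - r₂))) (1 + (2 * Real.pi * ‖x‖) ^ 2)
    with hLdef
  have hL : 0 < L := by
    have hX : 0 < 1 + (2 * Real.pi * ‖x‖) ^ 2 := by positivity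
    rw [hLdef, traceScale]
    split_ifs
    · exact hX
    · exact lt_max_of_lt_left hX
  have hw0 := weight_nonneg (traceOrder r₁ r₂ s₂ j) τ (2 * Real.pi * ‖x‖)
  have hle : ∀ s : ℝ, ENNReal.ofReal (weight (traceOrder r₁ r₂ s₂ j) τ (2 * Real.pi * ‖x‖)) *
      ‖(2 * Real.pi * Complex.I * s) ^ j * g s‖ₑ ≤
      ENNReal.ofReal (4 * √(2 * (√L / (L + (2 * Real.pi * s) ^ 2)))) *
        (ENNReal.ofReal (weight (chgOrder r₁ r₂ s₂) τ (2 * Real.pi * ‖joinLast x s‖)) *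
          ‖g s‖ₑ) := by
    intro s
    rw [enorm_mul, ← mul_assoc, ← mul_assoc, ← ofReal_norm ((_ : ℂ) ^ j),
      ← ENNReal.ofReal_mul hw0, ← ENNReal.ofReal_mul (by positivity)]
    refine mul_le_mul' (ENNReal.ofReal_le_ofReal ?_) le_rfl
    refine le_of_eq_of_le ?_ (weight_traceOrder_mul_le hr hj hs τ x s)
    rw [norm_pow]
    congr 2
    simp [abs_of_pos Real.pi_pos]
  have hm1 : AEMeasurable (fun s : ℝ =>
      ENNReal.ofReal (4 * √(2 * (√L / (L + (2 * Real.pi * s) ^ 2))))) volume := by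
    apply Measurable.aemeasurable
    fun_prop
  have hm2 : AEMeasurable (fun s : ℝ => ENNReal.ofReal (weight (chgOrder r₁ r₂ s₂) τ
      (2 * Real.pi * ‖joinLast x s‖)) * ‖g s‖ₑ) volume := by
    refine AEMeasurable.mul (Measurable.aemeasurable ?_) hg.enorm
    exact ((measurable_weight _ τ).comp
      ((continuous_joinLast_right x).norm.measurable.const_mul _)).ennreal_ofReal
  rw [← lintegral_const_mul' _ _ ENNReal.ofReal_ne_top]
  refine (ENNReal.rpow_le_rpow (lintegral_mono hle) (by norm_num)).trans ?_
  refine (sq_lintegral_mul_le hm1 hm2).trans_eq ?_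
  congr 1
  have e : ∀ s : ℝ, ENNReal.ofReal (4 * √(2 * (√L / (L + (2 * Real.pi * s) ^ 2)))) ^ (2 : ℝ) =
      16 * ENNReal.ofReal (2 * (√L / (L + (2 * Real.pi * s) ^ 2))) := by
    intro s
    rw [ENNReal.ofReal_rpow_of_nonneg (by positivity) (by norm_num), Real.rpow_two, mul_pow,
      Real.sq_sqrt (by positivity), ENNReal.ofReal_mul (by norm_num)]
    norm_num
  simp only [e]
  rw [lintegral_const_mul' _ _ (by norm_num), lintegral_poissonKernel hL, mul_one]

section trace

variable {T : ℝ} [hT : Fact (0 < T)] {d r₁ r₂ j : ℕ} {s₂ : ℝ}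

/-- `v` is the trace of order `j` of `u`, on the Fourier side. -/
def IsTrace (j : ℕ) (u : L2G T (d + 1)) (v : L2G T d) : Prop :=
  ∀ k : ℤ, fourierG v k =ᵐ[volume] fun x =>
    ∫ s : ℝ, (2 * Real.pi * Complex.I * s) ^ j * fourierG u k (joinLast x s)

theorem IsTrace.unique {u : L2G T (d + 1)} {v w : L2G T d} (hv : IsTrace j u v)
    (hw : IsTrace j u w) : v = w :=
  eq_of_fourierG_eq fun k => Lp.ext ((hv k).trans (hw k).symm)

theorem aestronglyMeasurable_joinLast (g : Lp ℂ 2 (volume : Measure (EuclideanSpace ℝ (Fin (d + 1))))) :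
    AEStronglyMeasurable (fun p : EuclideanSpace ℝ (Fin d) × ℝ => g (joinLast p.1 p.2))
      (volume.prod volume) :=
  (Lp.aestronglyMeasurable g).comp_measurePreserving (measurePreserving_joinLast d)

theorem lintegral_polyNorm_joinLast (μ : ℝ → ℝ) (u : L2G T (d + 1)) (k : ℤ) :
    ∫⁻ ξ : EuclideanSpace ℝ (Fin (d + 1)),
      (ENNReal.ofReal (weight μ (2 * Real.pi * k / T) (2 * Real.pi * ‖ξ‖)) *
        ‖fourierG u k ξ‖ₑ) ^ (2 : ℝ) =
    ∫⁻ x : EuclideanSpace ℝ (Fin d), ∫⁻ s : ℝ,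
      (ENNReal.ofReal (weight μ (2 * Real.pi * k / T) (2 * Real.pi * ‖joinLast x s‖)) *
        ‖fourierG u k (joinLast x s)‖ₑ) ^ (2 : ℝ) := by
  rw [lintegral_joinLast]
  refine AEMeasurable.pow_const (AEMeasurable.mul (Measurable.aemeasurable ?_)
    (Lp.aestronglyMeasurable _).enorm) _
  exact ((measurable_weight _ _).comp (measurable_norm.const_mul _)).ennreal_ofReal

theorem ae_integrable_trace (hr : r₂ < r₁) (hj : j < r₁) (hs : 0 ≤ s₂) {u : L2G T (d + 1)}
    (hu : polyNorm (chgOrder r₁ r₂ s₂) u < ⊤) (k : ℤ) :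
    ∀ᵐ x : EuclideanSpace ℝ (Fin d), Integrable fun s : ℝ =>
      (2 * Real.pi * Complex.I * s) ^ j * fourierG u k (joinLast x s) := by
  rw [polyNorm_lt_top_iff] at hu
  have hk := (ENNReal.le_tsum k).trans_lt hu
  rw [lintegral_polyNorm_joinLast] at hk
  have hm : AEMeasurable (fun p : EuclideanSpace ℝ (Fin d) × ℝ =>
      (ENNReal.ofReal (weight (chgOrder r₁ r₂ s₂) (2 * Real.pi * k / T)
        (2 * Real.pi * ‖joinLast p.1 p.2‖)) *
        ‖fourierG u k (joinLast p.1 p.2)‖ₑ) ^ (2 : ℝ)) (volume.prod volume) := by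
    refine AEMeasurable.pow_const (AEMeasurable.mul (Measurable.aemeasurable ?_)
      (aestronglyMeasurable_joinLast _).enorm) _
    exact ((measurable_weight _ _).comp
      ((joinLastL d).continuous.norm.measurable.const_mul _)).ennreal_ofReal
  filter_upwards [ae_lt_top' hm.lintegral_prod_right' hk.ne,
    (aestronglyMeasurable_joinLast (fourierG u k)).prodMk_left] with x hx hx'
  refine ⟨(by fun_prop : Continuous fun s : ℝ => (2 * Real.pi * Complex.I * s : ℂ) ^ j)
    |>.aestronglyMeasurable.mul hx', ?_⟩
  have h := (sq_lintegral_trace_le hr hj hs (2 * Real.pi * k / T) x hx').trans_lt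
    (ENNReal.mul_lt_top (by norm_num) hx)
  rw [ENNReal.rpow_lt_top_iff_of_pos (by norm_num)] at h
  have h1 := (traceOrder_bounds hr hs hj (2 * Real.pi * k / T) (2 * Real.pi * ‖x‖)).1
  refine lt_of_le_of_lt ?_ h
  exact le_mul_of_one_le_left zero_le (ENNReal.one_le_ofReal.2 h1)

/-- The slice estimate is integrated in `x` and summed over `k`. Since the trace weights are at
least one, the resulting transforms are square summable and hence come from an element of `L²`. -/
theorem exists_isTrace (hr : r₂ < r₁) (hj : j < r₁) (hs : 0 ≤ s₂) {u : L2G T (d + 1)}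
    (hu : polyNorm (chgOrder r₁ r₂ s₂) u < ⊤) :
    ∃ v : L2G T d, IsTrace j u v ∧
      polyNorm (traceOrder r₁ r₂ s₂ j) v ≤ 4 * polyNorm (chgOrder r₁ r₂ s₂) u := by
  set h : ℤ → EuclideanSpace ℝ (Fin d) → ℂ := fun k x =>
    ∫ s : ℝ, (2 * Real.pi * Complex.I * s) ^ j * fourierG u k (joinLast x s) with hh
  have hmeas : ∀ k, AEStronglyMeasurable (h k) volume := fun k => by
    refine AEStronglyMeasurable.integral_prod_right' (ν := volume)
      (f := fun p : EuclideanSpace ℝ (Fin d) × ℝ =>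
        (2 * Real.pi * Complex.I * p.2 : ℂ) ^ j * fourierG u k (joinLast p.1 p.2)) ?_
    exact (by fun_prop : Continuous fun p : EuclideanSpace ℝ (Fin d) × ℝ =>
      (2 * Real.pi * Complex.I * p.2 : ℂ) ^ j).aestronglyMeasurable.mul
      (aestronglyMeasurable_joinLast _)
  have hbound : ∀ k : ℤ, ∫⁻ x, (ENNReal.ofReal (weight (traceOrder r₁ r₂ s₂ j) (2 * Real.pi * k / T)
      (2 * Real.pi * ‖x‖)) * ‖h k x‖ₑ) ^ (2 : ℝ) ≤
      16 * ∫⁻ ξ : EuclideanSpace ℝ (Fin (d + 1)),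
        (ENNReal.ofReal (weight (chgOrder r₁ r₂ s₂) (2 * Real.pi * k / T) (2 * Real.pi * ‖ξ‖)) *
          ‖fourierG u k ξ‖ₑ) ^ (2 : ℝ) := by
    intro k
    rw [lintegral_polyNorm_joinLast, ← lintegral_const_mul' _ _ (by norm_num)]
    refine lintegral_mono_ae ?_
    filter_upwards [(aestronglyMeasurable_joinLast (fourierG u k)).prodMk_left] with x hx
    refine le_trans ?_ (sq_lintegral_trace_le hr hj hs (2 * Real.pi * k / T) x hx)
    gcongr
    exact enorm_integral_le_lintegral_enorm _
  have hsum : ∑' k : ℤ, ∫⁻ x, (ENNReal.ofReal (weight (traceOrder r₁ r₂ s₂ j)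
      (2 * Real.pi * k / T) (2 * Real.pi * ‖x‖)) * ‖h k x‖ₑ) ^ (2 : ℝ) ≤
      16 * ∑' k : ℤ, ∫⁻ ξ : EuclideanSpace ℝ (Fin (d + 1)),
        (ENNReal.ofReal (weight (chgOrder r₁ r₂ s₂) (2 * Real.pi * k / T) (2 * Real.pi * ‖ξ‖)) *
          ‖fourierG u k ξ‖ₑ) ^ (2 : ℝ) := by
    rw [← ENNReal.tsum_mul_left]
    exact ENNReal.tsum_le_tsum hbound
  have hu' := (polyNorm_lt_top_iff _ u).1 hu
  have hlt := hsum.trans_lt (ENNReal.mul_lt_top (by norm_num) hu')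
  have hone : ∀ k : ℤ, ∫⁻ x, ‖h k x‖ₑ ^ (2 : ℝ) ≤ ∫⁻ x, (ENNReal.ofReal
      (weight (traceOrder r₁ r₂ s₂ j) (2 * Real.pi * k / T) (2 * Real.pi * ‖x‖)) *
        ‖h k x‖ₑ) ^ (2 : ℝ) := by
    intro k
    refine lintegral_mono fun x => ENNReal.rpow_le_rpow ?_ (by norm_num)
    have h1 := (traceOrder_bounds hr hs hj (2 * Real.pi * k / T) (2 * Real.pi * ‖x‖)).1
    exact le_mul_of_one_le_left zero_le (ENNReal.one_le_ofReal.2 h1)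
  have hmem : ∀ k, MemLp (h k) 2 volume := fun k => by
    refine ⟨hmeas k, ?_⟩
    rw [eLpNorm_lt_top_iff_lintegral_rpow_enorm_lt_top (by norm_num) (by norm_num)]
    exact (hone k).trans_lt ((ENNReal.le_tsum k).trans_lt hlt)
  obtain ⟨v, hv⟩ := exists_fourierG_eq (T := T) (fun k => (hmem k).toLp _) (by
    refine lt_of_le_of_lt (ENNReal.tsum_le_tsum fun k => ?_) hlt
    refine le_trans (le_of_eq (lintegral_congr_ae ?_)) (hone k)
    filter_upwards [(hmem k).coeFn_toLp] with x hx
    rw [hx])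
  have hv' : IsTrace j u v := fun k => by
    rw [hv k]
    exact (hmem k).coeFn_toLp
  refine ⟨v, hv', ?_⟩
  have e : polyNorm (traceOrder r₁ r₂ s₂ j) v = (∑' k : ℤ, ∫⁻ x, (ENNReal.ofReal
      (weight (traceOrder r₁ r₂ s₂ j) (2 * Real.pi * k / T) (2 * Real.pi * ‖x‖)) *
        ‖h k x‖ₑ) ^ (2 : ℝ)) ^ (1 / 2 : ℝ) := by
    unfold polyNorm
    congr 1
    refine tsum_congr fun k => lintegral_congr_ae ?_
    filter_upwards [hv' k] with x hx
    rw [hx]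
  rw [e]
  refine (ENNReal.rpow_le_rpow hsum (by norm_num)).trans_eq ?_
  rw [ENNReal.mul_rpow_of_nonneg _ _ (by norm_num)]
  unfold polyNorm
  congr 1
  rw [show (16 : ℝ≥0∞) = 4 ^ (2 : ℝ) by norm_num, ← ENNReal.rpow_mul]
  norm_num

/-- Finite norms are needed here: they make the slice integrals converge absolutely, whereas the
integral of a nonintegrable function is zero by convention and would not be additive. -/
theorem IsTrace.add (hr : r₂ < r₁) (hj : j < r₁) (hs : 0 ≤ s₂) {u u' : L2G T (d + 1)}
    {v v' : L2G T d} (hu : polyNorm (chgOrder r₁ r₂ s₂) u < ⊤)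
    (hu' : polyNorm (chgOrder r₁ r₂ s₂) u' < ⊤) (h : IsTrace j u v) (h' : IsTrace j u' v') :
    IsTrace j (u + u') (v + v') := by
  intro k
  rw [fourierG_add, fourierG_add]
  filter_upwards [Lp.coeFn_add (fourierG v k) (fourierG v' k), h k, h' k,
    ae_joinLast (Lp.coeFn_add (fourierG u k) (fourierG u' k)),
    ae_integrable_trace hr hj hs hu k, ae_integrable_trace hr hj hs hu' k]
    with x h1 h2 h3 h4 h5 h6
  rw [h1, Pi.add_apply, h2, h3, ← integral_add h5 h6]
  refine integral_congr_ae ?_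
  filter_upwards [h4] with s hs
  rw [hs, Pi.add_apply, mul_add]

theorem IsTrace.smul (c : ℂ) {u : L2G T (d + 1)} {v : L2G T d} (h : IsTrace j u v) :
    IsTrace j (c • u) (c • v) := by
  intro k
  rw [fourierG_smul, fourierG_smul]
  filter_upwards [Lp.coeFn_smul c (fourierG v k), h k,
    ae_joinLast (Lp.coeFn_smul c (fourierG u k))] with x h1 h2 h3
  rw [h1, Pi.smul_apply, h2, smul_eq_mul, ← integral_const_mul]
  refine integral_congr_ae ?_
  filter_upwards [h3] with s hs
  rw [hs, Pi.smul_apply, smul_eq_mul, mul_left_comm]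

theorem IsTrace.mem_oscillatory {u : L2G T (d + 1)} {v : L2G T d} (h : IsTrace j u v)
    (hu : u ∈ oscillatory T (d + 1)) : v ∈ oscillatory T d := by
  rw [mem_oscillatory_iff] at hu ⊢
  refine Lp.ext ?_
  have h0 := Lp.coeFn_zero ℂ 2 (volume : Measure (EuclideanSpace ℝ (Fin (d + 1))))
  rw [← hu] at h0
  filter_upwards [h 0, ae_joinLast h0,
    Lp.coeFn_zero ℂ 2 (volume : Measure (EuclideanSpace ℝ (Fin d)))] with x h1 h2 h3
  rw [h1, h3, Pi.zero_apply]
  refine (integral_congr_ae ?_).trans (integral_zero _ _)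
  filter_upwards [h2] with s hs
  rw [hs, Pi.zero_apply, mul_zero]

end trace

/-! ### The trace only depends on the restriction to the half space -/

section tensor

variable {d : ℕ}

variable (d) in
/-- The projection `(x', x_n) ↦ x'`. -/
noncomputable def initL : EuclideanSpace ℝ (Fin (d + 1)) →L[ℝ] EuclideanSpace ℝ (Fin d) :=
  LinearMap.toContinuousLinearMap
    { toFun := fun x => WithLp.toLp 2 fun i => x i.castSucc
      map_add' := fun p q => by ext i; simp
      map_smul' := fun c p => by ext i; simp }

variable (d) in
/-- The projection `(x', x_n) ↦ x_n`. -/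
noncomputable def lastL : EuclideanSpace ℝ (Fin (d + 1)) →L[ℝ] ℝ := EuclideanSpace.proj (Fin.last d)

@[simp]
theorem lastL_apply (x : EuclideanSpace ℝ (Fin (d + 1))) : lastL d x = x (Fin.last d) := rfl

@[simp]
theorem initL_joinLast (x : EuclideanSpace ℝ (Fin d)) (s : ℝ) : initL d (joinLast x s) = x := by
  ext i
  simp [initL, joinLast]

theorem joinLast_initL (x : EuclideanSpace ℝ (Fin (d + 1))) :
    joinLast (initL d x) (x (Fin.last d)) = x := by
  ext i
  refine Fin.lastCases ?_ (fun j => ?_) i <;> simp [initL, joinLast]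

/-- The function `(x', x_n) ↦ χ(x') θ(x_n)`. -/
noncomputable def tensor (χ : EuclideanSpace ℝ (Fin d) → ℂ) (θ : ℝ → ℂ) (x : EuclideanSpace ℝ (Fin (d + 1))) : ℂ :=
  χ (initL d x) * θ (lastL d x)

theorem contDiff_tensor {χ : EuclideanSpace ℝ (Fin d) → ℂ} {θ : ℝ → ℂ}
    (hχ : ContDiff ℝ (⊤ : ℕ∞) χ) (hθ : ContDiff ℝ (⊤ : ℕ∞) θ) :
    ContDiff ℝ (⊤ : ℕ∞) (tensor χ θ) :=
  (hχ.comp (initL d).contDiff).mul (hθ.comp (lastL d).contDiff)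

theorem hasCompactSupport_tensor {χ : EuclideanSpace ℝ (Fin d) → ℂ} {θ : ℝ → ℂ}
    (hχ : HasCompactSupport χ) (hθ : HasCompactSupport θ) : HasCompactSupport (tensor χ θ) := by
  refine HasCompactSupport.intro ((hχ.prod hθ).image (joinLastL d).continuous) fun x hx => ?_
  by_contra h
  refine hx ⟨(initL d x, x (Fin.last d)), ⟨subset_tsupport _ ?_, subset_tsupport _ ?_⟩,
    joinLast_initL x⟩
  · exact left_ne_zero_of_mul h
  · exact right_ne_zero_of_mul h

theorem fourier_tensor (χ : EuclideanSpace ℝ (Fin d) → ℂ) (θ : ℝ → ℂ)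
    (x : EuclideanSpace ℝ (Fin d)) (s : ℝ) :
    𝓕 (tensor χ θ) (joinLast x s) = 𝓕 χ x * 𝓕 θ s := by
  rw [Real.fourier_eq', Real.fourier_eq', Real.fourier_eq',
    ← (measurePreserving_joinLast d).integral_comp (measurableEmbedding_joinLast d),
    ← integral_prod_mul]
  refine integral_congr_ae (Filter.Eventually.of_forall fun p => ?_)
  simp only [tensor, initL_joinLast, lastL_apply, joinLast_last, inner_joinLast, smul_eq_mul]
  have e : (((-2 * Real.pi * (inner ℝ p.1 x + p.2 * s) : ℝ) : ℂ) * Complex.I) =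
      ((-2 * Real.pi * inner ℝ p.1 x : ℝ) : ℂ) * Complex.I +
        ((-2 * Real.pi * inner ℝ p.2 s : ℝ) : ℂ) * Complex.I := by
    have : inner ℝ p.2 s = p.2 * s := by
      rw [real_inner_comm]
      rfl
    rw [this]
    push_cast
    ring
  rw [e, Complex.exp_add]
  ring

end tensor

/-! ### Partial Fourier transforms of functions supported in the opposite half space. -/

section slice

variable {d : ℕ}

/-- The slice integral `H` is square integrable in `x`, and the hypothesis says that it is
orthogonal to the transforms of all test functions. By Plancherel its inverse transform `K`
annihilates all test functions, so `K = 0`. -/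
theorem ae_slice_integral_eq_zero
    {g : Lp ℂ 2 (volume : Measure (EuclideanSpace ℝ (Fin (d + 1))))} {κ : ℝ → ℂ} (hκ : MemLp κ 2 volume)
    (h : ∀ χ : EuclideanSpace ℝ (Fin d) → ℂ, (hχ : ContDiff ℝ (⊤ : ℕ∞) χ) →
      (hχ' : HasCompactSupport χ) →
      MemLp (fun ξ : EuclideanSpace ℝ (Fin (d + 1)) => 𝓕 χ (initL d ξ) * κ (lastL d ξ)) 2 volume ∧
      ∫ ξ : EuclideanSpace ℝ (Fin (d + 1)),
        g ξ * starRingEnd ℂ (𝓕 χ (initL d ξ) * κ (lastL d ξ)) = 0) :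
    ∀ᵐ x : EuclideanSpace ℝ (Fin d), ∫ s : ℝ, g (joinLast x s) * starRingEnd ℂ (κ s) = 0 := by
  set H : EuclideanSpace ℝ (Fin d) → ℂ :=
    fun x => ∫ s : ℝ, g (joinLast x s) * starRingEnd ℂ (κ s) with hH
  have hκm : AEStronglyMeasurable (fun s => starRingEnd ℂ (κ s)) volume :=
    (Complex.continuous_conj).comp_aestronglyMeasurable hκ.1
  have hκ2 := hκ.2
  rw [eLpNorm_lt_top_iff_lintegral_rpow_enorm_lt_top (by norm_num) (by norm_num)] at hκ2
  have hm : AEStronglyMeasurable (fun p : EuclideanSpace ℝ (Fin d) × ℝ =>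
      g (joinLast p.1 p.2) * starRingEnd ℂ (κ p.2)) (volume.prod volume) :=
    (aestronglyMeasurable_joinLast g).mul hκm.comp_snd
  have hg2 : ∫⁻ ξ, ‖g ξ‖ₑ ^ (2 : ℝ) < ⊤ := by
    rw [lintegral_enorm_sq_eq]
    exact ENNReal.rpow_lt_top_of_nonneg (by norm_num) enorm_ne_top
  rw [lintegral_joinLast ((Lp.aestronglyMeasurable g).enorm.pow_const _)] at hg2
  -- Cauchy–Schwarz in `s` against `κ`, followed by integration in `x`.
  have hHm : MemLp H 2 volume := by
    refine ⟨hm.integral_prod_right', ?_⟩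
    rw [eLpNorm_lt_top_iff_lintegral_rpow_enorm_lt_top (by norm_num) (by norm_num)]
    refine lt_of_le_of_lt ?_ (ENNReal.mul_lt_top hg2 hκ2)
    rw [← lintegral_mul_const' _ _ hκ2.ne]
    refine lintegral_mono_ae ?_
    filter_upwards [(aestronglyMeasurable_joinLast g).prodMk_left] with x hx
    refine (ENNReal.rpow_le_rpow (enorm_integral_le_lintegral_enorm _) (by norm_num)).trans ?_
    simp only [enorm_mul]
    refine (sq_lintegral_mul_le hx.enorm hκm.enorm).trans_eq ?_
    congr 1
    refine lintegral_congr fun s => ?_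
    rw [RCLike.enorm_conj]
    rfl
  set K := 𝓕⁻ (hHm.toLp H) with hK
  have hK0 : K = 0 := by
    refine Lp.ext (Filter.EventuallyEq.trans ?_ (Lp.coeFn_zero ℂ 2 volume).symm)
    refine ae_eq_zero_of_integral_contDiff_smul_eq_zero
      ((Lp.memLp K).locallyIntegrable (by norm_num)) fun χ hχ hχ' => ?_
    have h1 : ContDiff ℝ (⊤ : ℕ∞) fun x => (χ x : ℂ) := Complex.ofRealCLM.contDiff.comp hχ
    have h2 : HasCompactSupport fun x => (χ x : ℂ) := hχ'.comp_left (g := Complex.ofReal) rfl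
    set χs := h2.toSchwartzMap h1 with hχs
    have e1 : inner ℂ (χs.toLp 2) K = ∫ x, χ x • K x := by
      rw [L2.inner_def]
      refine integral_congr_ae ?_
      filter_upwards [χs.coeFn_toLp 2 volume] with x hx
      rw [hx, RCLike.inner_apply]
      change K x * starRingEnd ℂ (χ x : ℂ) = _
      rw [Complex.conj_ofReal, Complex.real_smul, mul_comm]
    have e2 : inner ℂ (χs.toLp 2) K = inner ℂ ((𝓕 χs).toLp 2) (hHm.toLp H) := by
      rw [← SchwartzMap.toLp_fourier_eq, ← Lp.inner_fourier_eq, hK,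
        FourierTransform.fourier_fourierInv_eq]
    rw [← e1, e2, L2.inner_def, ← (h _ h1 h2).2, integral_joinLast]
    · refine integral_congr_ae ?_
      filter_upwards [hHm.coeFn_toLp, (𝓕 χs).coeFn_toLp 2 volume] with x hx hx'
      rw [hx, hx', RCLike.inner_apply, hH, SchwartzMap.fourier_coe]
      simp only [initL_joinLast, lastL_apply, joinLast_last, map_mul]
      rw [← integral_mul_const]
      refine integral_congr_ae (Filter.Eventually.of_forall fun s => ?_)
      have e : ∀ a b c : ℂ, a * b * c = a * (c * b) := fun a b c => by ring
      exact e _ _ _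
    · exact (Lp.memLp g).integrable_mul (h _ h1 h2).1.star
  have hH0 : hHm.toLp H = 0 := by
    rw [← FourierTransform.fourier_fourierInv_eq (F := Lp ℂ 2 (volume : Measure (EuclideanSpace ℝ (Fin d)))) (hHm.toLp H), ← hK, hK0]
    exact (Lp.fourierTransformₗᵢ (EuclideanSpace ℝ (Fin d)) ℂ).map_zero
  filter_upwards [hHm.coeFn_toLp, Lp.coeFn_zero ℂ 2 (volume : Measure (EuclideanSpace ℝ (Fin d)))]
    with x h1 h2
  exact h1.symm.trans (by rw [hH0, h2]; rfl)

/-- If `f ∈ L²(ℝᵈ⁺¹)` vanishes on the half space, then the partial Fourier transforms of `f` in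
the tangential variables vanish on the half line, in the sense of distributions. -/
theorem ae_fourier_slice_eq_zero {f : Lp ℂ 2 (volume : Measure (EuclideanSpace ℝ (Fin (d + 1))))}
    (hf : ∀ᵐ x, 0 < x (Fin.last d) → f x = 0) {θ : ℝ → ℂ} (hθ : ContDiff ℝ (⊤ : ℕ∞) θ)
    (hθ' : HasCompactSupport θ) (hθ0 : tsupport θ ⊆ Ioi 0) :
    ∀ᵐ x : EuclideanSpace ℝ (Fin d),
      ∫ s : ℝ, (𝓕 f : Lp ℂ 2 _) (joinLast x s) * starRingEnd ℂ (𝓕 θ s) = 0 := by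
  have hκ : MemLp (𝓕 θ) 2 volume := (𝓕 (hθ'.toSchwartzMap hθ)).memLp 2 volume
  refine ae_slice_integral_eq_zero hκ fun χ hχ hχ' => ?_
  set ψ := (hasCompactSupport_tensor hχ' hθ').toSchwartzMap (contDiff_tensor hχ hθ) with hψ
  have h1 : inner ℂ (ψ.toLp 2) f = 0 := by
    rw [L2.inner_def]
    refine (integral_congr_ae ?_).trans (integral_zero _ _)
    filter_upwards [hf, ψ.coeFn_toLp 2 volume] with x hx hx'
    rw [hx', RCLike.inner_apply]
    by_cases h0 : 0 < x (Fin.last d)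
    · rw [hx h0, zero_mul]
    · have : ψ x = 0 := by
        change χ (initL d x) * θ (lastL d x) = 0
        rw [image_eq_zero_of_notMem_tsupport (f := θ) (x := lastL d x) fun h => h0 (hθ0 h),
          mul_zero]
      rw [this, map_zero, mul_zero]
  have e : (fun ξ : EuclideanSpace ℝ (Fin (d + 1)) => 𝓕 χ (initL d ξ) * 𝓕 θ (lastL d ξ)) =
      𝓕 (tensor χ θ) := by
    funext ξ
    conv_rhs => rw [← joinLast_initL ξ]
    exact (fourier_tensor χ θ _ _).symm
  refine ⟨e ▸ (𝓕 ψ).memLp 2 volume, ?_⟩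
  rw [← Lp.inner_fourier_eq, SchwartzMap.toLp_fourier_eq, L2.inner_def] at h1
  rw [← h1]
  refine integral_congr_ae ?_
  filter_upwards [(𝓕 ψ).coeFn_toLp 2 volume] with ξ hξ
  rw [hξ, RCLike.inner_apply, SchwartzMap.fourier_coe]
  exact congrArg (fun z => _ * starRingEnd ℂ z) (congrFun e ξ)

/-- The factor `2πis` is moved onto the test function, where it becomes a derivative;
differentiation keeps the support inside `(0, ∞)`, so the induction runs over all `θ` at once. -/
theorem ae_pow_fourier_slice_eq_zero
    {f : Lp ℂ 2 (volume : Measure (EuclideanSpace ℝ (Fin (d + 1))))}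
    (hf : ∀ᵐ x, 0 < x (Fin.last d) → f x = 0) (j : ℕ) {θ : ℝ → ℂ} (hθ : ContDiff ℝ (⊤ : ℕ∞) θ)
    (hθ' : HasCompactSupport θ) (hθ0 : tsupport θ ⊆ Ioi 0) :
    ∀ᵐ x : EuclideanSpace ℝ (Fin d), ∫ s : ℝ, (2 * Real.pi * Complex.I * s) ^ j *
      (𝓕 f : Lp ℂ 2 _) (joinLast x s) * starRingEnd ℂ (𝓕 θ s) = 0 := by
  induction j generalizing θ with
  | zero => simpa using ae_fourier_slice_eq_zero hf hθ hθ' hθ0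
  | succ j ih =>
    have hd : ContDiff ℝ (⊤ : ℕ∞) (deriv θ) := (contDiff_infty_iff_deriv.1 hθ).2
    have h := ih hd hθ'.deriv ((closure_minimal (support_deriv_subset) (isClosed_tsupport θ)).trans
      hθ0)
    rw [Real.fourier_deriv (hθ.continuous.integrable_of_hasCompactSupport hθ')
      (hθ.differentiable (by norm_num))
      (hd.continuous.integrable_of_hasCompactSupport hθ'.deriv)] at h
    filter_upwards [h] with x hx
    -- The transform of `θ'` is conjugated in the pairing, which turns `2πis` into `-2πis`; hence
    -- the sign.
    rw [← neg_eq_zero, ← hx, ← integral_neg]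
    refine integral_congr_ae (Filter.Eventually.of_forall fun s => ?_)
    simp only [smul_eq_mul, map_mul, Complex.conj_ofReal, Complex.conj_I, map_ofNat]
    ring

/-- Nonnegative bumps of integral one that concentrate at the origin from inside the half line. A
sequence is used because the exceptional null set depends on the test function. -/
theorem exists_bump_seq : ∃ b : ℕ → ℝ → ℂ, (∀ m, ContDiff ℝ (⊤ : ℕ∞) (b m)) ∧
    (∀ m, HasCompactSupport (b m)) ∧ (∀ m, tsupport (b m) ⊆ Ioi 0) ∧
    (∀ m s, ‖𝓕 (b m) s‖ ≤ 1) ∧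
    ∀ s, Filter.Tendsto (fun m => 𝓕 (b m) s) Filter.atTop (nhds 1) := by
  let e : ℕ → ℝ := fun m => 1 / ((m : ℝ) + 1)
  have he : ∀ m, 0 < e m := fun m => by positivity
  -- Centre `2e` and outer radius `e` place the support in `[e, 3e]`, away from the origin.
  let B : (m : ℕ) → ContDiffBump (2 * e m : ℝ) := fun m =>
    ⟨e m / 2, e m, by have := he m; positivity, by have := he m; linarith⟩
  have hsupp : ∀ m, tsupport ((B m).normed volume) ⊆ Icc (e m) (3 * e m) := by
    intro m
    rw [ContDiffBump.tsupport_normed_eq, Real.closedBall_eq_Icc]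
    refine Icc_subset_Icc ?_ ?_ <;> (simp only [B]; linarith)
  have hts : ∀ m, tsupport (fun x => ((B m).normed volume x : ℂ)) ⊆ Icc (e m) (3 * e m) :=
    fun m => (closure_mono (fun x hx => by
      simpa using hx)).trans (hsupp m)
  have hint : ∀ m, Integrable fun x => ((B m).normed volume x : ℂ) := fun m =>
    (B m).integrable_normed.ofReal
  have hI : ∀ m, ∫ x, ((B m).normed volume x : ℂ) = 1 := fun m => by
    rw [integral_complex_ofReal, (B m).integral_normed, Complex.ofReal_one]
  have hI' : ∀ m, ∫ x, ‖((B m).normed volume x : ℂ)‖ = 1 := fun m => by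
    rw [← (B m).integral_normed (μ := volume)]
    refine integral_congr_ae (Filter.Eventually.of_forall fun x => ?_)
    simp only [Complex.norm_real, Real.norm_eq_abs, abs_of_nonneg ((B m).nonneg_normed x)]
  refine ⟨fun m x => ((B m).normed volume x : ℂ),
    fun m => Complex.ofRealCLM.contDiff.comp (B m).contDiff_normed,
    fun m => (B m).hasCompactSupport_normed.comp_left (g := Complex.ofReal) rfl,
    fun m => (hts m).trans fun x hx => (he m).trans_le hx.1, fun m s => ?_, fun s => ?_⟩
  · rw [← hI' m, Real.fourier_real_eq]
    refine (norm_integral_le_integral_norm _).trans_eq ?_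
    simp only [Circle.norm_smul]
  · have hb : ∀ m, ‖𝓕 (fun x => ((B m).normed volume x : ℂ)) s - 1‖ ≤
        2 * Real.pi * |s| * 3 * e m := by
      intro m
      rw [Real.fourier_real_eq_integral_exp_smul]
      have hint2 : Integrable fun x : ℝ => Complex.exp (((-2 * Real.pi * x * s : ℝ) : ℂ) *
          Complex.I) • ((B m).normed volume x : ℂ) := by
        refine (hint m).bdd_mul (c := 1) (Continuous.aestronglyMeasurable (by fun_prop))
          (Filter.Eventually.of_forall fun x => ?_)
        rw [Complex.norm_exp_ofReal_mul_I]
      rw [← hI m, ← integral_sub hint2 (hint m)]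
      refine (norm_integral_le_integral_norm _).trans ?_
      have hle : ∀ x : ℝ, ‖Complex.exp (((-2 * Real.pi * x * s : ℝ) : ℂ) * Complex.I) •
          ((B m).normed volume x : ℂ) - ((B m).normed volume x : ℂ)‖ ≤
          (2 * Real.pi * |s| * 3 * e m) * ‖((B m).normed volume x : ℂ)‖ := by
        intro x
        by_cases hx : x ∈ Icc (e m) (3 * e m)
        · rw [smul_eq_mul, ← sub_one_mul, norm_mul]
          gcongr
          rw [mul_comm _ Complex.I]
          refine Real.norm_exp_I_mul_ofReal_sub_one_le.trans ?_
          have hx0 : 0 ≤ x := (he m).le.trans hx.1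
          rw [Real.norm_eq_abs, abs_mul, abs_mul, abs_mul, abs_neg, abs_of_pos Real.pi_pos,
            abs_of_nonneg hx0, abs_two]
          have := Real.pi_pos
          calc 2 * Real.pi * x * |s| ≤ 2 * Real.pi * (3 * e m) * |s| := by
                have := hx.2
                gcongr
            _ = _ := by ring
        · have h0 : ((B m).normed volume x : ℂ) = 0 :=
            image_eq_zero_of_notMem_tsupport (f := fun x => ((B m).normed volume x : ℂ))
              fun h => hx (hts m h)
          simp [h0]
      refine (integral_mono (hint2.sub (hint m)).norm ((hint m).norm.const_mul _) hle).trans_eq ?_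
      rw [integral_const_mul, hI' m, mul_one]
    rw [tendsto_iff_norm_sub_tendsto_zero]
    refine squeeze_zero (fun m => norm_nonneg _) hb ?_
    simpa [e] using (tendsto_one_div_add_atTop_nhds_zero_nat (𝕜 := ℝ)).const_mul
      (2 * Real.pi * |s| * 3)

/-- The transforms of the bumps are bounded by one and tend to one pointwise, so dominated
convergence removes them from the vanishing pairings; absolute convergence of the trace integral
supplies the majorant. -/
theorem ae_trace_eq_zero {f : Lp ℂ 2 (volume : Measure (EuclideanSpace ℝ (Fin (d + 1))))}
    (hf : ∀ᵐ x, 0 < x (Fin.last d) → f x = 0) (j : ℕ)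
    (hi : ∀ᵐ x : EuclideanSpace ℝ (Fin d), Integrable fun s : ℝ =>
      (2 * Real.pi * Complex.I * s) ^ j * (𝓕 f : Lp ℂ 2 _) (joinLast x s)) :
    ∀ᵐ x : EuclideanSpace ℝ (Fin d), ∫ s : ℝ, (2 * Real.pi * Complex.I * s) ^ j *
      (𝓕 f : Lp ℂ 2 _) (joinLast x s) = 0 := by
  obtain ⟨b, hb1, hb2, hb3, hb4, hb5⟩ := exists_bump_seq
  have h := ae_all_iff.2 fun m => ae_pow_fourier_slice_eq_zero hf j (hb1 m) (hb2 m) (hb3 m)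
  filter_upwards [h, hi] with x hx hix
  have ht : Filter.Tendsto (fun m => ∫ s : ℝ, (2 * Real.pi * Complex.I * s) ^ j *
      (𝓕 f : Lp ℂ 2 _) (joinLast x s) * starRingEnd ℂ (𝓕 (b m) s)) Filter.atTop
      (nhds (∫ s : ℝ, (2 * Real.pi * Complex.I * s) ^ j *
        (𝓕 f : Lp ℂ 2 _) (joinLast x s) * starRingEnd ℂ 1)) := by
    refine tendsto_integral_of_dominated_convergence _ (fun m => hix.1.mul ?_) hix.norm
      (fun m => Filter.Eventually.of_forall fun s => ?_) (Filter.Eventually.of_forall fun s => ?_)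
    · exact (Complex.continuous_conj.comp
        (𝓕 ((hb2 m).toSchwartzMap (hb1 m))).continuous).aestronglyMeasurable
    · rw [norm_mul]
      refine mul_le_of_le_one_right (norm_nonneg _) ?_
      rw [RCLike.norm_conj]
      exact hb4 m s
    · exact ((Complex.continuous_conj.tendsto 1).comp (hb5 s)).const_mul _
  simp only [hx, map_one, mul_one] at ht
  exact tendsto_nhds_unique ht tendsto_const_nhds

end slice

/-! ### Traces of elements with zero restriction. -/

section restrict

variable {T : ℝ} {d r₁ r₂ j : ℕ} {s₂ : ℝ}

theorem measurableSet_halfSpace : MeasurableSet (halfSpace T d) := by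
  have h : Continuous fun p : TorusSpace T (d + 1) => p.2 (Fin.last d) :=
    (lastL d).continuous.comp continuous_snd
  exact measurableSet_lt measurable_const h.measurable

variable [hT : Fact (0 < T)]

theorem ae_timeCoeff_eq_zero {u : L2G T (d + 1)} (hu : restrictL2 T d u = 0) (k : ℤ) :
    ∀ᵐ x, 0 < x (Fin.last d) → timeCoeff u k x = 0 := by
  have h1 : u =ᵐ[(torusMeasure T (d + 1)).restrict (halfSpace T d)] 0 := by
    have h2 := LpToLpRestrictCLM_coeFn (F := ℂ) ℂ (p := 2) (halfSpace T d) u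
    have h3 : LpToLpRestrictCLM (TorusSpace T (d + 1)) ℂ ℂ (torusMeasure T (d + 1)) 2
      (halfSpace T d) u = 0 := hu
    rw [h3] at h2
    exact h2.symm.trans (Lp.coeFn_zero ℂ 2 _)
  -- Replacing `u` by its truncation gives an identity almost everywhere on the whole space, to
  -- which slicing by Fubini applies.
  have h2 : u =ᵐ[torusMeasure T (d + 1)] (halfSpace T d)ᶜ.indicator u := by
    filter_upwards [(ae_restrict_iff' measurableSet_halfSpace).1 h1] with p hp
    by_cases h : p ∈ halfSpace T d
    · rw [indicator_of_notMem (by simpa using h)]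
      exact hp h
    · rw [indicator_of_mem (by simpa using h)]
  filter_upwards [coeFn_timeCoeff u k, ae_slice h2] with x hx hs h0
  rw [hx, fourierCoeff_congr_ae hs]
  have e : ∀ t : AddCircle T, (halfSpace T d)ᶜ.indicator u (t, x) = 0 := fun t =>
    indicator_of_notMem (by simpa [halfSpace] using h0) _
  simp only [e, fourierCoeff, smul_zero, integral_zero]

theorem isTrace_zero_of_restrict (hr : r₂ < r₁) (hj : j < r₁) (hs : 0 ≤ s₂) {u : L2G T (d + 1)}
    (hu : polyNorm (chgOrder r₁ r₂ s₂) u < ⊤) (hu' : restrictL2 T d u = 0) :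
    IsTrace j u 0 := by
  intro k
  have h0 : fourierG (0 : L2G T d) k = 0 := by
    simpa using fourierG_smul (0 : ℂ) (0 : L2G T d) k
  rw [h0]
  filter_upwards [Lp.coeFn_zero ℂ 2 (volume : Measure (EuclideanSpace ℝ (Fin d))),
    ae_trace_eq_zero (ae_timeCoeff_eq_zero hu' k) j (ae_integrable_trace hr hj hs hu k)] with x h1 h2
  rw [h1]
  exact h2.symm

end restrict

/-! ### The extension operator -/

/-- This is the Gram matrix of the monomials on `[-1, 1]`. A vector in its kernel is the coefficient
vector of a polynomial `p` with `∫ p² = 0`; then `p` vanishes on an interval, so it is zero. -/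
theorem moment_mulVec_injective (N : ℕ) : Function.Injective
    (Matrix.mulVecLin (Matrix.of fun l i : Fin N => ∫ s in (-1 : ℝ)..1, s ^ (l : ℕ) * s ^ (i : ℕ))) := by
  rw [← LinearMap.ker_eq_bot, LinearMap.ker_eq_bot']
  intro c hc
  set p : Polynomial ℝ := ∑ i : Fin N, Polynomial.C (c i) * Polynomial.X ^ (i : ℕ) with hp
  have hev : ∀ s, p.eval s = ∑ i : Fin N, c i * s ^ (i : ℕ) := fun s => by
    simp [hp, Polynomial.eval_finsetSum]
  have hint : ∫ s in (-1 : ℝ)..1, p.eval s ^ 2 = 0 := by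
    have h1 : ∀ l : Fin N, ∑ i : Fin N, (∫ s in (-1 : ℝ)..1, s ^ (l : ℕ) * s ^ (i : ℕ)) * c i = 0 :=
      fun l => congrFun hc l
    have h2 : ∀ s : ℝ, p.eval s ^ 2 =
        ∑ l : Fin N, c l * ∑ i : Fin N, s ^ (l : ℕ) * s ^ (i : ℕ) * c i := by
      intro s
      rw [hev, sq, Finset.sum_mul]
      refine Finset.sum_congr rfl fun l _ => ?_
      rw [mul_assoc, Finset.mul_sum]
      congr 1
      refine Finset.sum_congr rfl fun i _ => by ring
    simp only [h2]
    rw [intervalIntegral.integral_finsetSum fun l _ =>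
      Continuous.intervalIntegrable (by fun_prop) _ _]
    refine Finset.sum_eq_zero fun l _ => ?_
    rw [intervalIntegral.integral_const_mul, intervalIntegral.integral_finsetSum fun l _ =>
      Continuous.intervalIntegrable (by fun_prop) _ _]
    simp only [intervalIntegral.integral_mul_const, h1 l, mul_zero]
  have hzero : ∀ s ∈ Icc (-1 : ℝ) 1, p.eval s = 0 := by
    intro s hs
    by_contra hne
    have h := intervalIntegral.integral_pos (f := fun s => p.eval s ^ 2) (a := -1) (b := 1)
      (by norm_num) (by fun_prop) (fun x _ => sq_nonneg _) ⟨s, hs, by positivity⟩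
    exact h.ne' hint
  have hp0 : p = 0 := Polynomial.eq_zero_of_infinite_isRoot p
    ((Icc_infinite (by norm_num : (-1 : ℝ) < 1)).mono hzero)
  funext i
  have h := congrArg (fun q => Polynomial.coeff q (i : ℕ)) hp0
  simpa [hp, Polynomial.finsetSum_coeff, Polynomial.coeff_C_mul, Polynomial.coeff_X_pow,
    Fin.val_inj] using h

/-- Bounded functions supported in `[-1, 1]` with prescribed moments of order less than `N`. -/
theorem exists_dual_moments (N : ℕ) (j : Fin N) : ∃ η : ℝ → ℝ, Measurable η ∧
    (∃ C, 0 ≤ C ∧ ∀ s, |η s| ≤ C) ∧ (∀ s, 1 < |s| → η s = 0) ∧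
    ∀ l : Fin N, ∫ s, s ^ (l : ℕ) * η s = if l = j then 1 else 0 := by
  -- The Gram matrix is square, hence onto; `c` holds the coefficients of the polynomial that is
  -- dual to the `j`-th monomial.
  obtain ⟨c, hc⟩ := LinearMap.injective_iff_surjective.1 (moment_mulVec_injective N)
    (Pi.single j 1)
  have hcont : Continuous fun s : ℝ => ∑ i : Fin N, s ^ (i : ℕ) * c i := by fun_prop
  refine ⟨(Icc (-1) 1).indicator fun s => ∑ i : Fin N, s ^ (i : ℕ) * c i,
    hcont.measurable.indicator measurableSet_Icc, ?_, fun s hs => ?_, fun l => ?_⟩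
  · obtain ⟨C, hC⟩ := isCompact_Icc.exists_bound_of_continuousOn (s := Icc (-1 : ℝ) 1)
      hcont.continuousOn
    refine ⟨max C 0, le_max_right _ _, fun s => ?_⟩
    by_cases h : s ∈ Icc (-1 : ℝ) 1
    · rw [indicator_of_mem h]
      exact (hC s h).trans (le_max_left _ _)
    · rw [indicator_of_notMem h, abs_zero]
      exact le_max_right _ _
  · rw [indicator_of_notMem]
    exact fun h => hs.not_ge (abs_le.2 h)
  · have h1 : (∑ i : Fin N, (∫ s in (-1 : ℝ)..1, s ^ (l : ℕ) * s ^ (i : ℕ)) * c i) =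
        Pi.single (M := fun _ => ℝ) j 1 l := congrFun hc l
    have h3 : (if l = j then (1 : ℝ) else 0) = Pi.single (M := fun _ => ℝ) j 1 l :=
      (Pi.single_apply _ _ _).symm
    rw [h3, ← h1]
    have h2 : (fun s => s ^ (l : ℕ) * (Icc (-1 : ℝ) 1).indicator
        (fun s => ∑ i : Fin N, s ^ (i : ℕ) * c i) s) =
        (Icc (-1 : ℝ) 1).indicator fun s => ∑ i : Fin N, s ^ (l : ℕ) * s ^ (i : ℕ) * c i := by
      funext s
      by_cases h : s ∈ Icc (-1 : ℝ) 1
      · rw [indicator_of_mem h, indicator_of_mem h, Finset.mul_sum]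
        simp only [mul_assoc]
      · rw [indicator_of_notMem h, indicator_of_notMem h, mul_zero]
    rw [h2, integral_indicator measurableSet_Icc, integral_Icc_eq_integral_Ioc,
      ← intervalIntegral.integral_of_le (by norm_num),
      intervalIntegral.integral_finsetSum fun l _ =>
        Continuous.intervalIntegrable (by fun_prop) _ _]
    simp only [intervalIntegral.integral_mul_const]

/-- The profile `η` of order `j`, rescaled to the squared length scale `L`. -/
noncomputable def extensionKernel (η : ℝ → ℝ) (j : ℕ) (L s : ℝ) : ℂ :=
  ((2 * Real.pi / √L * (√L)⁻¹ ^ j * η (2 * Real.pi / √L * s) : ℝ) : ℂ) * (-Complex.I) ^ j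

/-- After rescaling only the `l`-th moment of `η` remains. For `l = j` the powers of `√L` cancel and
`I^j * (-I)^j = 1`; for `l ≠ j` the moment is zero, and the prefactor is irrelevant. -/
theorem integral_pow_mul_extensionKernel {η : ℝ → ℝ} {j l : ℕ} {L a : ℝ} (hL : 0 < L)
    (ha : a = if l = j then 1 else 0) (hη : ∫ s, s ^ l * η s = a) :
    ∫ s : ℝ, (2 * Real.pi * Complex.I * s) ^ l * extensionKernel η j L s = a := by
  have hq : 0 < √L := Real.sqrt_pos.2 hL
  have hπ := Real.pi_pos
  have e : ∀ s : ℝ, (2 * Real.pi * Complex.I * s) ^ l * extensionKernel η j L s =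
      (((2 * Real.pi / √L * (√L)⁻¹ ^ j * √L ^ l) *
        ((2 * Real.pi / √L * s) ^ l * η (2 * Real.pi / √L * s)) : ℝ) : ℂ) *
        (Complex.I ^ l * (-Complex.I) ^ j) := by
    intro s
    have h1 : (2 * Real.pi * s : ℝ) = √L * (2 * Real.pi / √L * s) := by field_simp
    have h2 : (2 * Real.pi * Complex.I * s : ℂ) =
        ((√L * (2 * Real.pi / √L * s) : ℝ) : ℂ) * Complex.I := by
      rw [← h1]
      push_cast
      ring
    rw [extensionKernel, h2, mul_pow, ← Complex.ofReal_pow, mul_pow √L]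
    push_cast
    ring
  simp only [e]
  rw [integral_mul_const, integral_complex_ofReal, integral_const_mul,
    Measure.integral_comp_mul_left (fun x => x ^ l * η x), hη, abs_of_pos (by positivity),
    smul_eq_mul, ha]
  split_ifs with h
  · subst h
    have h3 : 2 * Real.pi / √L * (√L)⁻¹ ^ l * √L ^ l * ((2 * Real.pi / √L)⁻¹ * 1) = 1 := by
      rw [inv_pow]
      field_simp
    rw [h3, ← mul_pow]
    simp
  · simp

theorem enorm_sq_extensionKernel_le {η : ℝ → ℝ} {C : ℝ} (hC : ∀ s, |η s| ≤ C)
    (hη : ∀ s, 1 < |s| → η s = 0) (j : ℕ) {L : ℝ} (hL : 0 < L) (s : ℝ) :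
    ‖extensionKernel η j L s‖ ^ 2 ≤
      (Icc (-(√L / (2 * Real.pi))) (√L / (2 * Real.pi))).indicator
        (fun _ => 4 * Real.pi ^ 2 * C ^ 2 * (L ^ (j + 1))⁻¹) s := by
  have hq : 0 < √L := Real.sqrt_pos.2 hL
  have hπ := Real.pi_pos
  have hn : ‖extensionKernel η j L s‖ =
      2 * Real.pi / √L * (√L)⁻¹ ^ j * |η (2 * Real.pi / √L * s)| := by
    rw [extensionKernel, norm_mul, norm_pow, norm_neg, Complex.norm_I, one_pow, mul_one,
      Complex.norm_real, Real.norm_eq_abs, abs_mul, abs_of_pos (by positivity)]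
  rw [hn]
  by_cases h : s ∈ Icc (-(√L / (2 * Real.pi))) (√L / (2 * Real.pi))
  · rw [indicator_of_mem h]
    have hC0 := hC (2 * Real.pi / √L * s)
    calc (2 * Real.pi / √L * (√L)⁻¹ ^ j * |η (2 * Real.pi / √L * s)|) ^ 2
        ≤ (2 * Real.pi / √L * (√L)⁻¹ ^ j * C) ^ 2 := by gcongr
      _ = 4 * Real.pi ^ 2 * C ^ 2 * ((√L ^ 2) ^ (j + 1))⁻¹ := by
          rw [inv_pow]
          field_simp
          ring
      _ = _ := by rw [Real.sq_sqrt hL.le]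
  · rw [indicator_of_notMem h, hη, abs_zero, mul_zero]
    · norm_num
    · by_contra h'
      refine h (abs_le.1 ?_)
      rw [not_lt, abs_mul, abs_of_pos (by positivity)] at h'
      rw [le_div_iff₀ (by positivity)]
      rw [div_mul_eq_mul_div, div_le_one hq] at h'
      linarith

theorem traceScale_pos {r₂ j : ℕ} {Q X : ℝ} (hX : 0 < X) : 0 < traceScale r₂ j Q X := by
  unfold traceScale
  split_ifs
  · exact hX
  · exact lt_max_of_lt_left hX

/-- As `z ≤ L`, each of the `r₁` factors at `X + z` is at most twice its value at `X`, or at most `2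
* max X Q` when `L` is that maximum. The rest is a count of powers: `r₂ = (j + 1) + (r₂ - 1 - j)`,
respectively `r₁ = (j + 1) + (r₁ - 1 - j)`. -/
theorem chgSymbol_le_traceSymbol {r₁ r₂ j : ℕ} (hr : r₂ < r₁) (hj : j < r₁) {Q X z : ℝ}
    (hX : 0 < X) (hz : 0 ≤ z) (hz' : z ≤ traceScale r₂ j Q X) :
    chgSymbol r₁ r₂ Q (X + z) * √(traceScale r₂ j Q X) ≤
      2 ^ r₁ * traceScale r₂ j Q X ^ (j + 1) * traceSymbol r₁ r₂ j Q X := by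
  have hB : 0 < max X Q := lt_max_of_lt_left hX
  have hzB : z ≤ max X Q := by
    refine hz'.trans ?_
    unfold traceScale
    split_ifs
    · exact le_max_left _ _
    · exact le_rfl
  have hM : max (X + z) Q ≤ 2 * max X Q := by
    refine max_le ?_ ?_
    · have := le_max_left X Q
      linarith
    · have := le_max_right X Q
      linarith
  have hM0 : 0 ≤ max (X + z) Q := le_max_of_le_left (by linarith)
  unfold traceSymbol chgSymbol
  unfold traceScale at hz' ⊢
  split_ifs at hz' ⊢ with h
  · calc (X + z) ^ r₂ * max (X + z) Q ^ (r₁ - r₂) * √X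
        ≤ (2 * X) ^ r₂ * (2 * max X Q) ^ (r₁ - r₂) * √X := by
          gcongr
          linarith
      _ = (2 ^ r₂ * 2 ^ (r₁ - r₂)) * X ^ r₂ * (√X * max X Q ^ (r₁ - r₂)) := by
          rw [mul_pow, mul_pow]
          ring
      _ = 2 ^ r₁ * (X ^ (j + 1) * X ^ (r₂ - 1 - j)) * (√X * max X Q ^ (r₁ - r₂)) := by
          rw [← pow_add, ← pow_add]
          congr 3
          · omega
          · omega
      _ = _ := by ring
  · calc (X + z) ^ r₂ * max (X + z) Q ^ (r₁ - r₂) * √(max X Q)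
        ≤ (2 * max X Q) ^ r₂ * (2 * max X Q) ^ (r₁ - r₂) * √(max X Q) := by
          gcongr
          have := le_max_left X Q
          linarith
      _ = (2 ^ r₂ * 2 ^ (r₁ - r₂)) * (max X Q ^ r₂ * max X Q ^ (r₁ - r₂)) * √(max X Q) := by
          rw [mul_pow, mul_pow]
          ring
      _ = 2 ^ r₁ * (max X Q ^ (j + 1) * max X Q ^ (r₁ - 1 - j)) * √(max X Q) := by
          rw [← pow_add, ← pow_add, ← pow_add]
          congr 3
          · omega
          · omega
      _ = _ := by ring

/-- The powers `L^(j + 1)` from the symbol and from the squared kernel cancel, and the remaining `1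
/ √L` cancels against the length `√L / π` of the support. The constant collects 16 from the weight,
`2^r₁` from the symbol and `4π²C²` from the kernel, divided by `π`. -/
theorem lintegral_weight_extensionKernel_le {d r₁ r₂ j : ℕ} (hr : r₂ < r₁) (hj : j < r₁) {s₂ : ℝ}
    (hs : 0 ≤ s₂) {η : ℝ → ℝ} {C : ℝ} (hC : ∀ s, |η s| ≤ C) (hη : ∀ s, 1 < |s| → η s = 0)
    (τ : ℝ) (x : EuclideanSpace ℝ (Fin d)) :
    ∫⁻ s : ℝ, (ENNReal.ofReal (weight (chgOrder r₁ r₂ s₂) τ (2 * Real.pi * ‖joinLast x s‖)) *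
      ‖extensionKernel η j (traceScale r₂ j ((1 + τ ^ 2) ^ (s₂ / ((r₁ : ℝ) - r₂)))
        (1 + (2 * Real.pi * ‖x‖) ^ 2)) s‖ₑ) ^ (2 : ℝ) ≤
    ENNReal.ofReal (2 ^ (r₁ + 6) * Real.pi * C ^ 2) *
      ENNReal.ofReal (weight (traceOrder r₁ r₂ s₂ j) τ (2 * Real.pi * ‖x‖)) ^ (2 : ℝ) := by
  have hπ := Real.pi_pos
  have h1 := (traceOrder_bounds hr hs hj τ (2 * Real.pi * ‖x‖)).2.1
  have hX : 0 < 1 + (2 * Real.pi * ‖x‖) ^ 2 := by positivity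
  have h2 := fun s => weight_sq_le_chgSymbol hr hs τ (2 * Real.pi * ‖joinLast x s‖)
  simp only [one_add_norm_joinLast_sq] at h2
  set Q := (1 + τ ^ 2) ^ (s₂ / ((r₁ : ℝ) - r₂))
  set X := 1 + (2 * Real.pi * ‖x‖) ^ 2
  have hL : 0 < traceScale r₂ j Q X := traceScale_pos hX
  have h3 := fun {z} => chgSymbol_le_traceSymbol (z := z) (Q := Q) hr hj hX
  set L := traceScale r₂ j Q X
  set S := traceSymbol r₁ r₂ j Q X
  set w := weight (traceOrder r₁ r₂ s₂ j) τ (2 * Real.pi * ‖x‖) with hw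
  have hq : 0 < √L := Real.sqrt_pos.2 hL
  have hS : 0 ≤ S := by
    have hB : 0 < max X Q := lt_max_of_lt_left hX
    simp only [S, traceSymbol]
    split_ifs <;> positivity
  have hC0 : 0 ≤ C := (abs_nonneg _).trans (hC 0)
  have hle : ∀ s : ℝ, (ENNReal.ofReal (weight (chgOrder r₁ r₂ s₂) τ
      (2 * Real.pi * ‖joinLast x s‖)) * ‖extensionKernel η j L s‖ₑ) ^ (2 : ℝ) ≤
      (Icc (-(√L / (2 * Real.pi))) (√L / (2 * Real.pi))).indicator
        (fun _ => ENNReal.ofReal (2 ^ (r₁ + 6) * Real.pi ^ 2 * C ^ 2 * S * (√L)⁻¹)) s := by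
    intro s
    have hK := enorm_sq_extensionKernel_le hC hη j hL s
    have hw0 := weight_nonneg (chgOrder r₁ r₂ s₂) τ (2 * Real.pi * ‖joinLast x s‖)
    rw [← ofReal_norm, ← ENNReal.ofReal_mul hw0, ENNReal.ofReal_rpow_of_nonneg (by positivity)
      (by norm_num), Real.rpow_two, mul_pow]
    by_cases h : s ∈ Icc (-(√L / (2 * Real.pi))) (√L / (2 * Real.pi))
    · rw [indicator_of_mem h] at hK ⊢
      refine ENNReal.ofReal_le_ofReal ?_
      have hz : (2 * Real.pi * s) ^ 2 ≤ L := by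
        rw [← Real.sq_sqrt hL.le, sq_le_sq, abs_of_pos hq, abs_mul, abs_of_pos (by positivity)]
        have := abs_le.2 h
        rw [le_div_iff₀ (by positivity)] at this
        linarith
      have h4 := h3 (sq_nonneg _) hz
      rw [← le_div_iff₀ hq] at h4
      have h5 : weight (chgOrder r₁ r₂ s₂) τ (2 * Real.pi * ‖joinLast x s‖) ^ 2 ≤
          16 * (2 ^ r₁ * L ^ (j + 1) * S / √L) := (h2 s).trans (by gcongr)
      refine (mul_le_mul h5 hK (by positivity) (by positivity)).trans_eq ?_
      have : L ^ (j + 1) ≠ 0 := by positivity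
      field_simp
      ring
    · rw [indicator_of_notMem h] at hK ⊢
      rw [le_antisymm hK (by positivity), mul_zero, ENNReal.ofReal_zero]
  refine (lintegral_mono hle).trans ?_
  rw [lintegral_indicator_const measurableSet_Icc, Real.volume_Icc,
    ← ENNReal.ofReal_mul (by positivity)]
  have hw0 : 0 ≤ w := weight_nonneg _ _ _
  rw [ENNReal.ofReal_rpow_of_nonneg hw0 (by norm_num), Real.rpow_two,
    ← ENNReal.ofReal_mul (by positivity)]
  refine ENNReal.ofReal_le_ofReal ?_
  calc 2 ^ (r₁ + 6) * Real.pi ^ 2 * C ^ 2 * S * (√L)⁻¹ *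
        (√L / (2 * Real.pi) - -(√L / (2 * Real.pi)))
      = 2 ^ (r₁ + 6) * Real.pi * C ^ 2 * S := by
        field_simp
        ring
    _ ≤ 2 ^ (r₁ + 6) * Real.pi * C ^ 2 * w ^ 2 := by gcongr

/-! ### Extension of a single datum. -/

section extension

variable {T : ℝ} {d r₁ r₂ j : ℕ} {s₂ : ℝ} {η : ℝ → ℝ}

/-- The kernel of the extension operator for the datum of order `j`. -/
noncomputable def extKernel (η : ℝ → ℝ) (T : ℝ) (r₁ r₂ : ℕ) (s₂ : ℝ) (j : ℕ) (k : ℤ)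
    (x : EuclideanSpace ℝ (Fin d)) (s : ℝ) : ℂ :=
  extensionKernel η j (traceScale r₂ j ((1 + (2 * Real.pi * k / T) ^ 2) ^ (s₂ / ((r₁ : ℝ) - r₂)))
    (1 + (2 * Real.pi * ‖x‖) ^ 2)) s

theorem measurable_extKernel (hη : Measurable η) (k : ℤ) :
    Measurable fun p : EuclideanSpace ℝ (Fin d) × ℝ => extKernel η T r₁ r₂ s₂ j k p.1 p.2 := by
  unfold extKernel extensionKernel traceScale
  split_ifs <;> fun_prop

variable [hT : Fact (0 < T)]

variable (d) in
theorem measurePreserving_joinLastEquiv :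
    MeasurePreserving (joinLastEquiv d) (volume.prod volume) volume := by
  have e : (fun p : EuclideanSpace ℝ (Fin d) × ℝ => joinLast p.1 p.2) = joinLastEquiv d :=
    funext fun p => (joinLastEquiv_apply p).symm
  exact e ▸ measurePreserving_joinLast d

theorem joinLastEquiv_symm_apply (ξ : EuclideanSpace ℝ (Fin (d + 1))) :
    (joinLastEquiv d).symm ξ = (initL d ξ, lastL d ξ) := by
  rw [MeasurableEquiv.symm_apply_eq, joinLastEquiv_apply]
  exact (joinLast_initL ξ).symm

theorem ae_initL {p : EuclideanSpace ℝ (Fin d) → Prop} (h : ∀ᵐ x, p x) :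
    ∀ᵐ ξ : EuclideanSpace ℝ (Fin (d + 1)), p (initL d ξ) := by
  have h1 : ∀ᵐ q ∂((volume : Measure (EuclideanSpace ℝ (Fin d))).prod (volume : Measure ℝ)),
      p q.1 := Measure.quasiMeasurePreserving_fst.ae h
  have h2 := (measurePreserving_joinLastEquiv d).symm.quasiMeasurePreserving.ae h1
  filter_upwards [h2] with ξ hξ
  rwa [joinLastEquiv_symm_apply] at hξ

/-- `u` is the extension of the datum `v` of order `j`, on the Fourier side. -/
def IsExtension (η : ℝ → ℝ) (r₁ r₂ : ℕ) (s₂ : ℝ) (j : ℕ) (v : L2G T d) (u : L2G T (d + 1)) :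
    Prop :=
  ∀ k : ℤ, fourierG u k =ᵐ[volume] fun ξ =>
    fourierG v k (initL d ξ) * extKernel η T r₁ r₂ s₂ j k (initL d ξ) (lastL d ξ)

theorem IsExtension.unique {v : L2G T d} {u u' : L2G T (d + 1)}
    (h : IsExtension η r₁ r₂ s₂ j v u) (h' : IsExtension η r₁ r₂ s₂ j v u') : u = u' :=
  eq_of_fourierG_eq fun k => Lp.ext ((h k).trans (h' k).symm)

theorem IsExtension.add {v v' : L2G T d} {u u' : L2G T (d + 1)}
    (h : IsExtension η r₁ r₂ s₂ j v u) (h' : IsExtension η r₁ r₂ s₂ j v' u') :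
    IsExtension η r₁ r₂ s₂ j (v + v') (u + u') := by
  intro k
  rw [fourierG_add, fourierG_add]
  filter_upwards [Lp.coeFn_add (fourierG u k) (fourierG u' k), h k, h' k,
    ae_initL (Lp.coeFn_add (fourierG v k) (fourierG v' k))] with ξ h1 h2 h3 h4
  rw [h1, h4, Pi.add_apply, Pi.add_apply, h2, h3, add_mul]

theorem IsExtension.smul (c : ℂ) {v : L2G T d} {u : L2G T (d + 1)}
    (h : IsExtension η r₁ r₂ s₂ j v u) : IsExtension η r₁ r₂ s₂ j (c • v) (c • u) := by
  intro k
  rw [fourierG_smul, fourierG_smul]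
  filter_upwards [Lp.coeFn_smul c (fourierG u k), h k,
    ae_initL (Lp.coeFn_smul c (fourierG v k))] with ξ h1 h2 h3
  rw [h1, h3, Pi.smul_apply, Pi.smul_apply, h2, smul_mul_assoc]

theorem IsExtension.mem_oscillatory {v : L2G T d} {u : L2G T (d + 1)}
    (h : IsExtension η r₁ r₂ s₂ j v u) (hv : v ∈ oscillatory T d) : u ∈ oscillatory T (d + 1) := by
  rw [mem_oscillatory_iff] at hv ⊢
  have h0 := Lp.coeFn_zero ℂ 2 (volume : Measure (EuclideanSpace ℝ (Fin d)))
  rw [← hv] at h0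
  refine Lp.ext ?_
  filter_upwards [h 0, ae_initL h0,
    Lp.coeFn_zero ℂ 2 (volume : Measure (EuclideanSpace ℝ (Fin (d + 1))))] with ξ h1 h2 h3
  rw [h1, h2, h3, Pi.zero_apply, zero_mul, Pi.zero_apply]

/-- The transform of the datum does not depend on `s` and leaves the integral; what is left is a
moment of the kernel. -/
theorem IsExtension.isTrace {l : ℕ} (hη : ∫ s, s ^ l * η s = if l = j then 1 else 0)
    {v : L2G T d} {u : L2G T (d + 1)} (h : IsExtension η r₁ r₂ s₂ j v u) :
    IsTrace l u (if l = j then v else 0) := by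
  intro k
  have h0 : fourierG (0 : L2G T d) k = 0 := by
    simpa using fourierG_smul (0 : ℂ) (0 : L2G T d) k
  filter_upwards [ae_joinLast (h k),
    Lp.coeFn_zero ℂ 2 (volume : Measure (EuclideanSpace ℝ (Fin d)))] with x hx hx0
  have e : ∫ s : ℝ, (2 * Real.pi * Complex.I * s) ^ l * fourierG u k (joinLast x s) =
      fourierG v k x * ((if l = j then 1 else 0 : ℝ) : ℂ) := by
    rw [← integral_pow_mul_extensionKernel (η := η) (j := j) (l := l)
      (L := traceScale r₂ j ((1 + (2 * Real.pi * k / T) ^ 2) ^ (s₂ / ((r₁ : ℝ) - r₂)))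
        (1 + (2 * Real.pi * ‖x‖) ^ 2)) (traceScale_pos (by positivity)) rfl hη,
      ← integral_const_mul]
    refine integral_congr_ae ?_
    filter_upwards [hx] with s hs
    rw [hs, initL_joinLast, lastL_apply, joinLast_last, extKernel, mul_left_comm]
  rw [e]
  split_ifs
  · simp
  · rw [h0, hx0]
    simp

theorem exists_isExtension (hr : r₂ < r₁) (hj : j < r₁) (hs : 0 ≤ s₂) (hηm : Measurable η)
    {C : ℝ} (hC : ∀ s, |η s| ≤ C) (hη : ∀ s, 1 < |s| → η s = 0) {v : L2G T d}
    (hv : polyNorm (traceOrder r₁ r₂ s₂ j) v < ⊤) :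
    ∃ u : L2G T (d + 1), IsExtension η r₁ r₂ s₂ j v u ∧
      polyNorm (chgOrder r₁ r₂ s₂) u ≤
        ENNReal.ofReal (2 ^ (r₁ + 6) * Real.pi * C ^ 2) ^ (1 / 2 : ℝ) *
          polyNorm (traceOrder r₁ r₂ s₂ j) v := by
  set h : ℤ → EuclideanSpace ℝ (Fin (d + 1)) → ℂ := fun k ξ =>
    fourierG v k (initL d ξ) * extKernel η T r₁ r₂ s₂ j k (initL d ξ) (lastL d ξ) with hh
  have hmeas : ∀ k, AEStronglyMeasurable (h k) volume := fun k => by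
    have h1 : AEStronglyMeasurable (fun p : EuclideanSpace ℝ (Fin d) × ℝ =>
        fourierG v k p.1 * extKernel η T r₁ r₂ s₂ j k p.1 p.2) (volume.prod volume) :=
      (Lp.aestronglyMeasurable (fourierG v k)).comp_fst.mul
        (measurable_extKernel hηm k).aestronglyMeasurable
    have h2 := h1.comp_measurePreserving (measurePreserving_joinLastEquiv d).symm
    simpa only [Function.comp_def, joinLastEquiv_symm_apply] using h2
  set c := ENNReal.ofReal (2 ^ (r₁ + 6) * Real.pi * C ^ 2) with hc
  have hbound : ∀ k : ℤ, ∫⁻ ξ, (ENNReal.ofReal (weight (chgOrder r₁ r₂ s₂)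
      (2 * Real.pi * k / T) (2 * Real.pi * ‖ξ‖)) * ‖h k ξ‖ₑ) ^ (2 : ℝ) ≤
      c * ∫⁻ x : EuclideanSpace ℝ (Fin d), (ENNReal.ofReal (weight (traceOrder r₁ r₂ s₂ j)
        (2 * Real.pi * k / T) (2 * Real.pi * ‖x‖)) * ‖fourierG v k x‖ₑ) ^ (2 : ℝ) := by
    intro k
    rw [lintegral_joinLast, ← lintegral_const_mul' _ _ ENNReal.ofReal_ne_top]
    · refine lintegral_mono fun x => ?_
      have hk := lintegral_weight_extensionKernel_le hr hj hs hC hη (2 * Real.pi * k / T) x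
      simp only [hh, initL_joinLast, lastL_apply, joinLast_last, enorm_mul, extKernel,
        mul_left_comm (ENNReal.ofReal _), ENNReal.mul_rpow_of_nonneg _ _ zero_le_two]
      simp only [ENNReal.mul_rpow_of_nonneg _ _ zero_le_two] at hk
      rw [lintegral_const_mul' _ _ (ENNReal.rpow_ne_top_of_nonneg zero_le_two enorm_ne_top)]
      refine (mul_le_mul_right hk _).trans_eq ?_
      rw [mul_left_comm, mul_comm (_ ^ (2 : ℝ)), ← mul_assoc, ← mul_assoc, mul_comm (_ ^ (2 : ℝ))]
    · refine AEMeasurable.pow_const (AEMeasurable.mul (Measurable.aemeasurable ?_)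
        (hmeas k).enorm) _
      exact ((measurable_weight _ _).comp (measurable_norm.const_mul _)).ennreal_ofReal
  have hsum : ∑' k : ℤ, ∫⁻ ξ, (ENNReal.ofReal (weight (chgOrder r₁ r₂ s₂)
      (2 * Real.pi * k / T) (2 * Real.pi * ‖ξ‖)) * ‖h k ξ‖ₑ) ^ (2 : ℝ) ≤
      c * ∑' k : ℤ, ∫⁻ x : EuclideanSpace ℝ (Fin d), (ENNReal.ofReal (weight
        (traceOrder r₁ r₂ s₂ j) (2 * Real.pi * k / T) (2 * Real.pi * ‖x‖)) *
          ‖fourierG v k x‖ₑ) ^ (2 : ℝ) := by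
    rw [← ENNReal.tsum_mul_left]
    exact ENNReal.tsum_le_tsum hbound
  have hlt := hsum.trans_lt (ENNReal.mul_lt_top ENNReal.ofReal_lt_top
    ((polyNorm_lt_top_iff _ v).1 hv))
  have hone : ∀ k : ℤ, ∫⁻ ξ, ‖h k ξ‖ₑ ^ (2 : ℝ) ≤ ∫⁻ ξ, (ENNReal.ofReal
      (weight (chgOrder r₁ r₂ s₂) (2 * Real.pi * k / T) (2 * Real.pi * ‖ξ‖)) *
        ‖h k ξ‖ₑ) ^ (2 : ℝ) := by
    intro k
    refine lintegral_mono fun ξ => ENNReal.rpow_le_rpow ?_ (by norm_num)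
    have h1 := one_le_weight (chgOrder_eq (r₁ := r₁) (r₂ := r₂) hs) hs (by positivity)
      (by exact_mod_cast hr) (2 * Real.pi * k / T) (2 * Real.pi * ‖ξ‖)
    exact le_mul_of_one_le_left zero_le (ENNReal.one_le_ofReal.2 h1)
  have hmem : ∀ k, MemLp (h k) 2 volume := fun k => by
    refine ⟨hmeas k, ?_⟩
    rw [eLpNorm_lt_top_iff_lintegral_rpow_enorm_lt_top (by norm_num) (by norm_num)]
    exact (hone k).trans_lt ((ENNReal.le_tsum k).trans_lt hlt)
  obtain ⟨u, hu⟩ := exists_fourierG_eq (T := T) (fun k => (hmem k).toLp _) (by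
    refine lt_of_le_of_lt (ENNReal.tsum_le_tsum fun k => ?_) hlt
    refine le_trans (le_of_eq (lintegral_congr_ae ?_)) (hone k)
    filter_upwards [(hmem k).coeFn_toLp] with x hx
    rw [hx])
  have hu' : IsExtension η r₁ r₂ s₂ j v u := fun k => by
    rw [hu k]
    exact (hmem k).coeFn_toLp
  refine ⟨u, hu', ?_⟩
  have e : polyNorm (chgOrder r₁ r₂ s₂) u = (∑' k : ℤ, ∫⁻ ξ, (ENNReal.ofReal
      (weight (chgOrder r₁ r₂ s₂) (2 * Real.pi * k / T) (2 * Real.pi * ‖ξ‖)) *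
        ‖h k ξ‖ₑ) ^ (2 : ℝ)) ^ (1 / 2 : ℝ) := by
    unfold polyNorm
    congr 1
    refine tsum_congr fun k => lintegral_congr_ae ?_
    filter_upwards [hu' k] with x hx
    rw [hx]
  rw [e]
  refine (ENNReal.rpow_le_rpow hsum (by norm_num)).trans_eq ?_
  rw [ENNReal.mul_rpow_of_nonneg _ _ (by norm_num)]
  rfl

end extension

/-! ### Test functions -/

section test

variable {T : ℝ} {n : ℕ}

/-- Smooth functions on `𝕋 × ℝⁿ` with compact support. -/
structure IsTest (φ : TorusSpace T n → ℂ) : Prop where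
  smooth : ContDiff ℝ (⊤ : ℕ∞) fun p : ℝ × EuclideanSpace ℝ (Fin n) => φ ((p.1 : AddCircle T), p.2)
  compact : HasCompactSupport φ

variable (T n) in
-- Smoothness is only defined on the lift to `ℝ × ℝⁿ`; this is how continuity descends to `𝕋 × ℝⁿ`.
theorem isQuotientMap_lift : Topology.IsQuotientMap
    fun p : ℝ × EuclideanSpace ℝ (Fin n) => (((p.1 : AddCircle T), p.2) : TorusSpace T n) :=
  (QuotientAddGroup.isOpenQuotientMap_mk.prodMap IsOpenQuotientMap.id).isQuotientMap

theorem IsTest.continuous {φ : TorusSpace T n → ℂ} (hφ : IsTest φ) : Continuous φ :=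
  (isQuotientMap_lift T n).continuous_iff.2 hφ.smooth.continuous

/-- The derivative in the direction `v`. -/
noncomputable def dirDeriv (v : ℝ × EuclideanSpace ℝ (Fin n)) (φ : TorusSpace T n → ℂ)
    (p : TorusSpace T n) : ℂ :=
  deriv (fun h : ℝ => φ (p.1 + ((h * v.1 : ℝ) : AddCircle T), p.2 + h • v.2)) 0

theorem IsTest.dirDeriv_lift {φ : TorusSpace T n → ℂ} (hφ : IsTest φ)
    (v p : ℝ × EuclideanSpace ℝ (Fin n)) :
    dirDeriv v φ ((p.1 : AddCircle T), p.2) =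
      fderiv ℝ (fun q : ℝ × EuclideanSpace ℝ (Fin n) => φ ((q.1 : AddCircle T), q.2)) p v := by
  rw [← ((hφ.smooth.differentiable (by norm_num)) p).lineDeriv_eq_fderiv, lineDeriv, dirDeriv]
  simp [smul_eq_mul]

theorem isTest_zero : IsTest (fun _ : TorusSpace T n => (0 : ℂ)) :=
  ⟨contDiff_const, HasCompactSupport.zero⟩

theorem IsTest.add {φ ψ : TorusSpace T n → ℂ} (hφ : IsTest φ) (hψ : IsTest ψ) :
    IsTest fun p => φ p + ψ p :=
  ⟨hφ.smooth.add hψ.smooth, hφ.compact.add hψ.compact⟩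

theorem IsTest.neg {φ : TorusSpace T n → ℂ} (hφ : IsTest φ) : IsTest fun p => -φ p :=
  ⟨hφ.smooth.neg, hφ.compact.comp_left (g := fun z : ℂ => -z) neg_zero⟩

theorem IsTest.sum {ι : Type*} (s : Finset ι) {φ : ι → TorusSpace T n → ℂ}
    (hφ : ∀ i ∈ s, IsTest (φ i)) : IsTest fun p => ∑ i ∈ s, φ i p := by
  classical
  induction s using Finset.induction_on with
  | empty => simpa using isTest_zero
  | insert a s ha ih =>
    simp only [Finset.sum_insert ha]
    exact (hφ a (Finset.mem_insert_self _ _)).add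
      (ih fun i hi => hφ i (Finset.mem_insert_of_mem hi))

/-- For local operations such as derivatives: their value at `p` depends only on the germ of the
function at `p`. -/
theorem hasCompactSupport_of_eventually {F : Type*} [Zero F] {φ : TorusSpace T n → ℂ}
    (hφ : HasCompactSupport φ) {ψ : TorusSpace T n → F}
    (h : ∀ p, φ =ᶠ[nhds p] 0 → ψ p = 0) : HasCompactSupport ψ :=
  HasCompactSupport.intro hφ fun p hp => h p (notMem_tsupport_iff_eventuallyEq.1 hp)

theorem IsTest.dirDeriv {φ : TorusSpace T n → ℂ} (hφ : IsTest φ)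
    (v : ℝ × EuclideanSpace ℝ (Fin n)) : IsTest (dirDeriv v φ) := by
  refine ⟨?_, hasCompactSupport_of_eventually hφ.compact fun p hp => ?_⟩
  · simp only [hφ.dirDeriv_lift v]
    exact (hφ.smooth.fderiv_right (m := (⊤ : ℕ∞)) (by norm_num)).clm_apply contDiff_const
  · have hc : Continuous fun h : ℝ =>
        ((p.1 + ((h * v.1 : ℝ) : AddCircle T), p.2 + h • v.2) : TorusSpace T n) := by
      refine Continuous.prodMk (continuous_const.add ?_) (by fun_prop)
      exact (AddCircle.continuous_mk' T).comp (by fun_prop)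
    have h0 : Filter.Tendsto (fun h : ℝ =>
        ((p.1 + ((h * v.1 : ℝ) : AddCircle T), p.2 + h • v.2) : TorusSpace T n)) (nhds 0)
        (nhds p) := by
      have h := hc.tendsto 0
      simpa using h
    have he := h0.eventually hp
    unfold NewtonTrace.dirDeriv
    refine (Filter.EventuallyEq.deriv_eq (f := fun _ => (0 : ℂ)) ?_).trans (deriv_const _ _)
    filter_upwards [he] with h hh using hh

/-- The derivative in the space variables. -/
noncomputable def spaceDeriv (φ : TorusSpace T n → ℂ) (p : TorusSpace T n) :
    EuclideanSpace ℝ (Fin n) →L[ℝ] ℂ := fderiv ℝ (fun x => φ (p.1, x)) p.2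

theorem IsTest.hasFDerivAt_lift {φ : TorusSpace T n → ℂ} (hφ : IsTest φ)
    (p : ℝ × EuclideanSpace ℝ (Fin n)) :
    HasFDerivAt (fun x => φ ((p.1 : AddCircle T), x)) ((fderiv ℝ
      (fun q : ℝ × EuclideanSpace ℝ (Fin n) => φ ((q.1 : AddCircle T), q.2)) p).comp
        (ContinuousLinearMap.inr ℝ ℝ _)) p.2 := by
  have h1 := ((hφ.smooth.differentiable (by norm_num)) p).hasFDerivAt
  have h2 : HasFDerivAt (fun x : EuclideanSpace ℝ (Fin n) => (p.1, x))
      (ContinuousLinearMap.inr ℝ ℝ _) p.2 := hasFDerivAt_prodMk_right _ _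
  exact HasFDerivAt.comp (x := p.2) (f := fun x => (p.1, x)) (g := fun q : ℝ × EuclideanSpace ℝ (Fin n) => φ ((q.1 : AddCircle T), q.2)) h1 h2

theorem IsTest.hasFDerivAt {φ : TorusSpace T n → ℂ} (hφ : IsTest φ) (p : TorusSpace T n) :
    HasFDerivAt (fun x => φ (p.1, x)) (spaceDeriv φ p) p.2 := by
  obtain ⟨q, rfl⟩ := (isQuotientMap_lift T n).surjective p
  exact (hφ.hasFDerivAt_lift q).differentiableAt.hasFDerivAt

theorem IsTest.spaceDeriv_lift {φ : TorusSpace T n → ℂ} (hφ : IsTest φ)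
    (p : ℝ × EuclideanSpace ℝ (Fin n)) :
    spaceDeriv φ ((p.1 : AddCircle T), p.2) = (fderiv ℝ
      (fun q : ℝ × EuclideanSpace ℝ (Fin n) => φ ((q.1 : AddCircle T), q.2)) p).comp
        (ContinuousLinearMap.inr ℝ ℝ _) := (hφ.hasFDerivAt_lift p).fderiv

theorem IsTest.spaceDeriv_apply {φ : TorusSpace T n → ℂ} (hφ : IsTest φ) (p : TorusSpace T n)
    (v : EuclideanSpace ℝ (Fin n)) : spaceDeriv φ p v = NewtonTrace.dirDeriv (0, v) φ p := by
  obtain ⟨q, rfl⟩ := (isQuotientMap_lift T n).surjective p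
  simp only
  rw [hφ.spaceDeriv_lift, hφ.dirDeriv_lift]
  rfl

theorem IsTest.continuous_spaceDeriv {φ : TorusSpace T n → ℂ} (hφ : IsTest φ) :
    Continuous (spaceDeriv φ) := by
  refine (isQuotientMap_lift T n).continuous_iff.2 ?_
  have e : (spaceDeriv φ ∘ fun p : ℝ × EuclideanSpace ℝ (Fin n) => ((p.1 : AddCircle T), p.2)) =
      fun p => (fderiv ℝ
        (fun q : ℝ × EuclideanSpace ℝ (Fin n) => φ ((q.1 : AddCircle T), q.2)) p).comp
          (ContinuousLinearMap.inr ℝ ℝ _) := funext fun p => hφ.spaceDeriv_lift p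
  rw [e]
  exact (hφ.smooth.continuous_fderiv (by norm_num)).clm_comp continuous_const

theorem IsTest.exists_bound_spaceDeriv {φ : TorusSpace T n → ℂ} (hφ : IsTest φ) :
    ∃ C, ∀ p, ‖spaceDeriv φ p‖ ≤ C := by
  refine hφ.continuous_spaceDeriv.bounded_above_of_compact_support
    (hasCompactSupport_of_eventually hφ.compact fun p hp => ?_)
  have h0 : Filter.Tendsto (fun x : EuclideanSpace ℝ (Fin n) => ((p.1, x) : TorusSpace T n)) (nhds p.2) (nhds p) := by
    have hc : Continuous fun x : EuclideanSpace ℝ (Fin n) => ((p.1, x) : TorusSpace T n) := by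
      fun_prop
    exact hc.tendsto p.2
  have he : (fun x : EuclideanSpace ℝ (Fin n) => φ (p.1, x)) =ᶠ[nhds p.2] fun _ => (0 : ℂ) := by
    filter_upwards [h0.eventually hp] with x hx using hx
  rw [spaceDeriv, he.fderiv_eq]
  simp

variable [hT : Fact (0 < T)]

/-- The Fourier coefficients in time of a function on `𝕋 × ℝⁿ`. -/
noncomputable def timeFourier (φ : TorusSpace T n → ℂ) (k : ℤ) (x : EuclideanSpace ℝ (Fin n)) : ℂ :=
  fourierCoeff (fun t => φ (t, x)) k

theorem integrable_of_continuous {F : Type*} [NormedAddCommGroup F] {f : AddCircle T → F}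
    (hf : Continuous f) : Integrable f (AddCircle.haarAddCircle (T := T)) :=
  hf.integrable_of_hasCompactSupport (HasCompactSupport.of_compactSpace f)

/-- Differentiation under the integral; the space derivative is bounded by compact support, and a
constant majorant is integrable on the circle. -/
theorem IsTest.hasFDerivAt_timeFourier {φ : TorusSpace T n → ℂ} (hφ : IsTest φ) (k : ℤ)
    (x : EuclideanSpace ℝ (Fin n)) : HasFDerivAt (timeFourier φ k)
      (∫ t, fourier (-k) t • spaceDeriv φ (t, x) ∂(AddCircle.haarAddCircle (T := T))) x := by
  obtain ⟨C, hC⟩ := hφ.exists_bound_spaceDeriv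
  have hc : ∀ y : EuclideanSpace ℝ (Fin n), Continuous fun t : AddCircle T =>
      fourier (-k) t • φ (t, y) := fun y =>
    (fourier (-k)).continuous.smul (hφ.continuous.comp (Continuous.prodMk_left y))
  refine hasFDerivAt_integral_of_dominated_of_fderiv_le (s := univ) (bound := fun _ => C)
    (F := fun y t => fourier (-k) t • φ (t, y))
    (F' := fun y t => fourier (-k) t • spaceDeriv φ (t, y)) Filter.univ_mem
    (Filter.Eventually.of_forall fun y => (hc y).aestronglyMeasurable)
    (integrable_of_continuous (hc x)) ?_ ?_ (integrable_const C) ?_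
  · exact ((fourier (-k)).continuous.smul
      (hφ.continuous_spaceDeriv.comp (Continuous.prodMk_left x))).aestronglyMeasurable
  · refine Filter.Eventually.of_forall fun t y _ => ?_
    rw [norm_smul, fourier_apply, Circle.norm_coe, one_mul]
    exact hC _
  · refine Filter.Eventually.of_forall fun t y _ => ?_
    have h := hφ.hasFDerivAt (t, y)
    exact h.const_smul (fourier (-k) t : ℂ)

theorem IsTest.fderiv_timeFourier {φ : TorusSpace T n → ℂ} (hφ : IsTest φ) (k : ℤ)
    (x v : EuclideanSpace ℝ (Fin n)) :
    fderiv ℝ (timeFourier φ k) x v = timeFourier (NewtonTrace.dirDeriv (0, v) φ) k x := by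
  rw [(hφ.hasFDerivAt_timeFourier k x).fderiv, ContinuousLinearMap.integral_apply]
  · simp only [smul_apply, hφ.spaceDeriv_apply]
    rfl
  · exact integrable_of_continuous ((fourier (-k)).continuous.smul
      (hφ.continuous_spaceDeriv.comp (Continuous.prodMk_left x)))

/-- Directional derivatives of a time coefficient are time coefficients of derivatives, which are
again test functions. Hence the induction must be uniform in `φ`. -/
theorem IsTest.contDiff_timeFourier {φ : TorusSpace T n → ℂ} (hφ : IsTest φ) (k : ℤ) :
    ContDiff ℝ (⊤ : ℕ∞) (timeFourier φ k) := by
  refine contDiff_infty.2 fun m => ?_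
  induction m generalizing φ with
  | zero =>
    exact contDiff_zero.2 (continuous_iff_continuousAt.2 fun x =>
      (hφ.hasFDerivAt_timeFourier k x).continuousAt)
  | succ m ih =>
    rw [Nat.cast_add, Nat.cast_one, contDiff_succ_iff_fderiv_apply]
    refine ⟨fun x => (hφ.hasFDerivAt_timeFourier k x).differentiableAt, ?_, fun v => ?_⟩
    -- The analyticity clause in the criterion is void at a finite order of differentiability.
    · exact fun h => absurd h (by exact_mod_cast WithTop.natCast_ne_top m)
    · simp only [hφ.fderiv_timeFourier]
      exact ih (hφ.dirDeriv _)

theorem hasCompactSupport_timeFourier {φ : TorusSpace T n → ℂ} (hφ : HasCompactSupport φ) (k : ℤ) :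
    HasCompactSupport (timeFourier φ k) := by
  refine HasCompactSupport.intro (hφ.image continuous_snd) fun x hx => ?_
  have h0 : ∀ t, φ (t, x) = 0 := fun t =>
    image_eq_zero_of_notMem_tsupport fun h => hx ⟨_, h, rfl⟩
  simp [timeFourier, fourierCoeff, h0]

/-- The Fourier coefficients in time of a test function, as Schwartz functions. -/
noncomputable def timeSchwartz {φ : TorusSpace T n → ℂ} (hφ : IsTest φ) (k : ℤ) :
    SchwartzMap (EuclideanSpace ℝ (Fin n)) ℂ :=
  (hasCompactSupport_timeFourier hφ.compact k).toSchwartzMap (hφ.contDiff_timeFourier k)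

theorem coe_timeSchwartz {φ : TorusSpace T n → ℂ} (hφ : IsTest φ) (k : ℤ) :
    (timeSchwartz hφ k : EuclideanSpace ℝ (Fin n) → ℂ) = timeFourier φ k := rfl

theorem IsTest.memLp {φ : TorusSpace T n → ℂ} (hφ : IsTest φ) : MemLp φ 2 (torusMeasure T n) := by
  unfold torusMeasure
  exact hφ.continuous.memLp_of_hasCompactSupport hφ.compact

/-- A test function as an element of `L²(𝕋 × ℝⁿ)`. -/
noncomputable def testLp {φ : TorusSpace T n → ℂ} (hφ : IsTest φ) : L2G T n := hφ.memLp.toLp φ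

theorem coeFn_testLp {φ : TorusSpace T n → ℂ} (hφ : IsTest φ) :
    testLp hφ =ᵐ[torusMeasure T n] φ := hφ.memLp.coeFn_toLp

theorem timeCoeff_testLp {φ : TorusSpace T n → ℂ} (hφ : IsTest φ) (k : ℤ) :
    timeCoeff (testLp hφ) k = (timeSchwartz hφ k).toLp 2 := by
  refine Lp.ext ?_
  filter_upwards [coeFn_timeCoeff (testLp hφ) k, ae_slice (coeFn_testLp hφ),
    (timeSchwartz hφ k).coeFn_toLp 2 volume] with x h1 h2 h3
  rw [h1, h3, fourierCoeff_congr_ae h2]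
  rfl

theorem fourierG_testLp {φ : TorusSpace T n → ℂ} (hφ : IsTest φ) (k : ℤ) :
    fourierG (testLp hφ) k =ᵐ[volume] 𝓕 (timeFourier φ k) := by
  rw [fourierG, timeCoeff_testLp, SchwartzMap.toLp_fourier_eq]
  exact (𝓕 (timeSchwartz hφ k)).coeFn_toLp 2 volume

theorem IsTest.integrable_timeFourier {φ : TorusSpace T n → ℂ} (hφ : IsTest φ) (k : ℤ) :
    Integrable (timeFourier φ k) :=
  (hφ.contDiff_timeFourier k).continuous.integrable_of_hasCompactSupport
    (hasCompactSupport_timeFourier hφ.compact k)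

theorem IsTest.timeFourier_add {φ ψ : TorusSpace T n → ℂ} (hφ : IsTest φ) (hψ : IsTest ψ) (k : ℤ)
    (x : EuclideanSpace ℝ (Fin n)) :
    timeFourier (fun p => φ p + ψ p) k x = timeFourier φ k x + timeFourier ψ k x := by
  have h := fourierCoeff.add
    (integrable_of_continuous (hφ.continuous.comp (Continuous.prodMk_left x)))
    (integrable_of_continuous (hψ.continuous.comp (Continuous.prodMk_left x)))
  exact congrFun h k

theorem timeFourier_neg (φ : TorusSpace T n → ℂ) (k : ℤ) (x : EuclideanSpace ℝ (Fin n)) :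
    timeFourier (fun p => -φ p) k x = -timeFourier φ k x := by
  simp [timeFourier, fourierCoeff, integral_neg]

theorem IsTest.fourier_add {φ ψ : TorusSpace T n → ℂ} (hφ : IsTest φ) (hψ : IsTest ψ) (k : ℤ)
    (ξ : EuclideanSpace ℝ (Fin n)) : 𝓕 (timeFourier (fun p => φ p + ψ p) k) ξ =
      𝓕 (timeFourier φ k) ξ + 𝓕 (timeFourier ψ k) ξ := by
  have e : timeSchwartz (hφ.add hψ) k = timeSchwartz hφ k + timeSchwartz hψ k := by
    ext x
    exact hφ.timeFourier_add hψ k x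
  have h := congrArg 𝓕 e
  rw [FourierTransform.fourier_add] at h
  exact DFunLike.congr_fun h ξ

theorem IsTest.fourier_neg {φ : TorusSpace T n → ℂ} (k : ℤ)
    (ξ : EuclideanSpace ℝ (Fin n)) : 𝓕 (timeFourier (fun p => -φ p) k) ξ =
      -𝓕 (timeFourier φ k) ξ := by
  have e : timeFourier (fun p => -φ p) k = fun x => -timeFourier φ k x :=
    funext fun x => timeFourier_neg φ k x
  rw [e, Real.fourier_eq, Real.fourier_eq, ← integral_neg]
  simp only [smul_neg]

theorem IsTest.fourier_sum {ι : Type*} (s : Finset ι) {φ : ι → TorusSpace T n → ℂ}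
    (hφ : ∀ i ∈ s, IsTest (φ i)) (k : ℤ) (ξ : EuclideanSpace ℝ (Fin n)) :
    𝓕 (timeFourier (fun p => ∑ i ∈ s, φ i p) k) ξ = ∑ i ∈ s, 𝓕 (timeFourier (φ i) k) ξ := by
  classical
  induction s using Finset.induction_on with
  | empty =>
    have e : timeFourier (fun _ : TorusSpace T n => (0 : ℂ)) k = fun _ => 0 := by
      funext x
      simp [timeFourier, fourierCoeff]
    simp [e, Real.fourier_eq]
  | insert a s ha ih =>
    have h1 := hφ a (Finset.mem_insert_self _ _)
    have h2 : ∀ i ∈ s, IsTest (φ i) := fun i hi => hφ i (Finset.mem_insert_of_mem hi)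
    simp only [Finset.sum_insert ha]
    rw [h1.fourier_add (IsTest.sum s h2), ih h2]

theorem IsTest.fourier_dirDeriv_space {φ : TorusSpace T n → ℂ} (hφ : IsTest φ) (k : ℤ)
    (v ξ : EuclideanSpace ℝ (Fin n)) : 𝓕 (timeFourier (NewtonTrace.dirDeriv (0, v) φ) k) ξ =
      (2 * Real.pi * Complex.I * (inner ℝ ξ v : ℝ)) * 𝓕 (timeFourier φ k) ξ := by
  have hi := hφ.integrable_timeFourier k
  have hd := (hφ.contDiff_timeFourier k).differentiable (by norm_num)
  have hi' : Integrable (fderiv ℝ (timeFourier φ k)) :=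
    ((hφ.contDiff_timeFourier k).continuous_fderiv (by norm_num)).integrable_of_hasCompactSupport
      ((hasCompactSupport_timeFourier hφ.compact k).fderiv (𝕜 := ℝ))
  have e : timeFourier (NewtonTrace.dirDeriv (0, v) φ) k =
      fun x => fderiv ℝ (timeFourier φ k) x v := funext fun x => (hφ.fderiv_timeFourier k x v).symm
  rw [e, ← Real.fourier_continuousLinearMap_apply hi', Real.fourier_fderiv hi hd hi']
  simp only [VectorFourier.fourierSMulRight_apply, neg_apply,
    Complex.real_smul, smul_eq_mul]
  have h1 : innerSL ℝ ξ v = inner ℝ ξ v := rfl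
  simp [h1]
  ring

/-- The derivative of the product of the exponential and `φ` is integrated over one period; the
boundary terms cancel by periodicity. -/
theorem IsTest.timeFourier_dirDeriv_time {φ : TorusSpace T n → ℂ} (hφ : IsTest φ) (k : ℤ)
    (x : EuclideanSpace ℝ (Fin n)) : timeFourier (NewtonTrace.dirDeriv (1, 0) φ) k x =
      (2 * Real.pi * Complex.I * k / T) * timeFourier φ k x := by
  have hd : ∀ t : ℝ, HasDerivAt (fun t : ℝ => φ ((t : AddCircle T), x))
      (NewtonTrace.dirDeriv (1, 0) φ ((t : AddCircle T), x)) t := by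
    intro t
    rw [hφ.dirDeriv_lift _ (t, x)]
    have h1 := ((hφ.smooth.differentiable (by norm_num)) (t, x)).hasFDerivAt
    have h2 : HasDerivAt (fun t : ℝ => (t, x)) ((1 : ℝ), (0 : EuclideanSpace ℝ (Fin n))) t :=
      (hasDerivAt_id t).prodMk (hasDerivAt_const t x)
    exact h1.comp_hasDerivAt t h2
  have hd' : ∀ t : ℝ, HasDerivAt
      (fun t : ℝ => fourier (-k) (t : AddCircle T) * φ ((t : AddCircle T), x))
      (-2 * Real.pi * Complex.I * k / T * fourier (-k) (t : AddCircle T) * φ ((t : AddCircle T), x) +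
        fourier (-k) (t : AddCircle T) * NewtonTrace.dirDeriv (1, 0) φ ((t : AddCircle T), x)) t :=
    fun t => (hasDerivAt_fourier_neg T k t).mul (hd t)
  have hmk : Continuous fun t : ℝ => (t : AddCircle T) := AddCircle.continuous_mk' T
  have hc1 : Continuous fun t : ℝ => fourier (-k) (t : AddCircle T) :=
    (fourier (-k)).continuous.comp hmk
  have hc2 : Continuous fun t : ℝ => φ ((t : AddCircle T), x) :=
    hφ.continuous.comp (hmk.prodMk continuous_const)
  have hc3 : Continuous fun t : ℝ => NewtonTrace.dirDeriv (1, 0) φ ((t : AddCircle T), x) :=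
    (hφ.dirDeriv _).continuous.comp (hmk.prodMk continuous_const)
  have hI := intervalIntegral.integral_eq_sub_of_hasDerivAt (a := 0) (b := 0 + T)
    (fun t _ => hd' t) ((((continuous_const.mul hc1).mul hc2).add
      (hc1.mul hc3)).intervalIntegrable _ _)
  have hi1 : IntervalIntegrable (fun t : ℝ => -2 * Real.pi * Complex.I * k / T *
      fourier (-k) (t : AddCircle T) * φ ((t : AddCircle T), x)) volume 0 (0 + T) :=
    ((continuous_const.mul hc1).mul hc2).intervalIntegrable _ _
  have hi2 : IntervalIntegrable (fun t : ℝ => fourier (-k) (t : AddCircle T) *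
      NewtonTrace.dirDeriv (1, 0) φ ((t : AddCircle T), x)) volume 0 (0 + T) :=
    (hc1.mul hc3).intervalIntegrable _ _
  rw [intervalIntegral.integral_add hi1 hi2] at hI
  simp only [mul_assoc (_ / _ : ℂ), zero_add, AddCircle.coe_period, QuotientAddGroup.mk_zero,
    sub_self] at hI
  rw [intervalIntegral.integral_const_mul] at hI
  rw [timeFourier, timeFourier, fourierCoeff_eq_intervalIntegral _ k 0,
    fourierCoeff_eq_intervalIntegral _ k 0]
  simp only [smul_eq_mul, zero_add, Complex.real_smul]
  linear_combination (((1 / T : ℝ) : ℂ)) * hI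

theorem IsTest.fourier_dirDeriv_time {φ : TorusSpace T n → ℂ} (hφ : IsTest φ) (k : ℤ)
    (ξ : EuclideanSpace ℝ (Fin n)) : 𝓕 (timeFourier (NewtonTrace.dirDeriv (1, 0) φ) k) ξ =
      (2 * Real.pi * Complex.I * k / T) * 𝓕 (timeFourier φ k) ξ := by
  have e : timeFourier (NewtonTrace.dirDeriv (1, 0) φ) k =
      fun x => (2 * Real.pi * Complex.I * k / T) * timeFourier φ k x :=
    funext fun x => hφ.timeFourier_dirDeriv_time k x
  rw [e, Real.fourier_eq, Real.fourier_eq, ← integral_const_mul]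
  simp only [Circle.smul_def, smul_eq_mul, mul_left_comm]

/-- Rapid decay of the Fourier transform of a test function. -/
theorem IsTest.tsum_lintegral_lt_top {φ : TorusSpace T n → ℂ} (hφ : IsTest φ) (N M : ℕ) :
    ∑' k : ℤ, ∫⁻ ξ : EuclideanSpace ℝ (Fin n), (ENNReal.ofReal ((1 + (2 * Real.pi * k / T) ^ 2) ^ N *
      (1 + (2 * Real.pi * ‖ξ‖) ^ 2) ^ M) * ‖𝓕 (timeFourier φ k) ξ‖ₑ) ^ (2 : ℝ) < ⊤ := by
  induction N generalizing φ with
  | zero =>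
    induction M generalizing φ with
    | zero =>
      -- Without weights this is Plancherel's theorem.
      convert tsum_lintegral_fourierG_lt_top (testLp hφ) using 1
      refine tsum_congr fun k => lintegral_congr_ae ?_
      filter_upwards [fourierG_testLp hφ k] with ξ hξ
      simp [hξ]
    | succ M ih =>
      let e : Fin n → EuclideanSpace ℝ (Fin n) := fun i => EuclideanSpace.single i 1
      have h2 : ∀ i ∈ Finset.univ, IsTest (NewtonTrace.dirDeriv (0, e i)
          (NewtonTrace.dirDeriv (0, e i) φ)) := fun i _ => (hφ.dirDeriv _).dirDeriv _
      have h3 := IsTest.sum _ h2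
      -- Applying `1 - Δ` multiplies the transform by `1 + (2π|ξ|)²`, so one more power of the
      -- weight is the previous case for `φ - Δφ`.
      have h := ih (hφ.add h3.neg)
      convert h using 5 with k ξ
      have e1 : 𝓕 (timeFourier (fun p => φ p + -∑ i, NewtonTrace.dirDeriv (0, e i)
          (NewtonTrace.dirDeriv (0, e i) φ) p) k) ξ =
          ((1 + (2 * Real.pi * ‖ξ‖) ^ 2 : ℝ) : ℂ) * 𝓕 (timeFourier φ k) ξ := by
        rw [hφ.fourier_add h3.neg, IsTest.fourier_neg, IsTest.fourier_sum _ h2]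
        have e2 : ∀ i, 𝓕 (timeFourier (NewtonTrace.dirDeriv (0, e i)
            (NewtonTrace.dirDeriv (0, e i) φ)) k) ξ =
            -((2 * Real.pi * ξ i) ^ 2 : ℝ) * 𝓕 (timeFourier φ k) ξ := by
          intro i
          rw [(hφ.dirDeriv _).fourier_dirDeriv_space, hφ.fourier_dirDeriv_space]
          have e3 : inner ℝ ξ (e i) = ξ i := by simp [e, EuclideanSpace.inner_single_right]
          rw [e3]
          push_cast
          linear_combination (4 * Real.pi ^ 2 * (ξ i : ℂ) ^ 2 * 𝓕 (timeFourier φ k) ξ) * Complex.I_sq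
        simp only [e2]
        rw [← Finset.sum_mul, mul_pow, EuclideanSpace.norm_sq_eq]
        simp only [Real.norm_eq_abs, sq_abs, mul_pow, Finset.sum_neg_distrib]
        push_cast
        rw [← Finset.mul_sum]
        ring
      rw [e1, enorm_mul, ← mul_assoc, pow_succ _ M, ← mul_assoc, ENNReal.ofReal_mul (by positivity)]
      congr 2
      rw [← ofReal_norm, Complex.norm_real, Real.norm_of_nonneg (by positivity)]
  | succ N ih =>
    have h2 := (hφ.dirDeriv (1, 0)).dirDeriv (1, 0)
    -- The same device in time, with `1 - ∂_t²`.
    have h := ih (hφ.add h2.neg)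
    convert h using 5 with k ξ
    have e1 : 𝓕 (timeFourier (fun p => φ p + -NewtonTrace.dirDeriv (1, 0)
        (NewtonTrace.dirDeriv (1, 0) φ) p) k) ξ =
        ((1 + (2 * Real.pi * k / T) ^ 2 : ℝ) : ℂ) * 𝓕 (timeFourier φ k) ξ := by
      rw [hφ.fourier_add h2.neg, IsTest.fourier_neg, (hφ.dirDeriv _).fourier_dirDeriv_time,
        hφ.fourier_dirDeriv_time]
      push_cast
      linear_combination (-(4 * Real.pi ^ 2 * (k : ℂ) ^ 2 / T ^ 2 * 𝓕 (timeFourier φ k) ξ)) *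
        Complex.I_sq
    rw [e1, enorm_mul, ← mul_assoc, pow_succ _ N, mul_right_comm, ENNReal.ofReal_mul (by positivity)]
    congr 2
    rw [← ofReal_norm, Complex.norm_real, Real.norm_of_nonneg (by positivity)]

theorem exists_weight_chgOrder_le {r₁ r₂ : ℕ} (hr : r₂ < r₁) {s₂ : ℝ} (hs : 0 ≤ s₂) :
    ∃ N M : ℕ, ∀ τ ρ, weight (chgOrder r₁ r₂ s₂) τ ρ ≤ 4 * ((1 + τ ^ 2) ^ N * (1 + ρ ^ 2) ^ M) := by
  refine ⟨⌈s₂ / ((r₁ : ℝ) - r₂)⌉₊ * (r₁ - r₂), r₁, fun τ ρ => ?_⟩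
  set N := ⌈s₂ / ((r₁ : ℝ) - r₂)⌉₊
  have h := weight_sq_le_chgSymbol hr hs τ ρ
  have hτ : 1 ≤ 1 + τ ^ 2 := by nlinarith [sq_nonneg τ]
  have hρ : 1 ≤ 1 + ρ ^ 2 := by nlinarith [sq_nonneg ρ]
  have hQ : (1 + τ ^ 2) ^ (s₂ / ((r₁ : ℝ) - r₂)) ≤ (1 + τ ^ 2) ^ N := by
    rw [← Real.rpow_natCast _ N]
    exact Real.rpow_le_rpow_of_exponent_le hτ (Nat.le_ceil _)
  have hτN : 1 ≤ (1 + τ ^ 2) ^ N := one_le_pow₀ hτ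
  have hmax : max (1 + ρ ^ 2) ((1 + τ ^ 2) ^ (s₂ / ((r₁ : ℝ) - r₂))) ≤
      (1 + τ ^ 2) ^ N * (1 + ρ ^ 2) :=
    max_le (le_mul_of_one_le_left (by positivity) hτN)
      (hQ.trans (le_mul_of_one_le_right (by positivity) hρ))
  set B := (1 + τ ^ 2) ^ (N * (r₁ - r₂)) * (1 + ρ ^ 2) ^ r₁ with hB
  -- This allows `16 * B` to be replaced by `(4 * B)²` before taking square roots.
  have hB1 : 1 ≤ B := one_le_mul_of_one_le_of_one_le (one_le_pow₀ hτ) (one_le_pow₀ hρ)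
  have h2 : chgSymbol r₁ r₂ ((1 + τ ^ 2) ^ (s₂ / ((r₁ : ℝ) - r₂))) (1 + ρ ^ 2) ≤ B := by
    unfold chgSymbol
    calc _ ≤ (1 + ρ ^ 2) ^ r₂ * ((1 + τ ^ 2) ^ N * (1 + ρ ^ 2)) ^ (r₁ - r₂) := by gcongr
      _ = B := by
        rw [mul_pow, ← pow_mul, mul_left_comm, ← pow_add, Nat.add_sub_cancel' hr.le]
  refine le_of_sq_le_sq ?_ (by positivity)
  rw [mul_pow]
  nlinarith

theorem IsTest.polyNorm_lt_top {φ : TorusSpace T n → ℂ} (hφ : IsTest φ) {r₁ r₂ : ℕ}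
    (hr : r₂ < r₁) {s₂ : ℝ} (hs : 0 ≤ s₂) : polyNorm (chgOrder r₁ r₂ s₂) (testLp hφ) < ⊤ := by
  obtain ⟨N, M, h⟩ := exists_weight_chgOrder_le hr hs
  rw [polyNorm_lt_top_iff]
  refine lt_of_le_of_lt ?_ (ENNReal.mul_lt_top (by norm_num : (16 : ℝ≥0∞) < ⊤)
    (hφ.tsum_lintegral_lt_top N M))
  rw [← ENNReal.tsum_mul_left]
  refine ENNReal.tsum_le_tsum fun k => ?_
  rw [← lintegral_const_mul' _ _ (by norm_num)]
  refine lintegral_mono_ae ?_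
  filter_upwards [fourierG_testLp hφ k] with ξ hξ
  rw [hξ, show (16 : ℝ≥0∞) = 4 ^ (2 : ℝ) by norm_num, ← ENNReal.mul_rpow_of_nonneg _ _ zero_le_two,
    ← mul_assoc]
  refine ENNReal.rpow_le_rpow (mul_le_mul' ?_ le_rfl) zero_le_two
  refine (ENNReal.ofReal_le_ofReal (h _ _)).trans_eq ?_
  rw [ENNReal.ofReal_mul (by norm_num)]
  norm_num

theorem IsOscillatoryTest.isTest {φ : TorusSpace T n → ℂ} (hφ : IsOscillatoryTest φ) : IsTest φ :=
  ⟨hφ.smooth, hφ.compact⟩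

theorem IsOscillatoryTest.mem_oscillatory {φ : TorusSpace T n → ℂ} (hφ : IsOscillatoryTest φ) :
    testLp hφ.isTest ∈ oscillatory T n := by
  change timeCoeff (testLp hφ.isTest) 0 = 0
  rw [timeCoeff_testLp]
  have e : timeSchwartz hφ.isTest 0 = 0 := by
    ext x
    rw [coe_timeSchwartz]
    simpa [timeFourier, fourierCoeff] using hφ.mean_zero x
  rw [e]
  exact (SchwartzMap.toLpCLM ℂ ℂ 2 (volume : Measure (EuclideanSpace ℝ (Fin n)))).map_zero

end test

/-! ### The traces of test functions -/

/-! ### Restriction to a hyperplane and integration in the dual variable. -/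

section slice

variable {d : ℕ}

/-- Schwartz decay bounds `(1 + s²) |F|`, because `s²` is at most the squared norm of the joined
point. -/
theorem integrable_fourier_joinLast (F : SchwartzMap (EuclideanSpace ℝ (Fin (d + 1))) ℂ)
    (ξ : EuclideanSpace ℝ (Fin d)) : Integrable fun s : ℝ => F (joinLast ξ s) := by
  obtain ⟨C0, -, h0⟩ := F.decay 0 0
  obtain ⟨C2, -, h2⟩ := F.decay 2 0
  refine Integrable.mono' (integrable_inv_one_add_sq.const_mul (C0 + C2))
    (F.continuous.comp (continuous_joinLast_right ξ)).aestronglyMeasurable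
    (Filter.Eventually.of_forall fun s => ?_)
  have h1 := h0 (joinLast ξ s)
  have h3 := h2 (joinLast ξ s)
  rw [norm_iteratedFDeriv_zero, norm_joinLast_sq] at h3
  rw [norm_iteratedFDeriv_zero, pow_zero, one_mul] at h1
  rw [← div_eq_mul_inv, le_div_iff₀ (by positivity)]
  nlinarith [mul_nonneg (sq_nonneg ‖ξ‖) (norm_nonneg (F (joinLast ξ s)))]

/-- Let `p(s)` be the tangential transform of `f(·, s)` at `ξ`. By Fubini the transform of `p` is `𝓕
f (ξ, ·)`, so Fourier inversion at `s = 0` gives the claim. -/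
theorem fourier_slice {f : EuclideanSpace ℝ (Fin (d + 1)) → ℂ} (hf : ContDiff ℝ (⊤ : ℕ∞) f)
    (hc : HasCompactSupport f) (ξ : EuclideanSpace ℝ (Fin d)) :
    𝓕 (fun x : EuclideanSpace ℝ (Fin d) => f (joinLast x 0)) ξ =
      ∫ s : ℝ, 𝓕 f (joinLast ξ s) := by
  set g : EuclideanSpace ℝ (Fin d) → ℝ → ℂ := fun x s =>
    Real.fourierChar (-(inner ℝ x ξ)) • f (joinLast x s) with hg
  set p : ℝ → ℂ := fun s => ∫ x, g x s with hp
  have hgc : Continuous g.uncurry := by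
    have h1 : Continuous fun q : EuclideanSpace ℝ (Fin d) × ℝ => f (joinLast q.1 q.2) :=
      hf.continuous.comp (joinLastL d).continuous
    have h2 : Continuous fun q : EuclideanSpace ℝ (Fin d) × ℝ =>
        Real.fourierChar (-(inner ℝ q.1 ξ)) :=
      Real.continuous_fourierChar.comp (by fun_prop)
    exact h2.smul h1
  have hfi : Integrable f := hf.continuous.integrable_of_hasCompactSupport hc
  have hfj : Integrable (fun q : EuclideanSpace ℝ (Fin d) × ℝ => f (joinLast q.1 q.2))
      (volume.prod volume) := (measurePreserving_joinLast d).integrable_comp_of_integrable hfi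
  have hgi : Integrable g.uncurry (volume.prod volume) := by
    refine hfj.mono hgc.aestronglyMeasurable (Filter.Eventually.of_forall fun q => ?_)
    simp [hg, Function.uncurry, Circle.norm_smul]
  have hpi : Integrable p := hgi.integral_prod_right
  -- Inversion at a point needs continuity there; the tangential integrands are supported in one
  -- fixed compact set.
  have hpc : Continuous p := by
    have hK : IsCompact (initL d '' tsupport f) := hc.image (initL d).continuous
    rw [← continuousOn_univ]
    refine continuousOn_integral_of_compact_support hK (f := fun s x => g x s)
      (hgc.comp continuous_swap).continuousOn fun s x _ hx => ?_
    have h0 : f (joinLast x s) = 0 := image_eq_zero_of_notMem_tsupport fun h =>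
      hx ⟨_, h, initL_joinLast _ _⟩
    simp [hg, h0]
  have hFp : ∀ σ, 𝓕 p σ = 𝓕 f (joinLast ξ σ) := by
    intro σ
    rw [Real.fourier_eq, Real.fourier_eq, integral_joinLast]
    · rw [integral_integral_swap]
      · refine integral_congr_ae (Filter.Eventually.of_forall fun s => ?_)
        simp only [hp, hg]
        rw [Circle.smul_def, ← integral_smul]
        refine integral_congr_ae (Filter.Eventually.of_forall fun x => ?_)
        simp only [inner_joinLast, ← Circle.smul_def]
        rw [smul_smul, ← AddChar.map_add_eq_mul]
        congr 3
        simp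
        ring
      · refine hfj.mono ?_ (Filter.Eventually.of_forall fun q => ?_)
        · have h1 : Continuous fun q : EuclideanSpace ℝ (Fin d) × ℝ => f (joinLast q.1 q.2) :=
            hf.continuous.comp (joinLastL d).continuous
          have h3 : Continuous fun q : EuclideanSpace ℝ (Fin d) × ℝ => joinLast q.1 q.2 :=
            (joinLastL d).continuous
          have h2 : Continuous fun q : EuclideanSpace ℝ (Fin d) × ℝ =>
              Real.fourierChar (-(inner ℝ (joinLast q.1 q.2) (joinLast ξ σ))) :=
            Real.continuous_fourierChar.comp (by fun_prop)
          exact (h2.smul h1).aestronglyMeasurable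
        · simp [Function.uncurry, Circle.norm_smul]
    · exact (Real.fourierIntegral_convergent_iff _).2 hfi
  have hFi : Integrable (𝓕 p) := by
    have h := integrable_fourier_joinLast (𝓕 (hc.toSchwartzMap hf)) ξ
    refine h.congr (Filter.Eventually.of_forall fun s => ?_)
    exact (hFp s).symm
  have h := hpi.fourierInv_fourier_eq hFi (v := 0) hpc.continuousAt
  rw [Real.fourierInv_eq] at h
  simp only [hFp] at h
  rw [Real.fourier_eq]
  simpa [hp, hg] using h.symm

end slice

section testTrace

variable {T : ℝ} {d : ℕ}

/-- The restriction to the hyperplane `x_n = 0`. -/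
def hyperplaneTrace (ψ : TorusSpace T (d + 1) → ℂ) (p : TorusSpace T d) : ℂ :=
  ψ (p.1, joinLast p.2 0)

theorem IsTest.hyperplaneTrace {ψ : TorusSpace T (d + 1) → ℂ} (hψ : IsTest ψ) :
    IsTest (hyperplaneTrace ψ) := by
  constructor
  · have h : ContDiff ℝ (⊤ : ℕ∞) fun p : ℝ × EuclideanSpace ℝ (Fin d) =>
        (p.1, joinLastL d (p.2, 0)) := by fun_prop
    exact hψ.smooth.comp h
  · have hK : IsCompact ((fun p : TorusSpace T (d + 1) => (p.1, initL d p.2)) '' tsupport ψ) :=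
      hψ.compact.image (by fun_prop)
    refine HasCompactSupport.intro hK fun p hp => ?_
    refine image_eq_zero_of_notMem_tsupport (f := ψ) (x := (p.1, joinLast p.2 0))
      fun h => hp ⟨_, h, ?_⟩
    simp

theorem iteratedDeriv_joinLast (φ : TorusSpace T (d + 1) → ℂ) (j : ℕ) (t : AddCircle T)
    (x : EuclideanSpace ℝ (Fin d)) : iteratedDeriv j (fun s : ℝ => φ (t, joinLast x s)) =
      fun s => (dirDeriv (0, joinLast 0 1))^[j] φ (t, joinLast x s) := by
  induction j with
  | zero => simp
  | succ j ih =>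
    rw [iteratedDeriv_succ, ih, Function.iterate_succ_apply']
    funext s
    rw [dirDeriv]
    have e : ∀ h : ℝ, joinLast x s + h • joinLast 0 1 = joinLast x (s + h) := fun h => by
      have h1 := (joinLastL d).map_add (x, s) (h • (0, 1))
      rw [(joinLastL d).map_smul] at h1
      simpa [joinLastL_apply] using h1.symm
    simp only [e, mul_zero, AddCircle.coe_zero, add_zero]
    rw [deriv_comp_const_add (f := fun s => (dirDeriv (0, joinLast 0 1))^[j] φ (t, joinLast x s))]
    simp

theorem classicalTrace_eq (φ : TorusSpace T (d + 1) → ℂ) (j : ℕ) :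
    classicalTrace j φ = hyperplaneTrace ((dirDeriv (0, joinLast 0 1))^[j] φ) := by
  funext p
  rw [classicalTrace, iteratedDeriv_joinLast]
  rfl

theorem IsTest.iterate_dirDeriv {n : ℕ} {φ : TorusSpace T n → ℂ} (hφ : IsTest φ)
    (v : ℝ × EuclideanSpace ℝ (Fin n)) (j : ℕ) : IsTest ((NewtonTrace.dirDeriv v)^[j] φ) := by
  induction j with
  | zero => exact hφ
  | succ j ih =>
    rw [Function.iterate_succ_apply']
    exact ih.dirDeriv v

theorem IsTest.classicalTrace {φ : TorusSpace T (d + 1) → ℂ} (hφ : IsTest φ) (j : ℕ) :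
    IsTest (classicalTrace j φ) := by
  rw [classicalTrace_eq]
  exact (hφ.iterate_dirDeriv _ j).hyperplaneTrace

variable [hT : Fact (0 < T)]

theorem IsTest.fourier_iterate_dirDeriv {φ : TorusSpace T (d + 1) → ℂ} (hφ : IsTest φ) (j : ℕ)
    (k : ℤ) (x : EuclideanSpace ℝ (Fin d)) (s : ℝ) :
    𝓕 (timeFourier ((NewtonTrace.dirDeriv (0, joinLast 0 1))^[j] φ) k) (joinLast x s) =
      (2 * Real.pi * Complex.I * s) ^ j * 𝓕 (timeFourier φ k) (joinLast x s) := by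
  induction j with
  | zero => simp
  | succ j ih =>
    rw [Function.iterate_succ_apply', (hφ.iterate_dirDeriv _ j).fourier_dirDeriv_space, ih,
      inner_joinLast, inner_zero_right, zero_add, mul_one, pow_succ']
    ring

/-- The classical trace is the hyperplane restriction of an iterated normal derivative, whose
transform carries the factor `(2πis)^j`; the slice formula then gives the trace integral. -/
theorem IsTest.isTrace {φ : TorusSpace T (d + 1) → ℂ} (hφ : IsTest φ) (j : ℕ) :
    IsTrace j (testLp hφ) (testLp (hφ.classicalTrace j)) := by
  intro k
  filter_upwards [fourierG_testLp (hφ.classicalTrace j) k, ae_joinLast (fourierG_testLp hφ k)]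
    with x h1 h2
  have hψ := hφ.iterate_dirDeriv (0, joinLast 0 1) j
  have e : timeFourier (NewtonTrace.classicalTrace j φ) k = fun y =>
      timeFourier ((NewtonTrace.dirDeriv (0, joinLast 0 1))^[j] φ) k (joinLast y 0) := by
    rw [classicalTrace_eq]
    rfl
  rw [h1, e, fourier_slice (hψ.contDiff_timeFourier k) (hasCompactSupport_timeFourier hψ.compact k)]
  refine integral_congr_ae ?_
  filter_upwards [h2] with s hs
  rw [hs, hφ.fourier_iterate_dirDeriv]

end testTrace

/-! ### The trace operator and its right inverse -/

/-- A relation that is total, single-valued and compatible with the operations is the graph of a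
linear map. Both operators are only characterized through their transforms, so linearity is obtained
from the characterization. -/
theorem exists_linearMap_of_rel {R V W : Type*} [Semiring R] [AddCommMonoid V] [Module R V]
    [AddCommMonoid W] [Module R W] (r : V → W → Prop) (hex : ∀ x, ∃ y, r x y)
    (hun : ∀ x y z, r x y → r x z → y = z)
    (hadd : ∀ x x' y y', r x y → r x' y' → r (x + x') (y + y'))
    (hsmul : ∀ (c : R) x y, r x y → r (c • x) (c • y)) : ∃ f : V →ₗ[R] W, ∀ x, r x (f x) := by
  choose f hf using hex
  exact ⟨{ toFun := f
           map_add' := fun x y => hun _ _ _ (hf _) (hadd _ _ _ _ (hf x) (hf y))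
           map_smul' := fun c x => hun _ _ _ (hf _) (hsmul c _ _ (hf x)) }, hf⟩

/-! ### Subadditivity of the norms up to a constant. -/

section norm

variable {T : ℝ} [hT : Fact (0 < T)] {n : ℕ}

theorem polyNorm_zero (μ : ℝ → ℝ) : polyNorm μ (0 : L2G T n) = 0 := by
  have h0 : ∀ k : ℤ, fourierG (0 : L2G T n) k = 0 := fun k => by
    simpa using fourierG_smul (0 : ℂ) (0 : L2G T n) k
  have h1 : ∀ k : ℤ, ∫⁻ ξ : EuclideanSpace ℝ (Fin n),
      (ENNReal.ofReal (weight μ (2 * Real.pi * k / T) (2 * Real.pi * ‖ξ‖)) *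
        ‖fourierG (0 : L2G T n) k ξ‖ₑ) ^ (2 : ℝ) = 0 := fun k => by
    rw [← lintegral_zero (μ := (volume : Measure (EuclideanSpace ℝ (Fin n))))]
    refine lintegral_congr_ae ?_
    rw [h0]
    filter_upwards [Lp.coeFn_zero ℂ 2 (volume : Measure (EuclideanSpace ℝ (Fin n)))] with ξ hξ
    rw [hξ]
    simp
  rw [polyNorm, tsum_congr h1, tsum_zero, ENNReal.zero_rpow_of_pos (by norm_num)]

theorem polyNorm_add_le (μ : ℝ → ℝ) (f g : L2G T n) :
    polyNorm μ (f + g) ≤ 2 * (polyNorm μ f + polyNorm μ g) := by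
  unfold polyNorm
  have key : ∑' k : ℤ, ∫⁻ ξ : EuclideanSpace ℝ (Fin n),
      (ENNReal.ofReal (weight μ (2 * Real.pi * k / T) (2 * Real.pi * ‖ξ‖)) *
        ‖fourierG (f + g) k ξ‖ₑ) ^ (2 : ℝ) ≤
      2 ^ ((2 : ℝ) - 1) * (∑' k : ℤ, (∫⁻ ξ : EuclideanSpace ℝ (Fin n),
        (ENNReal.ofReal (weight μ (2 * Real.pi * k / T) (2 * Real.pi * ‖ξ‖)) *
          ‖fourierG f k ξ‖ₑ) ^ (2 : ℝ)) + ∑' k : ℤ, ∫⁻ ξ : EuclideanSpace ℝ (Fin n),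
        (ENNReal.ofReal (weight μ (2 * Real.pi * k / T) (2 * Real.pi * ‖ξ‖)) *
          ‖fourierG g k ξ‖ₑ) ^ (2 : ℝ)) := by
    rw [← ENNReal.tsum_add, ← ENNReal.tsum_mul_left]
    refine ENNReal.tsum_le_tsum fun k => ?_
    have hw : Measurable fun ξ : EuclideanSpace ℝ (Fin n) =>
        ENNReal.ofReal (weight μ (2 * Real.pi * k / T) (2 * Real.pi * ‖ξ‖)) :=
      (measurable_weight μ _).comp (measurable_norm.const_mul _) |>.ennreal_ofReal
    have hm := (hw.aemeasurable.mul (Lp.aestronglyMeasurable (fourierG f k)).enorm).pow_const (2 : ℝ)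
    simp only [Pi.mul_apply] at hm
    rw [← lintegral_add_left' hm, ← lintegral_const_mul' _ _
      (ENNReal.rpow_ne_top_of_nonneg (by norm_num) (by norm_num))]
    refine lintegral_mono_ae ?_
    rw [fourierG_add]
    filter_upwards [Lp.coeFn_add (fourierG f k) (fourierG g k)] with ξ hξ
    rw [hξ, Pi.add_apply]
    refine le_trans (ENNReal.rpow_le_rpow (mul_le_mul_right (enorm_add_le _ _) _) (by norm_num)) ?_
    rw [mul_add]
    exact ENNReal.rpow_add_le_mul_rpow_add_rpow _ _ (by norm_num)
  refine (ENNReal.rpow_le_rpow key (by norm_num)).trans ?_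
  rw [ENNReal.mul_rpow_of_nonneg _ _ (by norm_num), ← ENNReal.rpow_mul]
  refine mul_le_mul' ?_ (ENNReal.rpow_add_le_add_rpow _ _ (by norm_num) (by norm_num))
  -- The factor is `√2`; boundedness of finite sums needs no sharp constant, so it is rounded up to
  -- 2.
  calc (2 : ℝ≥0∞) ^ (((2 : ℝ) - 1) * (1 / 2)) ≤ 2 ^ (1 : ℝ) :=
        ENNReal.rpow_le_rpow_of_exponent_le (by norm_num) (by norm_num)
    _ = 2 := ENNReal.rpow_one 2

theorem polyNorm_sum_le {ι : Type*} (μ : ℝ → ℝ) (s : Finset ι) (f : ι → L2G T n) :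
    polyNorm μ (∑ i ∈ s, f i) ≤ 2 ^ s.card * ∑ i ∈ s, polyNorm μ (f i) := by
  classical
  induction s using Finset.induction_on with
  | empty => simp [polyNorm_zero]
  | insert a s ha ih =>
    rw [Finset.sum_insert ha, Finset.sum_insert ha, Finset.card_insert_of_notMem ha, pow_succ',
      mul_assoc]
    refine (polyNorm_add_le _ _ _).trans (mul_le_mul' le_rfl ?_)
    rw [mul_add]
    exact add_le_add (le_mul_of_one_le_left' (one_le_pow₀ (by norm_num))) ih

end norm

section operators

/-! ### Construction of the trace and extension operators. -/

variable {T : ℝ} [hT : Fact (0 < T)] {d r₁ r₂ : ℕ} {s₂ : ℝ}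

theorem IsTrace.sum {ι : Type*} (hr : r₂ < r₁) {j : ℕ} (hj : j < r₁) (hs : 0 ≤ s₂) (s : Finset ι)
    {u : ι → L2G T (d + 1)} {v : ι → L2G T d} (hu : ∀ i, u i ∈ HSpace T (d + 1) (chgOrder r₁ r₂ s₂))
    (h : ∀ i, IsTrace j (u i) (v i)) : IsTrace j (∑ i ∈ s, u i) (∑ i ∈ s, v i) := by
  classical
  induction s using Finset.induction_on with
  | empty =>
    simpa using isTrace_zero_of_restrict hr hj hs (polyNorm_zero_lt_top _)
      (map_zero (restrictL2 T d))
  | insert a s ha ih =>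
    rw [Finset.sum_insert ha, Finset.sum_insert ha]
    exact IsTrace.add hr hj hs (hu a) (Submodule.sum_mem _ fun i _ => hu i) (h a) ih

/-- Elements of `H^μ_⊥(G)` with the same restriction to the half space have the same traces. -/
theorem IsTrace.congr_restrict (hr : r₂ < r₁) {j : ℕ} (hj : j < r₁) (hs : 0 ≤ s₂)
    {F F' : HPerp T (d + 1) (chgOrder r₁ r₂ s₂)}
    (h : restrictPerp T d _ F = restrictPerp T d _ F') {v : L2G T d}
    (hv : IsTrace j (F' : L2G T (d + 1)) v) : IsTrace j (F : L2G T (d + 1)) v := by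
  have h0 : restrictL2 T d ((F - F' : HPerp T (d + 1) (chgOrder r₁ r₂ s₂)) : L2G T (d + 1)) = 0 := by
    have h1 : restrictL2 T d F = restrictL2 T d F' := congrArg Subtype.val h
    rw [Submodule.coe_sub, map_sub, h1, sub_self]
  have h2 := IsTrace.add hr hj hs F'.2.1 (F - F').2.1 hv
    (isTrace_zero_of_restrict hr hj hs (F - F').2.1 h0)
  rwa [← Submodule.coe_add, add_sub_cancel, add_zero] at h2

/-- The relation asks that `v` be the trace of every representative `F` of `f`. This builds in
independence of the representative, and totality reduces to the vanishing of traces of elements with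
zero restriction. -/
theorem exists_traceOperator (hr : r₂ < r₁) (hs : 0 ≤ s₂) :
    ∃ Tr : HBarPerp T d (chgOrder r₁ r₂ s₂) →ₗ[ℂ] TraceSpace T d r₁ r₂ s₂,
      ∀ (F : HPerp T (d + 1) (chgOrder r₁ r₂ s₂)) (j : Fin r₁),
        IsTrace j (F : L2G T (d + 1)) (Tr (restrictPerp T d _ F) j : L2G T d) := by
  have hsurj : Function.Surjective (restrictPerp T d (chgOrder r₁ r₂ s₂)) :=
    LinearMap.submoduleMap_surjective _ _
  suffices H : ∃ Tr : HBarPerp T d (chgOrder r₁ r₂ s₂) →ₗ[ℂ] TraceSpace T d r₁ r₂ s₂,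
      ∀ f, ∀ F : HPerp T (d + 1) (chgOrder r₁ r₂ s₂), restrictPerp T d _ F = f →
        ∀ j : Fin r₁, IsTrace j (F : L2G T (d + 1)) (Tr f j : L2G T d) from
    H.imp fun Tr hTr F j => hTr _ F rfl j
  refine exists_linearMap_of_rel
    (fun f (v : TraceSpace T d r₁ r₂ s₂) => ∀ F : HPerp T (d + 1) (chgOrder r₁ r₂ s₂),
      restrictPerp T d _ F = f →
        ∀ j : Fin r₁, IsTrace j (F : L2G T (d + 1)) (v j : L2G T d)) ?_ ?_ ?_ ?_
  · intro f
    obtain ⟨F, rfl⟩ := hsurj f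
    choose v hv hv' using fun j : Fin r₁ => exists_isTrace hr j.2 hs F.2.1
    refine ⟨fun j => ⟨v j, ?_, (hv j).mem_oscillatory F.2.2⟩, fun F' hF' j => ?_⟩
    · exact (hv' j).trans_lt (ENNReal.mul_lt_top (by norm_num) F.2.1)
    · exact IsTrace.congr_restrict hr j.2 hs hF' (hv j)
  · intro f v w hv hw
    obtain ⟨F, hF⟩ := hsurj f
    exact funext fun j => Subtype.ext ((hv F hF j).unique (hw F hF j))
  · intro f f' v v' hv hv' F hF j
    obtain ⟨F₁, h₁⟩ := hsurj f
    obtain ⟨F₂, h₂⟩ := hsurj f'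
    refine IsTrace.congr_restrict (F' := F₁ + F₂) hr j.2 hs (by rw [hF, map_add, h₁, h₂]) ?_
    exact IsTrace.add hr j.2 hs F₁.2.1 F₂.2.1 (hv F₁ h₁ j) (hv' F₂ h₂ j)
  · intro c f v hv F hF j
    obtain ⟨F₁, h₁⟩ := hsurj f
    refine IsTrace.congr_restrict (F' := c • F₁) hr j.2 hs (by rw [hF, map_smul, h₁]) ?_
    exact (hv F₁ h₁ j).smul c

theorem traceNorm_le (hr : r₂ < r₁) (hs : 0 ≤ s₂) {F : HPerp T (d + 1) (chgOrder r₁ r₂ s₂)}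
    {v : TraceSpace T d r₁ r₂ s₂}
    (h : ∀ j : Fin r₁, IsTrace j (F : L2G T (d + 1)) (v j : L2G T d)) :
    traceNorm v ≤ ((r₁ * 4 : NNReal) : ℝ≥0∞) *
      polyNorm (chgOrder r₁ r₂ s₂) (F : L2G T (d + 1)) := by
  have hj : ∀ j : Fin r₁, polyNorm (traceOrder r₁ r₂ s₂ j) (v j : L2G T d) ≤
      4 * polyNorm (chgOrder r₁ r₂ s₂) (F : L2G T (d + 1)) := fun j => by
    obtain ⟨w, hw, hw'⟩ := exists_isTrace hr j.2 hs F.2.1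
    rwa [← (h j).unique hw] at hw'
  refine (Finset.sum_le_sum fun j _ => hj j).trans_eq ?_
  simp [mul_assoc]

theorem exists_extensionOperator_single (hr : r₂ < r₁) (hs : 0 ≤ s₂) (j : Fin r₁) :
    ∃ E : HPerp T d (traceOrder r₁ r₂ s₂ j) →ₗ[ℂ] HPerp T (d + 1) (chgOrder r₁ r₂ s₂),
      (∃ C : NNReal, ∀ v, polyNorm (chgOrder r₁ r₂ s₂) (E v : L2G T (d + 1)) ≤
        C * polyNorm (traceOrder r₁ r₂ s₂ j) (v : L2G T d)) ∧
      ∀ v, ∀ l : Fin r₁, IsTrace l (E v : L2G T (d + 1)) (if l = j then (v : L2G T d) else 0) := by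
  obtain ⟨η, hm, ⟨C, -, hC⟩, hη, hmom⟩ := exists_dual_moments r₁ j
  have hex : ∀ v : HPerp T d (traceOrder r₁ r₂ s₂ j), ∃ u : HPerp T (d + 1) (chgOrder r₁ r₂ s₂),
      IsExtension η r₁ r₂ s₂ j (v : L2G T d) (u : L2G T (d + 1)) ∧
      polyNorm (chgOrder r₁ r₂ s₂) (u : L2G T (d + 1)) ≤
        ENNReal.ofReal (2 ^ (r₁ + 6) * Real.pi * C ^ 2) ^ (1 / 2 : ℝ) *
          polyNorm (traceOrder r₁ r₂ s₂ j) (v : L2G T d) := fun v => by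
    obtain ⟨u, hu, hu'⟩ := exists_isExtension hr j.2 hs hm hC hη v.2.1
    refine ⟨⟨u, hu'.trans_lt (ENNReal.mul_lt_top ?_ v.2.1), hu.mem_oscillatory v.2.2⟩, hu, hu'⟩
    exact ENNReal.rpow_lt_top_of_nonneg (by norm_num) ENNReal.ofReal_ne_top
  -- The norm bound is left out of the relation since it is not additive with a fixed constant; it
  -- is recovered afterwards because the extension is unique.
  obtain ⟨E, hE⟩ := exists_linearMap_of_rel (R := ℂ)
    (V := HPerp T d (traceOrder r₁ r₂ s₂ j)) (W := HPerp T (d + 1) (chgOrder r₁ r₂ s₂))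
    (fun v u => IsExtension η r₁ r₂ s₂ j (v : L2G T d) (u : L2G T (d + 1)))
    (fun v => (hex v).imp fun u hu => hu.1) (fun v u u' h h' => Subtype.ext (h.unique h'))
    (fun v v' u u' h h' => h.add h') (fun c v u h => h.smul c)
  refine ⟨E, ⟨(ENNReal.ofReal (2 ^ (r₁ + 6) * Real.pi * C ^ 2) ^ (1 / 2 : ℝ)).toNNReal,
    fun v => ?_⟩, fun v l => ?_⟩
  · rw [ENNReal.coe_toNNReal
      (ENNReal.rpow_lt_top_of_nonneg (by norm_num) ENNReal.ofReal_ne_top).ne]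
    obtain ⟨u, hu, hu'⟩ := hex v
    rwa [(hE v).unique hu]
  · have h := (hE v).isTrace (l := l) (by simpa [Fin.ext_iff] using hmom l)
    simpa [Fin.ext_iff] using h

/-- The sum over `j` of the single extensions: in the trace of order `l` only the summand `j = l`
contributes. -/
theorem exists_extensionOperator (hr : r₂ < r₁) (hs : 0 ≤ s₂) :
    ∃ E : TraceSpace T d r₁ r₂ s₂ →ₗ[ℂ] HPerp T (d + 1) (chgOrder r₁ r₂ s₂),
      (∃ C : NNReal, ∀ σ, polyNorm (chgOrder r₁ r₂ s₂) (E σ : L2G T (d + 1)) ≤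
        C * traceNorm σ) ∧
      ∀ σ, ∀ l : Fin r₁, IsTrace l (E σ : L2G T (d + 1)) (σ l : L2G T d) := by
  choose E hC hE using fun j : Fin r₁ =>
    exists_extensionOperator_single (T := T) (d := d) hr hs j
  choose C hC using hC
  have hcoe : ∀ σ : TraceSpace T d r₁ r₂ s₂,
      (((∑ j, E j ∘ₗ LinearMap.proj j) σ : HPerp T (d + 1) (chgOrder r₁ r₂ s₂)) :
        L2G T (d + 1)) = ∑ j, (E j (σ j) : L2G T (d + 1)) := fun σ => by
    simp [LinearMap.sum_apply]
  refine ⟨∑ j, E j ∘ₗ LinearMap.proj j, ⟨2 ^ r₁ * ∑ j, C j, fun σ => ?_⟩, fun σ l => ?_⟩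
  · rw [hcoe]
    refine (polyNorm_sum_le _ _ _).trans ?_
    rw [Finset.card_univ, Fintype.card_fin, ENNReal.coe_mul, ENNReal.coe_pow, ENNReal.coe_ofNat,
      mul_assoc]
    refine mul_le_mul' le_rfl ?_
    rw [traceNorm, Finset.mul_sum]
    refine (Finset.sum_le_sum fun j _ => (hC j (σ j)).trans ?_)
    exact mul_le_mul' (ENNReal.coe_le_coe.2
      (Finset.single_le_sum (fun _ _ => zero_le) (Finset.mem_univ j))) le_rfl
  · rw [hcoe]
    have h := IsTrace.sum hr l.2 hs Finset.univ (fun j => (E j (σ j)).2.1)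
      (fun j => hE j (σ j) l)
    simpa using h

end operators

end NewtonTrace

theorem mainTheorem5 (T : ℝ) [hT : Fact (0 < T)] (d r₁ r₂ : ℕ) (hr : r₂ < r₁) (s₂ : ℝ)
    (hs : 0 ≤ s₂) :
    -- the Newton polygon of `T_j(μ)` is that of `μ`, translated to the left by `j + 1/2`
    (∀ j : ℕ, j < r₁ → orderPolygon (traceOrder r₁ r₂ s₂ j) =
      {p : ℝ × ℝ | 0 ≤ p.1 ∧ 0 ≤ p.2 ∧
        (p.1 + ((j : ℝ) + 1 / 2), p.2) ∈ orderPolygon (chgOrder r₁ r₂ s₂)}) ∧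
    ∃ (Tr : HBarPerp T d (chgOrder r₁ r₂ s₂) →ₗ[ℂ] TraceSpace T d r₁ r₂ s₂)
      (E : TraceSpace T d r₁ r₂ s₂ →ₗ[ℂ] HPerp T (d + 1) (chgOrder r₁ r₂ s₂)),
      -- the trace on the half space is bounded
      (∃ C : NNReal, ∀ u, traceNorm (Tr u) ≤
        C * barNorm (chgOrder r₁ r₂ s₂) (u : L2Half T d)) ∧
      -- hence so is the trace on the whole space
      (∃ C : NNReal, ∀ u : HPerp T (d + 1) (chgOrder r₁ r₂ s₂),
        traceNorm (Tr (restrictPerp T d _ u)) ≤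
          C * polyNorm (chgOrder r₁ r₂ s₂) (u : L2G T (d + 1))) ∧
      -- it extends the classical trace of test functions
      (∀ φ : TorusSpace T (d + 1) → ℂ, IsOscillatoryTest φ →
        ∃ u : HPerp T (d + 1) (chgOrder r₁ r₂ s₂),
          (u : L2G T (d + 1)) =ᵐ[torusMeasure T (d + 1)] φ ∧
          ∀ j : Fin r₁, (Tr (restrictPerp T d _ u) j : L2G T d)
            =ᵐ[torusMeasure T d] classicalTrace j φ) ∧
      -- it is onto, and `E` is a bounded right inverse
      Function.Surjective Tr ∧
      (∃ C : NNReal, ∀ σ, polyNorm (chgOrder r₁ r₂ s₂) (E σ : L2G T (d + 1)) ≤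
        C * traceNorm σ) ∧
      (∀ σ, Tr (restrictPerp T d _ (E σ)) = σ) := by
  refine ⟨fun j hj => orderPolygon_traceOrder hr hs hj, ?_⟩
  obtain ⟨Tr, hTr⟩ := exists_traceOperator (T := T) (d := d) hr hs
  obtain ⟨E, hEC, hE⟩ := exists_extensionOperator (T := T) (d := d) hr hs
  have hinv : ∀ σ, Tr (restrictPerp T d _ (E σ)) = σ := fun σ =>
    funext fun l => Subtype.ext ((hTr (E σ) l).unique (hE σ l))
  refine ⟨Tr, E, ⟨r₁ * 4, fun u => ?_⟩, ⟨r₁ * 4, fun u => traceNorm_le hr hs (hTr u)⟩,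
    fun φ hφ => ?_, fun σ => ⟨_, hinv σ⟩, hEC, hinv⟩
  · have h0 : ((r₁ * 4 : NNReal) : ℝ≥0∞) ≠ 0 := by
      simpa using (Nat.zero_le r₂).trans_lt hr |>.ne'
    -- Dividing by the constant, which is nonzero because `r₁ > 0`, isolates the infimum over
    -- representatives, so that the bound can be checked on each of them.
    rw [← ENNReal.div_le_iff' h0 ENNReal.coe_ne_top]
    refine le_iInf₂ fun F hF => ?_
    rw [ENNReal.div_le_iff' h0 ENNReal.coe_ne_top]
    have e : restrictPerp T d _ ⟨F, hF.1⟩ = u := Subtype.ext hF.2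
    have h := traceNorm_le hr hs (hTr ⟨F, hF.1⟩)
    rwa [e] at h
  · have hu : testLp hφ.isTest ∈ HPerp T (d + 1) (chgOrder r₁ r₂ s₂) :=
      Submodule.mem_inf.2 ⟨hφ.isTest.polyNorm_lt_top hr hs, hφ.mem_oscillatory⟩
    refine ⟨⟨testLp hφ.isTest, hu⟩, coeFn_testLp hφ.isTest, fun j => ?_⟩
    have h := (hTr ⟨testLp hφ.isTest, hu⟩ j).unique (hφ.isTest.isTrace j)
    rw [h]
    exact coeFn_testLp (hφ.isTest.classicalTrace j)
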